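/- **Theorem.** Let $n\ge 1$, let $\alpha_1,\dots,\alpha_m$ be distinct nonzero real numbers, and let $0\le\theta_0<1$, $0<\theta_k<1$ $(1\le k\le m)$ satisfy $\theta_0+\sum_{k=1}^m\theta_k=1$. Let $K$ be a complex-valued measurable function on $\mathbb R^n\times\mathbb R^n$, differentiable in $y$ at all points with $x\ne0$ and $x\neq\alpha_k y$ for every $k$, such that at these points $$|K(x,y)|\le A\,|x|^{-\theta_0 n}\prod_{k=1}^m|x-\alpha_k y|^{-\theta_k n},\qquad |\nabla_y K(x,y)|\le B\,|x|^{-\theta_0 n}\sum_{k=1}^m|x-\alpha_k y|^{-\theta_k n-1}\prod_{j\ne k}|x-\alpha_j y|^{-\theta_j n}.$$ For a real polynomial $P$ on $\mathbb R^n\times\mathbb R^n$ let $$T_Pf(x)=\int_{\mathbb R^n}e^{iP(x,y)}K(x,y)f(y)\,dy .$$ An $H^1_E$ atom associated to $P$ is a measurable function $a$ for which there is a cube $Q$ with sides parallel to the axes and center $x_Q$ such that $\operatorname{supp}a\subset Q$, $|a|\le|Q|^{-1}$ a.e. on $Q$, and $\int e^{iP(x_Q,y)}a(y)\,dy=0$.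 The space $H^1_E(\mathbb R^n;P)$ consists of all $f\in L^1(\mathbb R^n)$ of the form $f=\sum_j\lambda_ja_j$ with atoms $a_j$ associated to $P$ and $\lambda_j\in\mathbb C$, $\sum_j|\lambda_j|<\infty$; the norm $\|f\|_{H^1_E}$ is the infimum of $\sum_j|\lambda_j|$ over all such decompositions. Then: 1. For every $p$ with $1<p<\theta_0^{-1}$ (that is, $1<p<\infty$ if $\theta_0=0$) and every $f\in L^p(\mathbb R^n)$, the integral defining $T_Pf(x)$ converges absolutely for a.e. $x$, and $\|T_Pf\|_{L^p}\le C_p\|f\|_{L^p}$. 2. For every $f\in H^1_E(\mathbb R^n;P)$, the integral defining $T_Pf(x)$ converges absolutely for a.e. $x$, and $\|T_Pf\|_{L^1}\le C\|f\|_{H^1_E}$. Here $C_p$ and $C$ depend on $P$ only through its degree, not on its coefficients; apart from that they depend only on $n$, $m$, the $\theta$'s, the $\alpha_k$, $A$, $B$, and (for $C_p$) on $p$. -/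

import Mathlib

open MeasureTheory
open scoped ENNReal NNReal

noncomputable section

/-- The value `P(x, y)` of a real polynomial in `2n` variables at `x, y ∈ ℝⁿ`. -/
def phase {n : ℕ} (P : MvPolynomial (Fin n ⊕ Fin n) ℝ) (x y : EuclideanSpace ℝ (Fin n)) : ℝ :=
  MvPolynomial.eval (Sum.elim (fun i => x i) (fun i => y i)) P

/-- The kernel `K` is measurable on `ℝⁿ × ℝⁿ`, it is differentiable in `y` away from the
singular set `{x = 0} ∪ ⋃ₖ {x = αₖ y}`, and there it satisfies the size bound (constant `A`) and
the bound on the `y`-gradient (constant `B`) of product type with exponents `θ₀, θₖ`. -/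
structure IsProductTypeKernel {n m : ℕ} (θ₀ : ℝ) (θ α : Fin m → ℝ) (A B : ℝ)
    (K : EuclideanSpace ℝ (Fin n) → EuclideanSpace ℝ (Fin n) → ℂ) : Prop where
  measurable : AEStronglyMeasurable
    (fun z : EuclideanSpace ℝ (Fin n) × EuclideanSpace ℝ (Fin n) => K z.1 z.2)
    (volume.prod volume)
  size : ∀ x y, x ≠ 0 → (∀ k, x ≠ α k • y) →
    ‖K x y‖ ≤ A * (‖x‖ ^ (-(θ₀ * n)) * ∏ k, ‖x - α k • y‖ ^ (-(θ k * n)))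
  differentiable : ∀ x y, x ≠ 0 → (∀ k, x ≠ α k • y) → DifferentiableAt ℝ (K x) y
  gradient : ∀ x y, x ≠ 0 → (∀ k, x ≠ α k • y) →
    ‖fderiv ℝ (K x) y‖ ≤ B * (‖x‖ ^ (-(θ₀ * n)) *
      ∑ k, ‖x - α k • y‖ ^ (-(θ k * n) - 1) *
        ∏ j ∈ Finset.univ.erase k, ‖x - α j • y‖ ^ (-(θ j * n)))

/-- The integrand `y ↦ exp(i P(x,y)) K(x,y) f(y)` of the oscillatory integral. -/
def oscIntegrand {n : ℕ} (P : MvPolynomial (Fin n ⊕ Fin n) ℝ)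
    (K : EuclideanSpace ℝ (Fin n) → EuclideanSpace ℝ (Fin n) → ℂ)
    (f : EuclideanSpace ℝ (Fin n) → ℂ) (x y : EuclideanSpace ℝ (Fin n)) : ℂ :=
  Complex.exp (Complex.I * (phase P x y : ℂ)) * K x y * f y

/-- The operator `T_P f(x) = ∫ exp(i P(x,y)) K(x,y) f(y) dy`. -/
def oscOperator {n : ℕ} (P : MvPolynomial (Fin n ⊕ Fin n) ℝ)
    (K : EuclideanSpace ℝ (Fin n) → EuclideanSpace ℝ (Fin n) → ℂ)
    (f : EuclideanSpace ℝ (Fin n) → ℂ) (x : EuclideanSpace ℝ (Fin n)) : ℂ :=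
  ∫ y, oscIntegrand P K f x y

/-- The closed cube with center `c`, sides parallel to the axes, and side length `2 r`. -/
def axisCube {n : ℕ} (c : EuclideanSpace ℝ (Fin n)) (r : ℝ) : Set (EuclideanSpace ℝ (Fin n)) :=
  {y | ∀ i, |y i - c i| ≤ r}

/-- `a` is an `H¹_E` atom associated to the polynomial `P`. -/
def IsHardyEAtom {n : ℕ} (P : MvPolynomial (Fin n ⊕ Fin n) ℝ)
    (a : EuclideanSpace ℝ (Fin n) → ℂ) : Prop :=
  AEStronglyMeasurable a volume ∧
  ∃ (c : EuclideanSpace ℝ (Fin n)) (r : ℝ), 0 < r ∧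
    Function.support a ⊆ axisCube c r ∧
    (∀ᵐ x, x ∈ axisCube c r → ‖a x‖ ≤ (volume.real (axisCube c r))⁻¹) ∧
    ∫ y, Complex.exp (Complex.I * (phase P c y : ℂ)) * a y = 0

/-- `f = ∑ⱼ lⱼ aⱼ` with atoms `aⱼ` associated to `P` and `∑ⱼ |lⱼ| < ∞`. Atoms have `L¹` norm at
most `1`, so convergence almost everywhere and convergence in `L¹` are the same here. -/
structure IsAtomicDecomposition {n : ℕ} (P : MvPolynomial (Fin n ⊕ Fin n) ℝ)
    (f : EuclideanSpace ℝ (Fin n) → ℂ) (l : ℕ → ℂ)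
    (a : ℕ → EuclideanSpace ℝ (Fin n) → ℂ) : Prop where
  atom : ∀ j, IsHardyEAtom P (a j)
  summable : Summable fun j => ‖l j‖
  hasSum : ∀ᵐ x, HasSum (fun j => l j * a j x) (f x)

/-- Membership in `H¹_E(ℝⁿ; P)`. -/
def MemHardyE {n : ℕ} (P : MvPolynomial (Fin n ⊕ Fin n) ℝ)
    (f : EuclideanSpace ℝ (Fin n) → ℂ) : Prop :=
  MemLp f 1 volume ∧ ∃ l a, IsAtomicDecomposition P f l a

/-- The norm of `H¹_E(ℝⁿ; P)`: the infimum of `∑ⱼ |lⱼ|` over all atomic decompositions. -/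
def hardyENorm {n : ℕ} (P : MvPolynomial (Fin n ⊕ Fin n) ℝ)
    (f : EuclideanSpace ℝ (Fin n) → ℂ) : ℝ≥0∞ :=
  ⨅ (l : ℕ → ℂ) (a : ℕ → EuclideanSpace ℝ (Fin n) → ℂ) (_ : IsAtomicDecomposition P f l a),
    ∑' j, ‖l j‖ₑ

end

/-!
The first part of the theorem uses no oscillation. The kernel is dominated by the positive kernel
`productKernel`, homogeneous of degree `-n`. Since the `αₖ` are distinct and nonzero, at most one of
the points `0`, `αₖ y` is much closer to `x` than `‖x‖ + ‖y‖`, so `productKernel` is at most a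
constant times a sum of kernels with a single singularity (`exists_productKernel_le`). These map
powers `‖y‖ ^ (-b)` to functions bounded by multiples of `‖x‖ ^ (-b)`, and Schur's test with power
weights gives the bound on `L^p` in the range `θ₀ p < 1` (`exists_lintegral_productKernel_rpow_le`).

For the second part it is enough to bound `T_P a` in `L¹` uniformly over atoms `a`
(`exists_lintegral_oscOperator_atom_le`); the sum over an atomic decomposition may be integrated
term by term at almost every point, because the positive operator applied to atoms is uniformly
bounded in `L¹` of every annulus centered at the origin. Let `a` be an atom on a cube of center `c`
and side `2r`, and let `ρ = ‖c‖ + √n r`, so that the cube lies in the ball of radius `ρ`.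

* On the ball `‖x‖ ≤ Λ ρ` the oscillation is discarded: testing the positive operator against
  `‖x‖ ^ (-b)` reduces the estimate to the average of `‖y‖ ^ (-b)` over the cube, which is
  comparable to `ρ ^ (-b)` even when the cube contains the origin (`exists_lintegral_near_le`).
* Outside this ball all singularities of the kernel are far away. Replacing `K (x, y)` by `K (x, c)`
  costs `r (ρ + ‖x‖) ^ (-n - 1)`, which has integral at most a constant times `r / ρ ≤ 1`. What
  remains is `‖x - c‖ ^ (-n)` times the oscillatory integral `∫ exp (i P(x, y)) a(y) dy`
  (`enorm_oscOperator_atom_le_of_far`).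

The last term is the heart of the matter (`exists_lintegral_osc_atom_le`). On the dyadic shell
`‖x - c‖ ∼ 2 ^ j r` both variables are rescaled to the unit cube. Let `S_j` be the sum of the
absolute values of those coefficients of the rescaled phase `Q_j (u, v)` which belong to monomials
containing both a `u` and a `v` variable. Cancellation of `a` against `exp (i Q_j (0, ·))` bounds
the contribution of the shell by a multiple of `S_j`. On the other hand the `TT*` method together
with the decay of oscillatory integrals with polynomial phase bounds it by a multiple of
`S_j ^ (-ε)`, with `ε > 0` depending only on the degree. As `S_j` at least doubles with each step,
the sum over `j` is bounded by a constant which does not depend on the coefficients of `P`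
(`tsum_le_of_doubling`).

The decay estimates are uniform in the coefficients because of one fact: on the unit cube a small
negative power of a polynomial of degree at most `d` has an integral bounded by the same negative
power of any coefficient (`exists_lintegral_multiPoly_rpow_neg_le`). In one variable this follows by
factoring the polynomial over `ℂ` and comparing the product over its roots with the Mahler measure,
which controls every coefficient; the general case is an induction on the dimension. Decay of the
one-dimensional oscillatory integral follows by an integration by parts
(`exists_enorm_integral_exp_poly_le`).
-/

/-! ### Negative powers of polynomials on cubes -/

/-- Lebesgue measure on the interval `[-1, 1]`. -/
noncomputable def intervalMeasure : Measure ℝ := volume.restrict (Set.Icc (-1) 1)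

/-- Lebesgue measure on the cube `[-1, 1]ⁿ`. -/
noncomputable def cubeMeasure (n : ℕ) : Measure (Fin n → ℝ) := Measure.pi fun _ => intervalMeasure

instance : IsFiniteMeasure intervalMeasure := by
  unfold intervalMeasure; infer_instance

instance (n : ℕ) : IsFiniteMeasure (cubeMeasure n) := by
  unfold cubeMeasure; infer_instance

lemma intervalMeasure_univ : intervalMeasure Set.univ = 2 := by
  simp only [intervalMeasure, Measure.restrict_apply_univ, Real.volume_Icc]
  norm_num

lemma cubeMeasure_univ (n : ℕ) : cubeMeasure n Set.univ = 2 ^ n := by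
  simp [cubeMeasure, Measure.pi_univ, intervalMeasure_univ]

lemma ae_intervalMeasure_abs_le : ∀ᵐ t ∂intervalMeasure, |t| ≤ 1 := by
  filter_upwards [ae_restrict_mem (μ := volume) (measurableSet_Icc (a := (-1 : ℝ)) (b := 1))]
    with t ht using abs_le.2 ht

lemma ae_cubeMeasure_abs_le (n : ℕ) : ∀ᵐ u ∂cubeMeasure n, ∀ i, |u i| ≤ 1 := by
  rw [ae_all_iff]
  intro i
  exact (Measure.tendsto_eval_ae_ae (μ := fun _ : Fin n => intervalMeasure) (i := i)).eventually
    ae_intervalMeasure_abs_le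

/-- A product of at most `N` factors is bounded by one plus the sum of the `N`-th powers. -/
lemma multiset_prod_le_one_add_sum_pow {N : ℕ} (hN : N ≠ 0) (s : Multiset ℝ≥0∞)
    (hs : s.card ≤ N) : s.prod ≤ 1 + (s.map (· ^ N)).sum := by
  set T := 1 + (s.map (· ^ N)).sum with hT
  have hT1 : 1 ≤ T := le_self_add
  have hN' : (0 : ℝ) < N := by positivity
  have hx : ∀ x ∈ s, x ≤ T ^ ((N : ℝ)⁻¹) := by
    intro x hx
    have h1 : x ^ N ≤ T :=
      (Multiset.single_le_sum (fun _ _ => zero_le) _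
        (Multiset.mem_map_of_mem (· ^ N) hx)).trans le_add_self
    rw [ENNReal.le_rpow_inv_iff hN', ENNReal.rpow_natCast]
    exact h1
  calc s.prod ≤ (T ^ ((N : ℝ)⁻¹)) ^ s.card := Multiset.prod_le_pow_card _ _ hx
    _ ≤ (T ^ ((N : ℝ)⁻¹)) ^ N :=
        pow_le_pow_right₀ (ENNReal.one_le_rpow hT1 (by positivity)) hs
    _ = T := by
        rw [← ENNReal.rpow_natCast, ← ENNReal.rpow_mul, inv_mul_cancel₀ hN'.ne',
          ENNReal.rpow_one]

lemma exists_lintegral_inv_sqrt_le :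
    ∃ C : ℝ≥0, ∀ x : ℝ, ∫⁻ t, ‖t - x‖ₑ ^ (-(1 / 2) : ℝ) ∂intervalMeasure ≤ C := by
  have hfin : ∫⁻ t in Metric.ball (0 : ℝ) 1, ‖t‖ₑ ^ (-(1 / 2) : ℝ) < ∞ := by
    have h := integrableOn_ball_of_norm_le_rpow (E := ℝ) (μ := volume) (by simp)
      (f := fun t : ℝ => ‖t‖ ^ (-(1 / 2) : ℝ)) (C := 1) (α := 1 / 2) (r := 1)
      (by simp; norm_num) (by
        refine Filter.Eventually.of_forall fun t => ?_
        rw [Real.norm_of_nonneg (by positivity), one_mul])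
      (by have : Measurable fun t : ℝ => ‖t‖ ^ (-(1 / 2) : ℝ) := by measurability
          exact this.aestronglyMeasurable)
    have h2 := h.2
    rw [hasFiniteIntegral_iff_enorm] at h2
    refine lt_of_le_of_lt (lintegral_mono_ae ?_) h2
    filter_upwards [ae_restrict_of_ae (Measure.ae_ne volume (0 : ℝ))] with t ht
    rw [Real.enorm_of_nonneg (r := ‖t‖ ^ (-(1 / 2) : ℝ)) (by positivity),
      ← ENNReal.ofReal_rpow_of_pos (norm_pos_iff.2 ht), ofReal_norm]
  refine ⟨2 + (∫⁻ t in Metric.ball (0 : ℝ) 1, ‖t‖ₑ ^ (-(1 / 2) : ℝ)).toNNReal, fun x => ?_⟩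
  rw [ENNReal.coe_add, ENNReal.coe_toNNReal hfin.ne]
  have hpt : ∀ t, ‖t - x‖ₑ ^ (-(1 / 2) : ℝ) ≤
      1 + (Metric.ball (0 : ℝ) 1).indicator (fun s => ‖s‖ₑ ^ (-(1 / 2) : ℝ)) (t - x) := by
    intro t
    by_cases h : t - x ∈ Metric.ball (0 : ℝ) 1
    · simp only [h, Set.indicator_of_mem]; exact le_add_self
    · refine le_trans ?_ le_self_add
      apply ENNReal.rpow_le_one_of_one_le_of_neg _ (by norm_num)
      rw [mem_ball_zero_iff, not_lt] at h
      rw [← ofReal_norm]; simpa using h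
  calc ∫⁻ t, ‖t - x‖ₑ ^ (-(1 / 2) : ℝ) ∂intervalMeasure
      ≤ ∫⁻ t, (1 + (Metric.ball (0 : ℝ) 1).indicator (fun s => ‖s‖ₑ ^ (-(1 / 2) : ℝ)) (t - x))
        ∂intervalMeasure := lintegral_mono hpt
    _ = 2 + ∫⁻ t, (Metric.ball (0 : ℝ) 1).indicator (fun s => ‖s‖ₑ ^ (-(1 / 2) : ℝ)) (t - x)
        ∂intervalMeasure := by
        rw [lintegral_add_left measurable_const, lintegral_const, intervalMeasure_univ, one_mul]
    _ ≤ 2 + ∫⁻ t, (Metric.ball (0 : ℝ) 1).indicator (fun s => ‖s‖ₑ ^ (-(1 / 2) : ℝ)) (t - x) := by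
        gcongr; exact Measure.restrict_le_self
    _ = _ := by
        rw [lintegral_sub_right_eq_self (fun t => (Metric.ball (0 : ℝ) 1).indicator
          (fun s => ‖s‖ₑ ^ (-(1 / 2) : ℝ)) t) x, lintegral_indicator measurableSet_ball]
        rfl

lemma rpow_neg_le_of_le_mul {M X G : ℝ≥0∞} {e : ℝ} (he : 0 < e) (hM : M ≠ 0) (hG : G ≠ ∞)
    (hX : X ≠ ∞) (h : M ≤ X * G) : X ^ (-e) ≤ G ^ e * M ^ (-e) := by
  have hG0 : G ≠ 0 := by rintro rfl; simp at h; exact hM h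
  have h1 : (X * G) ^ (-e) ≤ M ^ (-e) := by
    rw [ENNReal.rpow_neg, ENNReal.rpow_neg]
    exact ENNReal.inv_le_inv.2 (ENNReal.rpow_le_rpow h he.le)
  rw [ENNReal.mul_rpow_of_ne_top hX hG] at h1
  calc X ^ (-e) = G ^ e * (X ^ (-e) * G ^ (-e)) := by
        rw [mul_left_comm, ← ENNReal.rpow_add _ _ hG0 hG]; simp
    _ ≤ _ := by gcongr

/-- For a polynomial of degree at most `d` on `[-1, 1]`, the integral of a small negative power is
controlled by the same power of any of its coefficients. After factoring, the product of the
distances to the roots is compared with the Mahler measure, which dominates all coefficients. -/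
lemma exists_lintegral_poly_rpow_neg_le (d : ℕ) {e : ℝ} (he : 0 < e) (hed : e * (d + 1) ≤ 1 / 2) :
    ∃ C : ℝ≥0, 1 ≤ C ∧ ∀ (b : Fin (d + 1) → ℝ) (k : Fin (d + 1)),
      ∫⁻ t, ‖∑ j, b j * t ^ (j : ℕ)‖ₑ ^ (-e) ∂intervalMeasure ≤ C * ‖b k‖ₑ ^ (-e) := by
  obtain ⟨C₀, hC₀⟩ := exists_lintegral_inv_sqrt_le
  set C₁ : ℝ≥0 := 2 ^ (1 / 2 : ℝ) * 2 + 2 ^ (1 / 2 : ℝ) * C₀ with hC₁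
  set C₂ : ℝ≥0 := (2 + d * C₁) * (2 ^ d) ^ e with hC₂
  refine ⟨C₂, ?_, fun b k => ?_⟩
  · have : (1 : ℝ≥0) ≤ 2 ^ d := one_le_pow₀ (by norm_num)
    have h2 : (1 : ℝ≥0) ≤ (2 ^ d) ^ e := NNReal.one_le_rpow this he.le
    have h3 : (1 : ℝ≥0) ≤ 2 + d * C₁ := le_trans (by norm_num) le_self_add
    exact one_le_mul h3 h2
  -- The right side is infinite if `b k = 0`.
  by_cases hbk : b k = 0
  · have : C₂ ≠ 0 := by positivity
    simp [hbk, he, ENNReal.mul_top, this]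
  let p : Polynomial ℂ := ∑ j : Fin (d + 1), Polynomial.C (b j : ℂ) * Polynomial.X ^ (j : ℕ)
  have hcoeff : p.coeff k = b k := by
    simp [p, Polynomial.finsetSum_coeff, Polynomial.coeff_C_mul, Polynomial.coeff_X_pow,
      Fin.val_inj]
  have hp : p ≠ 0 := by
    intro h; rw [h] at hcoeff; simp at hcoeff; exact hbk (by exact_mod_cast hcoeff.symm)
  have hdeg : p.natDegree ≤ d := by
    apply Polynomial.natDegree_sum_le_of_forall_le
    intro j _
    exact (Polynomial.natDegree_C_mul_X_pow_le _ _).trans (Nat.lt_succ_iff.1 j.2)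
  have hcard : p.roots.card ≤ d := (Polynomial.card_roots' p).trans hdeg
  have hsplit : p.Splits := IsAlgClosed.splits p
  have heval : ∀ t : ℝ, ‖∑ j, b j * t ^ (j : ℕ)‖ = ‖p.leadingCoeff‖ *
      (p.roots.map fun z => ‖(t : ℂ) - z‖).prod := by
    intro t
    have h1 : ((∑ j, b j * t ^ (j : ℕ) : ℝ) : ℂ) = p.eval (t : ℂ) := by
      simp [p, Polynomial.eval_finsetSum]
    have h2 := hsplit.eval_eq_prod_roots (x := (t : ℂ))
    rw [← Complex.norm_real, h1, h2, norm_mul]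
    congr 1
    have h3 := map_multiset_prod (normHom : ℂ →*₀ ℝ) (p.roots.map fun x => (t : ℂ) - x)
    rw [Multiset.map_map] at h3
    exact h3
  have hM : ‖b k‖ ≤ 2 ^ d * (‖p.leadingCoeff‖ * (p.roots.map fun z => max 1 ‖z‖).prod) := by
    rw [← Polynomial.mahlerMeasure_eq_leadingCoeff_mul_prod_roots, ← Complex.norm_real, ← hcoeff]
    refine (Polynomial.norm_coeff_le_choose_mul_mahlerMeasure _ p).trans ?_
    have : (p.natDegree.choose k : ℝ) ≤ 2 ^ d := by
      have h1 : p.natDegree.choose k ≤ 2 ^ p.natDegree := Nat.choose_le_two_pow _ _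
      have h2 : 2 ^ p.natDegree ≤ 2 ^ d := Nat.pow_le_pow_right (by norm_num) hdeg
      exact_mod_cast h1.trans h2
    gcongr
    exact Polynomial.mahlerMeasure_nonneg p
  -- The factor `max 1 ‖z‖` of the Mahler measure is at most `g z t` times the distance from `t`
  -- to the root `z`, and `g z` to the power `1 / 2` is integrable uniformly in `z`.
  let g : ℂ → ℝ → ℝ := fun z t => 2 + 2 * |t - z.re|⁻¹
  have hg1 : ∀ z t, 1 ≤ g z t := fun z t => by
    have : 0 ≤ |t - z.re|⁻¹ := by positivity
    simp only [g]; linarith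
  have hgz : ∀ (z : ℂ) (t : ℝ), |t| ≤ 1 → t ≠ z.re → max 1 ‖z‖ ≤ ‖(t : ℂ) - z‖ * g z t := by
    intro z t ht htz
    have h0 : 0 < |t - z.re| := abs_pos.2 (sub_ne_zero.2 htz)
    have h1 : |t - z.re| ≤ ‖(t : ℂ) - z‖ := by
      simpa using Complex.abs_re_le_norm ((t : ℂ) - z)
    have h2 : ‖z‖ ≤ ‖(t : ℂ) - z‖ + 1 := by
      have : ‖z‖ ≤ ‖(t : ℂ) - z‖ + ‖(t : ℂ)‖ := by
        rw [norm_sub_rev]; simpa using norm_add_le (z - t) (t : ℂ)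
      rw [Complex.norm_real, Real.norm_eq_abs] at this
      linarith
    have h3 : 2 ≤ ‖(t : ℂ) - z‖ * (2 * |t - z.re|⁻¹) := by
      rw [mul_left_comm, ← div_eq_mul_inv]
      have : 1 ≤ ‖(t : ℂ) - z‖ / |t - z.re| := (one_le_div h0).2 h1
      linarith
    have h4 : 0 ≤ ‖(t : ℂ) - z‖ := norm_nonneg _
    simp only [g, mul_add]
    apply max_le <;> linarith
  have hae : ∀ᵐ t ∂intervalMeasure, ∀ z ∈ p.roots.toFinset, t ≠ z.re := by
    refine ae_restrict_of_ae ?_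
    rw [Filter.eventually_all_finset]
    intro z _
    exact Measure.ae_ne volume z.re
  have hpt : ∀ᵐ t ∂intervalMeasure, ‖∑ j, b j * t ^ (j : ℕ)‖ₑ ^ (-e) ≤
      (1 + (p.roots.map fun z => ENNReal.ofReal (g z t) ^ (1 / 2 : ℝ)).sum) *
        (((2 : ℝ≥0∞) ^ d) ^ e * ‖b k‖ₑ ^ (-e)) := by
    filter_upwards [hae, ae_intervalMeasure_abs_le] with t ht ht1
    set G : ℝ≥0∞ := (p.roots.map fun z => ENNReal.ofReal (g z t)).prod with hG
    have hGr : G = ENNReal.ofReal ((p.roots.map fun z => g z t).prod) := by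
      rw [hG]
      have : ∀ s : Multiset ℂ, (s.map fun z => ENNReal.ofReal (g z t)).prod =
          ENNReal.ofReal ((s.map fun z => g z t).prod) := by
        intro s
        induction s using Multiset.induction with
        | empty => simp
        | cons a s ih =>
          simp only [Multiset.map_cons, Multiset.prod_cons, ih]
          rw [ENNReal.ofReal_mul (by linarith [hg1 a t])]
      exact this _
    have hprod : (p.roots.map fun z => max 1 ‖z‖).prod ≤
        (p.roots.map fun z => ‖(t : ℂ) - z‖).prod * (p.roots.map fun z => g z t).prod := by
      rw [← Multiset.prod_map_mul]
      apply Multiset.prod_map_le_prod_map₀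
      · intro z _; positivity
      · intro z hz
        exact hgz z t ht1 (ht z (Multiset.mem_toFinset.2 hz))
    have hkey : ‖b k‖ₑ ≤ ‖∑ j, b j * t ^ (j : ℕ)‖ₑ * (2 ^ d * G) := by
      rw [← ofReal_norm, ← ofReal_norm, heval t, hGr]
      have h2d : (2 : ℝ≥0∞) ^ d = ENNReal.ofReal (2 ^ d) := by
        rw [ENNReal.ofReal_pow (by norm_num)]; norm_num
      rw [h2d, ← ENNReal.ofReal_mul (by positivity), ← ENNReal.ofReal_mul]
      swap
      · refine mul_nonneg (norm_nonneg _) (Multiset.prod_nonneg ?_)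
        intro x hx; obtain ⟨z, _, rfl⟩ := Multiset.mem_map.1 hx; exact norm_nonneg _
      apply ENNReal.ofReal_le_ofReal
      refine hM.trans ?_
      have := mul_le_mul_of_nonneg_left hprod
        (mul_nonneg (by positivity : (0 : ℝ) ≤ 2 ^ d) (norm_nonneg p.leadingCoeff))
      calc _ = _ := by ring
        _ ≤ _ := this
        _ = _ := by ring
    have hGtop : G ≠ ∞ := by rw [hGr]; exact ENNReal.ofReal_ne_top
    refine (rpow_neg_le_of_le_mul he (by simpa using hbk)
      (ENNReal.mul_ne_top (by simp) hGtop) (by simp) hkey).trans ?_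
    rw [ENNReal.mul_rpow_of_nonneg _ _ he.le, mul_comm (((2 : ℝ≥0∞) ^ d) ^ e), mul_assoc]
    gcongr
    have hGe : G ^ e = (p.roots.map fun z => ENNReal.ofReal (g z t) ^ e).prod := by
      have : ∀ s : Multiset ℂ, (s.map fun z => ENNReal.ofReal (g z t)).prod ^ e =
          (s.map fun z => ENNReal.ofReal (g z t) ^ e).prod := by
        intro s
        induction s using Multiset.induction with
        | empty => simp
        | cons a s ih =>
          simp only [Multiset.map_cons, Multiset.prod_cons, ← ih]
          rw [ENNReal.mul_rpow_of_nonneg _ _ he.le]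
      exact this _
    rw [hGe]
    refine (multiset_prod_le_one_add_sum_pow (Nat.succ_ne_zero d) _
      (by simpa using hcard.trans (Nat.le_succ d))).trans ?_
    gcongr
    rw [Multiset.map_map]
    apply Multiset.sum_map_le_sum_map
    intro z _
    simp only [Function.comp]
    rw [← ENNReal.rpow_natCast, ← ENNReal.rpow_mul]
    apply ENNReal.rpow_le_rpow_of_exponent_le
    · simpa using hg1 z t
    · simpa using hed
  have hmeas : ∀ z, Measurable fun t => ENNReal.ofReal (g z t) ^ (1 / 2 : ℝ) := by
    intro z; simp only [g]; fun_prop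
  have hz : ∀ z, ∫⁻ t, ENNReal.ofReal (g z t) ^ (1 / 2 : ℝ) ∂intervalMeasure ≤ C₁ := by
    intro z
    have h1 : ∀ᵐ t ∂intervalMeasure, ENNReal.ofReal (g z t) ^ (1 / 2 : ℝ) ≤
        2 ^ (1 / 2 : ℝ) + 2 ^ (1 / 2 : ℝ) * ‖t - z.re‖ₑ ^ (-(1 / 2) : ℝ) := by
      filter_upwards [ae_restrict_of_ae (Measure.ae_ne volume z.re)] with t ht
      have h0 : 0 < |t - z.re| := abs_pos.2 (sub_ne_zero.2 ht)
      have : ENNReal.ofReal (g z t) = 2 + 2 * ‖t - z.re‖ₑ⁻¹ := by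
        simp only [g]
        rw [ENNReal.ofReal_add (by norm_num) (by positivity), ENNReal.ofReal_mul (by norm_num),
          ENNReal.ofReal_inv_of_pos h0, Real.enorm_eq_ofReal_abs]
        norm_num
      rw [this]
      refine (ENNReal.rpow_add_le_add_rpow _ _ (by norm_num) (by norm_num)).trans ?_
      rw [ENNReal.mul_rpow_of_nonneg _ _ (by norm_num : (0 : ℝ) ≤ 1 / 2), ENNReal.inv_rpow,
        ← ENNReal.rpow_neg]
    refine (lintegral_mono_ae h1).trans ?_
    rw [lintegral_add_left measurable_const, lintegral_const, intervalMeasure_univ,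
      lintegral_const_mul _ (by fun_prop), hC₁]
    push_cast
    rw [ENNReal.coe_rpow_of_nonneg _ (by norm_num)]
    push_cast
    gcongr
    exact hC₀ _
  refine (lintegral_mono_ae hpt).trans ?_
  have hsum : ∀ s : Multiset ℂ, Measurable (fun t =>
      (s.map fun z => ENNReal.ofReal (g z t) ^ (1 / 2 : ℝ)).sum) ∧
      ∫⁻ t, (s.map fun z => ENNReal.ofReal (g z t) ^ (1 / 2 : ℝ)).sum ∂intervalMeasure ≤
        s.card * C₁ := by
    intro s
    induction s using Multiset.induction with
    | empty => simp
    | cons a s ih =>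
      simp only [Multiset.map_cons, Multiset.sum_cons, Multiset.card_cons]
      refine ⟨(hmeas a).add ih.1, ?_⟩
      rw [lintegral_add_left (hmeas a)]
      push_cast
      rw [add_mul, one_mul, add_comm]
      exact add_le_add ih.2 (hz a)
  have hmeas' : Measurable fun t =>
      1 + (p.roots.map fun z => ENNReal.ofReal (g z t) ^ (1 / 2 : ℝ)).sum :=
    measurable_const.add (hsum _).1
  rw [lintegral_mul_const _ hmeas', lintegral_add_left measurable_const,
    lintegral_const, intervalMeasure_univ, one_mul, hC₂, ← mul_assoc]
  push_cast
  rw [ENNReal.coe_rpow_of_nonneg _ he.le]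
  push_cast
  gcongr
  refine (hsum _).2.trans ?_
  gcongr

/-- The real polynomial `x ↦ ∑ q_γ x^γ` on `ℝⁿ` with coefficients `q_γ`, the multi-indices `γ`
running over `{0, …, d}ⁿ`. -/
def multiPoly {n d : ℕ} (q : (Fin n → Fin (d + 1)) → ℝ) (x : Fin n → ℝ) : ℝ :=
  ∑ γ, q γ * ∏ i, x i ^ (γ i : ℕ)

lemma continuous_multiPoly {n d : ℕ} (q : (Fin n → Fin (d + 1)) → ℝ) :
    Continuous (multiPoly q) := by
  unfold multiPoly; fun_prop

/-- As a function of one coordinate, a polynomial has polynomial coefficients in the others. -/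
lemma multiPoly_insertNth {n d : ℕ} (q : (Fin (n + 1) → Fin (d + 1)) → ℝ) (i : Fin (n + 1))
    (t : ℝ) (x : Fin n → ℝ) : multiPoly q (i.insertNth t x) =
      ∑ k : Fin (d + 1), multiPoly (fun γ => q (i.insertNth k γ)) x * t ^ (k : ℕ) := by
  unfold multiPoly
  rw [← (Fin.insertNthEquiv (fun _ => Fin (d + 1)) i).sum_comp, Fintype.sum_prod_type]
  refine Finset.sum_congr rfl fun k _ => ?_
  rw [Finset.sum_mul]
  refine Finset.sum_congr rfl fun γ _ => ?_
  change q (i.insertNth k γ) * ∏ l, (i.insertNth t x : Fin (n + 1) → ℝ) l ^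
    ((i.insertNth k γ : Fin (n + 1) → Fin (d + 1)) l : ℕ) = _
  rw [Fin.prod_univ_succAbove _ i]
  simp only [Fin.insertNth_apply_same, Fin.insertNth_apply_succAbove]
  ring

lemma measurePreserving_insertNth_cubeMeasure {n : ℕ} (i : Fin (n + 1)) :
    MeasurePreserving (MeasurableEquiv.piFinSuccAbove (fun _ => ℝ) i).symm
      (intervalMeasure.prod (cubeMeasure n)) (cubeMeasure (n + 1)) :=
  (measurePreserving_piFinSuccAbove (fun _ : Fin (n + 1) => intervalMeasure) i).symm

lemma lintegral_cubeMeasure_succ {n : ℕ} (i : Fin (n + 1)) {f : (Fin (n + 1) → ℝ) → ℝ≥0∞}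
    (hf : Measurable f) : ∫⁻ x, f x ∂cubeMeasure (n + 1) =
      ∫⁻ x, ∫⁻ t, f (i.insertNth t x) ∂intervalMeasure ∂cubeMeasure n := by
  rw [← (measurePreserving_insertNth_cubeMeasure i).lintegral_comp hf, lintegral_prod_symm']
  · rfl
  · exact hf.comp (MeasurableEquiv.measurable _)

lemma integral_cubeMeasure_succ {n : ℕ} (i : Fin (n + 1)) {f : (Fin (n + 1) → ℝ) → ℂ}
    (hf : Integrable f (cubeMeasure (n + 1))) : ∫ x, f x ∂cubeMeasure (n + 1) =
      ∫ x, ∫ t, f (i.insertNth t x) ∂intervalMeasure ∂cubeMeasure n := by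
  rw [← (measurePreserving_insertNth_cubeMeasure i).integral_comp', integral_prod_symm]
  · rfl
  · exact (measurePreserving_insertNth_cubeMeasure i).integrable_comp_of_integrable hf

/-- For a polynomial on the unit cube, the integral of a small negative power is controlled by the
same power of any of its coefficients. -/
lemma exists_lintegral_multiPoly_rpow_neg_le (n d : ℕ) {e : ℝ} (he : 0 < e)
    (hed : e * (d + 1) ≤ 1 / 2) :
    ∃ C : ℝ≥0, 1 ≤ C ∧ ∀ (q : (Fin n → Fin (d + 1)) → ℝ) (γ : Fin n → Fin (d + 1)),
      ∫⁻ x, ‖multiPoly q x‖ₑ ^ (-e) ∂cubeMeasure n ≤ C * ‖q γ‖ₑ ^ (-e) := by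
  obtain ⟨C₁, hC₁, h1⟩ := exists_lintegral_poly_rpow_neg_le d he hed
  induction n with
  | zero =>
    refine ⟨1, le_rfl, fun q γ => ?_⟩
    have : ∀ x, multiPoly q x = q γ := by
      intro x
      unfold multiPoly
      rw [Fintype.sum_eq_single γ fun a ha => absurd (Subsingleton.elim a γ) ha]
      simp
    simp [this, cubeMeasure_univ]
  | succ n ih =>
    obtain ⟨C, hC, h⟩ := ih
    refine ⟨C₁ * C, one_le_mul hC₁ hC, fun q γ => ?_⟩
    rw [lintegral_cubeMeasure_succ 0]
    swap
    · exact (continuous_multiPoly q).measurable.enorm.pow_const _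
    have hγ : γ = (0 : Fin (n + 1)).insertNth (γ 0) (Fin.removeNth 0 γ) := by simp
    calc _ ≤ ∫⁻ x, C₁ * ‖multiPoly (fun γ' => q ((0 : Fin (n + 1)).insertNth (γ 0) γ')) x‖ₑ ^ (-e)
            ∂cubeMeasure n := by
          refine lintegral_mono fun x => ?_
          simp_rw [multiPoly_insertNth]
          exact h1 _ (γ 0)
      _ = C₁ * ∫⁻ x, ‖multiPoly (fun γ' => q ((0 : Fin (n + 1)).insertNth (γ 0) γ')) x‖ₑ ^ (-e)
            ∂cubeMeasure n := lintegral_const_mul' _ _ ENNReal.coe_ne_top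
      _ ≤ C₁ * (C * ‖q γ‖ₑ ^ (-e)) := by
          gcongr
          conv_rhs => rw [hγ]
          exact h _ _
      _ = _ := by push_cast; ring

/-! ### Oscillatory integrals with polynomial phase -/

/-- The integration by parts behind the decay of oscillatory integrals. The amplitude `1` is split
as `M / (p² + M) + p² / (p² + M)` with `p` the derivative of the phase; the second part is, up to an
error dominated by the first, `-i` times the derivative of `exp (i R) p / (p² + M)`. -/
lemma enorm_integral_exp_le {R p p' : ℝ → ℝ} {M D : ℝ} (hM : 0 < M) (hD : 0 ≤ D)
    (hR : ∀ t, HasDerivAt R (p t) t) (hp : ∀ t, HasDerivAt p (p' t) t) (hp' : Continuous p')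
    (hle : ∀ t, |t| ≤ 1 → |p' t| ≤ D * M) :
    ‖∫ t, Complex.exp (Complex.I * (R t : ℂ)) ∂intervalMeasure‖ₑ ≤
      ENNReal.ofReal (1 + D) * ∫⁻ t, ENNReal.ofReal (M / (p t ^ 2 + M)) ∂intervalMeasure +
        ENNReal.ofReal (M ^ (-(1 / 2) : ℝ)) := by
  have hRc : Continuous R := continuous_iff_continuousAt.2 fun t => (hR t).continuousAt
  have hpc : Continuous p := continuous_iff_continuousAt.2 fun t => (hp t).continuousAt
  have hpos : ∀ t, 0 < p t ^ 2 + M := fun t => by positivity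
  let E : ℝ → ℂ := fun t => Complex.exp (Complex.I * (R t : ℂ))
  have hEc : Continuous E := by simp only [E]; fun_prop
  have hEn : ∀ t, ‖E t‖ = 1 := fun t => by
    simp only [E]; rw [mul_comm]; exact Complex.norm_exp_ofReal_mul_I _
  let g : ℝ → ℝ := fun t => p t / (p t ^ 2 + M)
  let g' : ℝ → ℝ := fun t => p' t * (M - p t ^ 2) / (p t ^ 2 + M) ^ 2
  have hg : ∀ t, HasDerivAt g (g' t) t := by
    intro t
    refine ((hp t).div (((hp t).pow 2).add_const M) (hpos t).ne').congr_deriv ?_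
    simp only [g', Pi.pow_apply]
    push_cast
    congr 1
    ring
  have hE : ∀ t, HasDerivAt E (E t * (Complex.I * (p t : ℂ))) t := by
    intro t
    exact ((hR t).ofReal_comp.const_mul Complex.I).cexp
  let G : ℝ → ℂ := fun t => E t * (g t : ℂ)
  let G' : ℝ → ℂ := fun t => E t * (Complex.I * (p t : ℂ)) * (g t : ℂ) + E t * (g' t : ℂ)
  have hG : ∀ t, HasDerivAt G (G' t) t := fun t => (hE t).mul (hg t).ofReal_comp
  have hgc : Continuous g := continuous_iff_continuousAt.2 fun t => (hg t).continuousAt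
  have hg'c : Continuous g' :=
    (hp'.mul (continuous_const.sub (hpc.pow 2))).div₀ (((hpc.pow 2).add continuous_const).pow 2)
      fun t => (pow_pos (hpos t) 2).ne'
  have hG'c : Continuous G' := by simp only [G']; fun_prop
  have hFTC : ∫ t, G' t ∂intervalMeasure = G 1 - G (-1) := by
    rw [intervalMeasure, integral_Icc_eq_integral_Ioc,
      ← intervalIntegral.integral_of_le (by norm_num)]
    exact intervalIntegral.integral_eq_sub_of_hasDerivAt (fun t _ => hG t)
      (hG'c.intervalIntegrable _ _)
  have hint : ∀ f : ℝ → ℂ, Continuous f → Integrable f intervalMeasure := fun f hf =>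
    hf.continuousOn.integrableOn_compact isCompact_Icc
  have hgn : ∀ t, ‖G t‖ ≤ M ^ (-(1 / 2) : ℝ) / 2 := by
    intro t
    simp only [G]
    rw [norm_mul, hEn, one_mul, Complex.norm_real, Real.norm_eq_abs, abs_div,
      abs_of_pos (hpos t), Real.rpow_neg hM.le, ← Real.sqrt_eq_rpow,
      div_le_iff₀ (hpos t), ← sq_abs]
    have hs : 0 < √M := Real.sqrt_pos.2 hM
    have h2 : √M ^ 2 = M := Real.sq_sqrt hM.le
    nth_rewrite 2 [← h2]
    field_simp
    nlinarith [sq_nonneg (|p t| - √M)]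
  have hsplit : ∫ t, E t ∂intervalMeasure =
      ∫ t, (E t + Complex.I * G' t) ∂intervalMeasure - Complex.I * (G 1 - G (-1)) := by
    rw [integral_add (hint _ hEc) (hint _ (by fun_prop)), integral_const_mul, hFTC]
    ring
  have hbound : ∀ t, |t| ≤ 1 → ‖E t + Complex.I * G' t‖ ≤ (1 + D) * (M / (p t ^ 2 + M)) := by
    intro t ht
    have h1 : E t + Complex.I * G' t =
        E t * ((M / (p t ^ 2 + M) : ℝ) + Complex.I * (g' t : ℂ)) := by
      have h2 : ((p t : ℂ) ^ 2 + M) ≠ 0 := by exact_mod_cast (hpos t).ne'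
      have h3 : (1 : ℂ) - (p t : ℂ) * (p t / (p t ^ 2 + M)) = M / (p t ^ 2 + M) := by
        field_simp; ring
      simp only [G', g]
      push_cast
      rw [← h3]
      ring_nf
      rw [Complex.I_sq]
      ring
    rw [h1, norm_mul, hEn, one_mul]
    refine (norm_add_le _ _).trans ?_
    rw [norm_mul, Complex.norm_I, one_mul, Complex.norm_real, Complex.norm_real, add_mul, one_mul,
      Real.norm_of_nonneg (by have := hpos t; positivity)]
    gcongr
    simp only [g']
    rw [Real.norm_eq_abs, abs_div, abs_mul, abs_of_pos (pow_pos (hpos t) 2),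
      div_le_iff₀ (pow_pos (hpos t) 2)]
    have h4 : |M - p t ^ 2| ≤ p t ^ 2 + M := by
      rw [abs_le]; constructor <;> nlinarith [sq_nonneg (p t)]
    calc |p' t| * |M - p t ^ 2| ≤ (D * M) * (p t ^ 2 + M) :=
          mul_le_mul (hle t ht) h4 (abs_nonneg _) (by positivity)
      _ = _ := by have := (hpos t).ne'; field_simp
  change ‖∫ t, E t ∂intervalMeasure‖ₑ ≤ _
  rw [hsplit]
  refine (enorm_sub_le).trans (add_le_add ?_ ?_)
  · refine (enorm_integral_le_lintegral_enorm _).trans ?_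
    rw [← lintegral_const_mul' _ _ ENNReal.ofReal_ne_top]
    refine lintegral_mono_ae ?_
    filter_upwards [ae_intervalMeasure_abs_le] with t ht
    rw [← ENNReal.ofReal_mul (by positivity), ← ofReal_norm]
    exact ENNReal.ofReal_le_ofReal (hbound t ht)
  · rw [← ofReal_norm]
    apply ENNReal.ofReal_le_ofReal
    rw [norm_mul, Complex.norm_I, one_mul]
    linarith [norm_sub_le (G 1) (G (-1)), hgn 1, hgn (-1)]

lemma div_sq_add_le {M x e : ℝ} (hM : 0 < M) (he : 0 < e) (he2 : e ≤ 2) :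
    ENNReal.ofReal (M / (x ^ 2 + M)) ≤ ENNReal.ofReal (M ^ (e / 2)) * ‖x‖ₑ ^ (-e) := by
  by_cases hx : x = 0
  · have : 0 < M ^ (e / 2) := by positivity
    simp [hx, he, ENNReal.mul_top, this]
  have hx0 : 0 < |x| := abs_pos.2 hx
  rw [Real.enorm_eq_ofReal_abs, ENNReal.ofReal_rpow_of_pos hx0,
    ← ENNReal.ofReal_mul (by positivity)]
  apply ENNReal.ofReal_le_ofReal
  set r := √M with hr
  have hr0 : 0 < r := Real.sqrt_pos.2 hM
  have hM2 : M = r ^ 2 := (Real.sq_sqrt hM.le).symm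
  have h1 : M ^ (e / 2) = r ^ e := by
    rw [hM2, ← Real.rpow_natCast, ← Real.rpow_mul hr0.le]; congr 1; push_cast; ring
  rw [h1, Real.rpow_neg hx0.le, ← div_eq_mul_inv, ← Real.div_rpow hr0.le hx0.le, hM2, ← sq_abs x]
  rcases le_total |x| r with h | h
  · calc r ^ 2 / (|x| ^ 2 + r ^ 2) ≤ 1 := by
          rw [div_le_one (by positivity)]; nlinarith
      _ ≤ _ := Real.one_le_rpow ((one_le_div hx0).2 h) he.le
  · calc r ^ 2 / (|x| ^ 2 + r ^ 2) ≤ r ^ 2 / |x| ^ 2 := by gcongr; nlinarith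
      _ = (r / |x|) ^ (2 : ℝ) := by rw [Real.rpow_two, div_pow]
      _ ≤ _ := Real.rpow_le_rpow_of_exponent_ge (by positivity) ((div_le_one hx0).2 h) he2

/-- Decay of an oscillatory integral with polynomial phase, in terms of any coefficient of positive
order. -/
lemma exists_enorm_integral_exp_poly_le (d : ℕ) {e : ℝ} (he : 0 < e) (hed : e * (d + 1) ≤ 1 / 2) :
    ∃ C : ℝ≥0, ∀ (b : Fin (d + 1) → ℝ) (k : Fin (d + 1)), k ≠ 0 →
      ‖∫ t, Complex.exp (Complex.I * ((∑ j, b j * t ^ (j : ℕ) : ℝ) : ℂ)) ∂intervalMeasure‖ₑ ≤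
        C * ‖b k‖ₑ ^ (-(e / 2)) := by
  cases d with
  | zero => exact ⟨1, fun b k hk => absurd (Fin.ext (by omega)) hk⟩
  | succ d =>
  have hed' : e * (d + 1) ≤ 1 / 2 := by push_cast at hed; linarith
  have he1 : e ≤ 1 / 2 := by nlinarith [mul_nonneg he.le (Nat.cast_nonneg (α := ℝ) d)]
  obtain ⟨C₁, hC₁, h1⟩ := exists_lintegral_poly_rpow_neg_le d he hed'
  obtain ⟨D, hD⟩ : ∃ D : ℝ≥0, D = (d + 1) ^ 3 := ⟨_, rfl⟩
  refine ⟨(1 + D) * C₁ + 2, fun b k hk => ?_⟩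
  -- The largest coefficient of positive order controls the second derivative of the phase on
  -- `[-1, 1]`, so it can be taken as the parameter `M` of the integration by parts.
  obtain ⟨j₀, hj₀, hmax⟩ := Finset.exists_max_image (Finset.univ.erase (0 : Fin (d + 2)))
    (fun j => |b j|) ⟨k, by simp [hk]⟩
  have hj₀' : j₀ ≠ 0 := by simpa using hj₀
  set M := |b j₀| with hMdef
  have hbM : ∀ j : Fin (d + 1), |b j.succ| ≤ M := fun j => hmax _ (by simp)
  have hmono : ‖b j₀‖ₑ ^ (-(e / 2)) ≤ ‖b k‖ₑ ^ (-(e / 2)) := by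
    rw [ENNReal.rpow_neg, ENNReal.rpow_neg]
    apply ENNReal.inv_le_inv.2
    apply ENNReal.rpow_le_rpow _ (by positivity)
    rw [Real.enorm_eq_ofReal_abs, Real.enorm_eq_ofReal_abs]
    exact ENNReal.ofReal_le_ofReal (hmax k (by simp [hk]))
  refine le_trans ?_ (mul_le_mul_right hmono _)
  rw [Real.enorm_eq_ofReal_abs (b j₀)]
  -- For `M < 1` the trivial bound is enough.
  rcases lt_or_ge M 1 with hM1 | hM1
  · have h2 : (1 : ℝ≥0∞) ≤ ENNReal.ofReal M ^ (-(e / 2)) := by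
      rw [ENNReal.rpow_neg]
      apply ENNReal.one_le_inv.2
      exact ENNReal.rpow_le_one (by simpa using hM1.le) (by positivity)
    calc _ ≤ ∫⁻ t, ‖Complex.exp (Complex.I * ((∑ j, b j * t ^ (j : ℕ) : ℝ) : ℂ))‖ₑ
            ∂intervalMeasure := enorm_integral_le_lintegral_enorm _
      _ = ∫⁻ t, 1 ∂intervalMeasure := by
          congr with t
          rw [mul_comm, ← ofReal_norm, Complex.norm_exp_ofReal_mul_I, ENNReal.ofReal_one]
      _ = 2 * 1 := by rw [lintegral_const, intervalMeasure_univ]; simp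
      _ ≤ _ := by
          gcongr
          push_cast
          exact le_add_self
  · have hM : 0 < M := by linarith
    let p : ℝ → ℝ := fun t => ∑ j : Fin (d + 1), ((j + 1 : ℕ) * b j.succ) * t ^ (j : ℕ)
    let p' : ℝ → ℝ := fun t =>
      ∑ j : Fin (d + 1), ((j + 1 : ℕ) * b j.succ) * ((j : ℕ) * t ^ ((j : ℕ) - 1))
    have hR : ∀ t, HasDerivAt (fun t => ∑ j, b j * t ^ (j : ℕ)) (p t) t := by
      intro t
      have h2 : ∀ j : Fin (d + 2), HasDerivAt (fun t => b j * t ^ (j : ℕ))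
          (b j * ((j : ℕ) * t ^ ((j : ℕ) - 1))) t := fun j => (hasDerivAt_pow _ t).const_mul _
      refine (HasDerivAt.fun_sum (u := Finset.univ) fun j _ => h2 j).congr_deriv ?_
      rw [Fin.sum_univ_succ]
      simp only [p, Fin.val_zero, Fin.val_succ, Nat.cast_zero, zero_mul, mul_zero, zero_add,
        Nat.add_sub_cancel]
      refine Finset.sum_congr rfl fun j _ => ?_
      ring
    have hp : ∀ t, HasDerivAt p (p' t) t := by
      intro t
      exact HasDerivAt.fun_sum (u := Finset.univ) fun j _ => (hasDerivAt_pow _ t).const_mul _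
    have hle : ∀ t, |t| ≤ 1 → |p' t| ≤ D * M := by
      intro t ht
      refine (Finset.abs_sum_le_sum_abs _ _).trans ?_
      have h2 : ∀ j ∈ (Finset.univ : Finset (Fin (d + 1))),
          |((j + 1 : ℕ) * b j.succ) * ((j : ℕ) * t ^ ((j : ℕ) - 1))| ≤ (d + 1) ^ 2 * M := by
        intro j _
        have h3 : |t| ^ ((j : ℕ) - 1) ≤ 1 := pow_le_one₀ (abs_nonneg _) ht
        have h4 : ((j + 1 : ℕ) : ℝ) ≤ d + 1 := by exact_mod_cast j.2
        have h5 : ((j : ℕ) : ℝ) ≤ d + 1 := by exact_mod_cast j.2.le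
        rw [abs_mul, abs_mul, abs_mul, abs_pow, Nat.abs_cast, Nat.abs_cast]
        calc _ ≤ ((d + 1 : ℝ) * M) * ((d + 1) * 1) := by
              gcongr
              exact hbM j
          _ = _ := by ring
      refine (Finset.sum_le_card_nsmul _ _ _ h2).trans ?_
      simp only [hD, Finset.card_univ, Fintype.card_fin, nsmul_eq_mul]
      push_cast
      apply le_of_eq; ring
    have key := enorm_integral_exp_le hM D.coe_nonneg hR hp (by simp only [p']; fun_prop) hle
    refine key.trans ?_
    have h2 : ∫⁻ t, ENNReal.ofReal (M / (p t ^ 2 + M)) ∂intervalMeasure ≤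
        C₁ * ENNReal.ofReal M ^ (-(e / 2)) := by
      obtain ⟨j₁, rfl⟩ := Fin.exists_succ_eq.2 hj₀'
      calc _ ≤ ∫⁻ t, ENNReal.ofReal (M ^ (e / 2)) * ‖p t‖ₑ ^ (-e) ∂intervalMeasure :=
            lintegral_mono fun t => div_sq_add_le hM he (by linarith)
        _ = ENNReal.ofReal (M ^ (e / 2)) * ∫⁻ t, ‖p t‖ₑ ^ (-e) ∂intervalMeasure :=
            lintegral_const_mul' _ _ ENNReal.ofReal_ne_top
        _ ≤ ENNReal.ofReal (M ^ (e / 2)) *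
              (C₁ * ‖((j₁ + 1 : ℕ) * b j₁.succ : ℝ)‖ₑ ^ (-e)) := by
            gcongr
            exact h1 (fun j => (j + 1 : ℕ) * b j.succ) j₁
        _ ≤ ENNReal.ofReal (M ^ (e / 2)) * (C₁ * ENNReal.ofReal M ^ (-e)) := by
            gcongr _ * (_ * ?_)
            rw [ENNReal.rpow_neg, ENNReal.rpow_neg]
            apply ENNReal.inv_le_inv.2
            apply ENNReal.rpow_le_rpow _ he.le
            rw [Real.enorm_eq_ofReal_abs, abs_mul, Nat.abs_cast]
            apply ENNReal.ofReal_le_ofReal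
            have : (1 : ℝ) ≤ (j₁ + 1 : ℕ) := by exact_mod_cast Nat.succ_le_succ (Nat.zero_le _)
            exact le_mul_of_one_le_left (abs_nonneg _) this
        _ = _ := by
            rw [← ENNReal.ofReal_rpow_of_pos hM, mul_left_comm,
              ← ENNReal.rpow_add _ _ (by simpa using hM) ENNReal.ofReal_ne_top]
            congr 2; ring
    have h3 : ENNReal.ofReal (M ^ (-(1 / 2) : ℝ)) ≤ ENNReal.ofReal M ^ (-(e / 2)) := by
      rw [ENNReal.ofReal_rpow_of_pos hM]
      apply ENNReal.ofReal_le_ofReal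
      exact Real.rpow_le_rpow_of_exponent_le hM1 (by linarith)
    have h4 : ENNReal.ofReal (1 + D) = ((1 + D : ℝ≥0) : ℝ≥0∞) := by
      rw [← NNReal.coe_one, ← NNReal.coe_add, ENNReal.ofReal_coe_nnreal]
    calc _ ≤ ((1 + D : ℝ≥0) : ℝ≥0∞) * (C₁ * ENNReal.ofReal M ^ (-(e / 2))) +
          ENNReal.ofReal M ^ (-(e / 2)) := by rw [← h4]; gcongr
      _ = ((1 + D : ℝ≥0) * C₁ + 1) * ENNReal.ofReal M ^ (-(e / 2)) := by ring
      _ ≤ _ := by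
          gcongr
          have h5 : (1 + D) * C₁ + 1 ≤ (1 + D) * C₁ + 2 := by gcongr; norm_num
          exact_mod_cast h5

/-- Decay of an oscillatory integral over the unit cube with polynomial phase, in terms of any
coefficient of positive order. -/
lemma exists_enorm_integral_exp_multiPoly_le (n d : ℕ) {e : ℝ} (he : 0 < e)
    (hed : e * (d + 1) ≤ 1 / 2) :
    ∃ C : ℝ≥0, ∀ (q : (Fin n → Fin (d + 1)) → ℝ) (γ : Fin n → Fin (d + 1)), γ ≠ 0 →
      ‖∫ x, Complex.exp (Complex.I * (multiPoly q x : ℂ)) ∂cubeMeasure n‖ₑ ≤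
        C * ‖q γ‖ₑ ^ (-(e / 2)) := by
  cases n with
  | zero => exact ⟨1, fun q γ hγ => absurd (Subsingleton.elim γ 0) hγ⟩
  | succ n =>
  obtain ⟨C₁, h1⟩ := exists_enorm_integral_exp_poly_le d he hed
  obtain ⟨C₂, -, h2⟩ := exists_lintegral_multiPoly_rpow_neg_le n d (half_pos he)
    (by have : 0 ≤ e * (d + 1) := by positivity
        linarith)
  refine ⟨C₁ * C₂, fun q γ hγ => ?_⟩
  -- Oscillation is used in one variable which occurs in the monomial `γ`; the resulting negative
  -- power of a polynomial is integrated over the other variables.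
  obtain ⟨i, hi⟩ := Function.ne_iff.1 hγ
  have hγ' : γ = i.insertNth (γ i) (Fin.removeNth i γ) := by simp
  have hint : Integrable (fun x => Complex.exp (Complex.I * (multiPoly q x : ℂ)))
      (cubeMeasure (n + 1)) := by
    refine Integrable.of_bound (C := 1) ?_ (Filter.Eventually.of_forall fun x => ?_)
    · have := continuous_multiPoly q
      exact Continuous.aestronglyMeasurable (by fun_prop)
    · rw [mul_comm, Complex.norm_exp_ofReal_mul_I]
  rw [integral_cubeMeasure_succ i hint]
  calc _ ≤ ∫⁻ x, C₁ * ‖multiPoly (fun γ' => q (i.insertNth (γ i) γ')) x‖ₑ ^ (-(e / 2))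
          ∂cubeMeasure n := by
        refine (enorm_integral_le_lintegral_enorm _).trans (lintegral_mono fun x => ?_)
        simp_rw [multiPoly_insertNth]
        exact h1 _ (γ i) hi
    _ = C₁ * ∫⁻ x, ‖multiPoly (fun γ' => q (i.insertNth (γ i) γ')) x‖ₑ ^ (-(e / 2))
          ∂cubeMeasure n := lintegral_const_mul' _ _ ENNReal.coe_ne_top
    _ ≤ C₁ * (C₂ * ‖q γ‖ₑ ^ (-(e / 2))) := by
        gcongr
        conv_rhs => rw [hγ']
        exact h2 _ _
    _ = _ := by push_cast; ring

/-! ### Oscillatory integrals against a bounded function with one cancellation -/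

/-- The `TT*` inequality for a bounded kernel acting on a bounded function. -/
lemma lintegral_enorm_integral_sq_le {X Y : Type*} [MeasurableSpace X] [MeasurableSpace Y]
    {μ : Measure X} {ν : Measure Y} [IsFiniteMeasure μ] [IsFiniteMeasure ν] {k : X → Y → ℂ}
    (hk : Measurable (Function.uncurry k)) (hk1 : ∀ x y, ‖k x y‖ ≤ 1) {a : Y → ℂ}
    (ha : AEStronglyMeasurable a ν) (ha1 : ∀ᵐ y ∂ν, ‖a y‖ ≤ 1) :
    ∫⁻ x, ‖∫ y, k x y * a y ∂ν‖ₑ ^ 2 ∂μ ≤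
      ∫⁻ z, ‖∫ x, k x z.1 * (starRingEnd ℂ) (k x z.2) ∂μ‖ₑ ∂(ν.prod ν) := by
  set F : X → ℂ := fun x => ∫ y, k x y * a y ∂ν with hF
  have hka : AEStronglyMeasurable (fun z : X × Y => k z.1 z.2 * a z.2) (μ.prod ν) :=
    hk.aestronglyMeasurable.mul ha.comp_snd
  have hFm : AEStronglyMeasurable F μ := hka.integral_prod_right'
  have hFb : ∀ x, ‖F x‖ ≤ ν.real Set.univ := by
    intro x
    have := norm_integral_le_of_norm_le_const (μ := ν) (f := fun y => k x y * a y) (C := 1) (by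
      filter_upwards [ha1] with y hy
      rw [norm_mul]
      exact mul_le_one₀ (hk1 x y) (norm_nonneg _) hy)
    simpa using this
  have hF2 : Integrable (fun x => ‖F x‖ ^ 2) μ := by
    refine Integrable.of_bound (C := ν.real Set.univ ^ 2) (hFm.norm.pow 2) ?_
    refine Filter.Eventually.of_forall fun x => ?_
    rw [Real.norm_of_nonneg (by positivity)]
    gcongr
    exact hFb x
  let H : X → Y × Y → ℂ := fun x z =>
    (k x z.1 * a z.1) * (starRingEnd ℂ) (k x z.2 * a z.2)
  have hHm : AEStronglyMeasurable (Function.uncurry H) (μ.prod (ν.prod ν)) := by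
    have hm1 : Measurable fun z : X × (Y × Y) => k z.1 z.2.1 :=
      hk.comp (measurable_fst.prodMk (measurable_fst.comp measurable_snd))
    have hm2 : Measurable fun z : X × (Y × Y) => k z.1 z.2.2 :=
      hk.comp (measurable_fst.prodMk (measurable_snd.comp measurable_snd))
    have ha1 : AEStronglyMeasurable (fun z : X × (Y × Y) => a z.2.1) (μ.prod (ν.prod ν)) :=
      (ha.comp_fst (ν := ν)).comp_snd
    have ha2 : AEStronglyMeasurable (fun z : X × (Y × Y) => a z.2.2) (μ.prod (ν.prod ν)) :=
      (ha.comp_snd (μ := ν)).comp_snd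
    exact (hm1.aestronglyMeasurable.mul ha1).mul
      (Complex.continuous_conj.comp_aestronglyMeasurable (hm2.aestronglyMeasurable.mul ha2))
  have haz : ∀ᵐ z ∂ν.prod ν, ‖a z.1‖ ≤ 1 ∧ ‖a z.2‖ ≤ 1 := by
    have h1 := (Measure.quasiMeasurePreserving_fst (μ := ν) (ν := ν)).ae ha1
    have h2 := (Measure.quasiMeasurePreserving_snd (μ := ν) (ν := ν)).ae ha1
    filter_upwards [h1, h2] with z hz1 hz2 using ⟨hz1, hz2⟩
  have hHint : Integrable (Function.uncurry H) (μ.prod (ν.prod ν)) := by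
    refine Integrable.of_bound (C := 1) hHm ?_
    have h1 := (Measure.quasiMeasurePreserving_snd (μ := μ) (ν := ν.prod ν)).ae haz
    filter_upwards [h1] with z hz
    simp only [Function.uncurry, H]
    rw [norm_mul, RCLike.norm_conj, norm_mul, norm_mul]
    exact mul_le_one₀ (mul_le_one₀ (hk1 _ _) (norm_nonneg _) hz.1) (by positivity)
      (mul_le_one₀ (hk1 _ _) (norm_nonneg _) hz.2)
  have hFF : ∀ x, ((‖F x‖ ^ 2 : ℝ) : ℂ) = ∫ z, H x z ∂(ν.prod ν) := by
    intro x
    rw [integral_prod_mul (fun y => k x y * a y) (fun y => (starRingEnd ℂ) (k x y * a y)),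
      integral_conj]
    push_cast
    exact (Complex.mul_conj' (F x)).symm
  have hL : ∫⁻ x, ‖F x‖ₑ ^ 2 ∂μ = ‖∫ x, ((‖F x‖ ^ 2 : ℝ) : ℂ) ∂μ‖ₑ := by
    have hre : ∫ x, ((‖F x‖ ^ 2 : ℝ) : ℂ) ∂μ = ((∫ x, ‖F x‖ ^ 2 ∂μ : ℝ) : ℂ) := integral_ofReal
    rw [hre, ← ofReal_norm, Complex.norm_real, Real.norm_eq_abs, abs_of_nonneg
      (integral_nonneg fun x => by positivity), ofReal_integral_eq_lintegral_ofReal hF2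
      (Filter.Eventually.of_forall fun x => by positivity)]
    refine lintegral_congr fun x => ?_
    rw [ENNReal.ofReal_pow (norm_nonneg _), ofReal_norm]
  rw [hL]
  simp_rw [hFF]
  rw [integral_integral_swap hHint]
  refine (enorm_integral_le_lintegral_enorm _).trans (lintegral_mono_ae ?_)
  filter_upwards [haz] with z hz
  have : ∫ x, H x z ∂μ =
      (∫ x, k x z.1 * (starRingEnd ℂ) (k x z.2) ∂μ) * (a z.1 * (starRingEnd ℂ) (a z.2)) := by
    rw [← integral_mul_const]
    congr with x
    simp only [H, map_mul]
    ring
  rw [this, enorm_mul]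
  refine mul_le_of_le_one_right' ?_
  rw [← ofReal_norm, norm_mul, RCLike.norm_conj]
  exact ENNReal.ofReal_le_one.2 (mul_le_one₀ hz.1 (norm_nonneg _) hz.2)

lemma multiPoly_zero {n d : ℕ} (q : (Fin n → Fin (d + 1)) → ℝ) : multiPoly q 0 = q 0 := by
  unfold multiPoly
  rw [Fintype.sum_eq_single 0]
  · simp
  · intro γ hγ
    obtain ⟨i, hi⟩ := Function.ne_iff.1 hγ
    rw [Finset.prod_eq_zero (Finset.mem_univ i), mul_zero]
    have : (γ i : ℕ) ≠ 0 := fun h => hi (Fin.ext (by simpa using h))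
    simp [this]

lemma abs_multiPoly_sub_zero_le {n d : ℕ} (q : (Fin n → Fin (d + 1)) → ℝ) {x : Fin n → ℝ}
    (hx : ∀ i, |x i| ≤ 1) :
    |multiPoly q x - multiPoly q 0| ≤ ∑ γ ∈ Finset.univ.erase 0, |q γ| := by
  rw [multiPoly_zero, multiPoly, ← Finset.add_sum_erase _ _ (Finset.mem_univ 0)]
  simp only [Pi.zero_apply, Fin.val_zero, pow_zero, Finset.prod_const_one, mul_one,
    add_sub_cancel_left]
  refine (Finset.abs_sum_le_sum_abs _ _).trans (Finset.sum_le_sum fun γ _ => ?_)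
  rw [abs_mul, Finset.abs_prod]
  refine mul_le_of_le_one_right (abs_nonneg _) (Finset.prod_le_one (fun i _ => abs_nonneg _) ?_)
  intro i _
  rw [abs_pow]
  exact pow_le_one₀ (abs_nonneg _) (hx i)

lemma multiPoly_sub {n d : ℕ} (q q' : (Fin n → Fin (d + 1)) → ℝ) (x : Fin n → ℝ) :
    multiPoly (fun γ => q γ - q' γ) x = multiPoly q x - multiPoly q' x := by
  simp only [multiPoly, sub_mul, Finset.sum_sub_distrib]

lemma multiPoly_const {n d : ℕ} (c : ℝ) (x : Fin n → ℝ) :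
    multiPoly (fun γ : Fin n → Fin (d + 1) => if γ = 0 then c else 0) x = c := by
  unfold multiPoly
  rw [Fintype.sum_eq_single 0 fun γ hγ => by simp [hγ]]
  simp

/-- The real polynomial `(u, v) ↦ ∑ q_{αβ} u^α v^β` on `ℝⁿ × ℝⁿ`. -/
def biPoly {n d : ℕ} (q : (Fin n → Fin (d + 1)) → (Fin n → Fin (d + 1)) → ℝ)
    (u v : Fin n → ℝ) : ℝ :=
  multiPoly (fun α => multiPoly (q α) v) u

lemma continuous_biPoly {n d : ℕ} (q : (Fin n → Fin (d + 1)) → (Fin n → Fin (d + 1)) → ℝ) :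
    Continuous fun z : (Fin n → ℝ) × (Fin n → ℝ) => biPoly q z.1 z.2 := by
  unfold biPoly multiPoly; fun_prop

lemma continuous_biPoly_right {n d : ℕ}
    (q : (Fin n → Fin (d + 1)) → (Fin n → Fin (d + 1)) → ℝ) (u : Fin n → ℝ) :
    Continuous (biPoly q u) := by
  unfold biPoly multiPoly; fun_prop

/-- The sum of the absolute values of the coefficients of the mixed monomials of `biPoly q`, those
depending on both variables. -/
noncomputable def mixedSum {n d : ℕ}
    (q : (Fin n → Fin (d + 1)) → (Fin n → Fin (d + 1)) → ℝ) : ℝ :=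
  ∑ α ∈ Finset.univ.erase 0, ∑ β ∈ Finset.univ.erase 0, |q α β|

lemma abs_biPoly_mixed_difference_le {n d : ℕ}
    (q : (Fin n → Fin (d + 1)) → (Fin n → Fin (d + 1)) → ℝ) {u v : Fin n → ℝ}
    (hu : ∀ i, |u i| ≤ 1) (hv : ∀ i, |v i| ≤ 1) :
    |biPoly q u v - biPoly q u 0 - (biPoly q 0 v - biPoly q 0 0)| ≤ mixedSum q := by
  have h1 := abs_multiPoly_sub_zero_le (fun α => multiPoly (q α) v - multiPoly (q α) 0) hu
  simp only [multiPoly_sub] at h1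
  refine h1.trans (Finset.sum_le_sum fun α _ => ?_)
  exact abs_multiPoly_sub_zero_le (q α) hv

lemma norm_exp_I_mul_ofReal' (x : ℝ) : ‖Complex.exp (Complex.I * (x : ℂ))‖ = 1 := by
  rw [mul_comm, Complex.norm_exp_ofReal_mul_I]

lemma integrable_exp_mul_of_bounded {X : Type*} [TopologicalSpace X] [MeasurableSpace X]
    [OpensMeasurableSpace X] {μ : Measure X} [IsFiniteMeasure μ] {φ : X → ℝ} (hφ : Continuous φ)
    {a : X → ℂ} (ha : AEStronglyMeasurable a μ) (ha1 : ∀ᵐ v ∂μ, ‖a v‖ ≤ 1) :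
    Integrable (fun v => Complex.exp (Complex.I * (φ v : ℂ)) * a v) μ := by
  refine Integrable.of_bound (C := 1) ?_ ?_
  · exact (Continuous.aestronglyMeasurable (by fun_prop)).mul ha
  · filter_upwards [ha1] with v hv
    rw [norm_mul, norm_exp_I_mul_ofReal', one_mul]; exact hv

/-- Small phases: the cancellation of `a` against `exp (i Q(0, ·))` gives a gain. -/
lemma lintegral_enorm_osc_le_mixedSum {n d : ℕ}
    (q : (Fin n → Fin (d + 1)) → (Fin n → Fin (d + 1)) → ℝ) {a : (Fin n → ℝ) → ℂ}
    (ha : AEStronglyMeasurable a (cubeMeasure n)) (ha1 : ∀ᵐ v ∂cubeMeasure n, ‖a v‖ ≤ 1)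
    (hcancel : ∫ v, Complex.exp (Complex.I * (biPoly q 0 v : ℂ)) * a v ∂cubeMeasure n = 0) :
    ∫⁻ u, ‖∫ v, Complex.exp (Complex.I * (biPoly q u v : ℂ)) * a v ∂cubeMeasure n‖ₑ
      ∂cubeMeasure n ≤ 4 ^ n * ENNReal.ofReal (mixedSum q) := by
  have hpt : ∀ᵐ u ∂cubeMeasure n,
      ‖∫ v, Complex.exp (Complex.I * (biPoly q u v : ℂ)) * a v ∂cubeMeasure n‖ₑ ≤
        2 ^ n * ENNReal.ofReal (mixedSum q) := by
    filter_upwards [ae_cubeMeasure_abs_le n] with u hu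
    have hint : ∀ u, Integrable (fun v => Complex.exp (Complex.I * (biPoly q u v : ℂ)) * a v)
        (cubeMeasure n) := by
      intro u
      exact integrable_exp_mul_of_bounded (continuous_biPoly_right q u) ha ha1
    -- The part of the phase which depends on `u` alone gives a unimodular factor, and the
    -- cancellation is not affected by it; the remaining difference of phases has only mixed monomials.
    set s : ℝ := biPoly q u 0 - biPoly q 0 0 with hs
    have h1 : ∫ v, Complex.exp (Complex.I * (biPoly q u v : ℂ)) * a v ∂cubeMeasure n =
        ∫ v, (Complex.exp (Complex.I * (biPoly q u v : ℂ)) * a v -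
          Complex.exp (Complex.I * (s : ℂ)) *
            (Complex.exp (Complex.I * (biPoly q 0 v : ℂ)) * a v)) ∂cubeMeasure n := by
      have h2 := integral_sub (hint u) ((hint 0).const_mul (Complex.exp (Complex.I * (s : ℂ))))
      rw [integral_const_mul, hcancel, mul_zero, sub_zero] at h2
      exact h2.symm
    rw [h1]
    refine (enorm_integral_le_lintegral_enorm _).trans ?_
    calc _ ≤ ∫⁻ v, ENNReal.ofReal (mixedSum q) ∂cubeMeasure n := by
          refine lintegral_mono_ae ?_
          filter_upwards [ha1, ae_cubeMeasure_abs_le n] with v hv1 hv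
          rw [← ofReal_norm]
          apply ENNReal.ofReal_le_ofReal
          set r : ℝ := biPoly q u v - biPoly q u 0 - (biPoly q 0 v - biPoly q 0 0) with hr
          have h2 : Complex.exp (Complex.I * (biPoly q u v : ℂ)) * a v -
              Complex.exp (Complex.I * (s : ℂ)) *
                (Complex.exp (Complex.I * (biPoly q 0 v : ℂ)) * a v) =
              Complex.exp (Complex.I * ((s + biPoly q 0 v : ℝ) : ℂ)) *
                (Complex.exp (Complex.I * (r : ℂ)) - 1) * a v := by
            have h3 : Complex.exp (Complex.I * (biPoly q u v : ℂ)) =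
                Complex.exp (Complex.I * ((s + biPoly q 0 v : ℝ) : ℂ)) *
                  Complex.exp (Complex.I * (r : ℂ)) := by
              rw [← Complex.exp_add, ← mul_add, ← Complex.ofReal_add]
              congr 3
              rw [hr, hs]; ring
            rw [h3, Complex.ofReal_add, mul_add, Complex.exp_add]
            ring
          rw [h2, norm_mul, norm_mul, norm_exp_I_mul_ofReal', one_mul]
          refine (mul_le_of_le_one_right (norm_nonneg _) hv1).trans ?_
          exact Real.norm_exp_I_mul_ofReal_sub_one_le.trans
            (abs_biPoly_mixed_difference_le q hu hv)
      _ = _ := by rw [lintegral_const, cubeMeasure_univ, mul_comm]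
  refine (lintegral_mono_ae hpt).trans (le_of_eq ?_)
  rw [lintegral_const, cubeMeasure_univ, mul_right_comm, ← mul_pow]
  norm_num

/-- Large phases: the oscillation gives a gain, with no use of cancellation. -/
lemma exists_lintegral_enorm_osc_mul_mixedSum_rpow_le (n d : ℕ) {e : ℝ} (he : 0 < e)
    (hed : e * (d + 1) ≤ 1 / 2) :
    ∃ C : ℝ≥0, ∀ (q : (Fin n → Fin (d + 1)) → (Fin n → Fin (d + 1)) → ℝ) (a : (Fin n → ℝ) → ℂ),
      AEStronglyMeasurable a (cubeMeasure n) → (∀ᵐ v ∂cubeMeasure n, ‖a v‖ ≤ 1) →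
      (∫⁻ u, ‖∫ v, Complex.exp (Complex.I * (biPoly q u v : ℂ)) * a v ∂cubeMeasure n‖ₑ
        ∂cubeMeasure n) * ENNReal.ofReal (mixedSum q) ^ (e / 4) ≤ C := by
  obtain ⟨C₁, h1⟩ := exists_enorm_integral_exp_multiPoly_le n d he hed
  obtain ⟨C₂, -, h2⟩ := exists_lintegral_multiPoly_rpow_neg_le n d (half_pos he)
    (by have : 0 ≤ e * (d + 1) := by positivity
        linarith)
  let N : ℝ≥0 := Fintype.card (Fin n → Fin (d + 1))
  let C₃ : ℝ≥0 := (2 ^ n * (C₁ * (2 ^ n * C₂))) ^ (1 / 2 : ℝ)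
  refine ⟨N * (N * C₃), fun q a ha ha1 => ?_⟩
  set I := ∫⁻ u, ‖∫ v, Complex.exp (Complex.I * (biPoly q u v : ℂ)) * a v ∂cubeMeasure n‖ₑ
    ∂cubeMeasure n with hI
  have hkm : Measurable (Function.uncurry fun u v : Fin n → ℝ =>
      Complex.exp (Complex.I * (biPoly q u v : ℂ))) := by
    have := continuous_biPoly q
    apply Continuous.measurable
    unfold Function.uncurry
    fun_prop
  have hsq : I ^ 2 ≤ 2 ^ n * ∫⁻ u,
      ‖∫ v, Complex.exp (Complex.I * (biPoly q u v : ℂ)) * a v ∂cubeMeasure n‖ₑ ^ 2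
        ∂cubeMeasure n := by
    have hm : AEMeasurable (fun u => ‖∫ v, Complex.exp (Complex.I * (biPoly q u v : ℂ)) * a v
        ∂cubeMeasure n‖ₑ) (cubeMeasure n) :=
      (AEStronglyMeasurable.integral_prod_right' (μ := cubeMeasure n) (ν := cubeMeasure n)
        (hkm.aestronglyMeasurable.mul ha.comp_snd)).enorm
    have := ENNReal.lintegral_mul_le_Lp_mul_Lq (cubeMeasure n) Real.HolderConjugate.two_two
      hm (aemeasurable_const (b := (1 : ℝ≥0∞)))
    simp only [Pi.mul_apply, mul_one, ENNReal.one_rpow, lintegral_const, one_mul,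
      cubeMeasure_univ] at this
    calc I ^ 2 ≤ _ := pow_le_pow_left' this 2
      _ = _ := by
        rw [mul_pow, ← ENNReal.rpow_natCast, ← ENNReal.rpow_natCast, ← ENNReal.rpow_mul,
          ← ENNReal.rpow_mul, mul_comm]
        norm_num
  -- It is enough to treat the mixed coefficients one at a time.
  have hcoef : ∀ α β, α ≠ 0 → β ≠ 0 → I * ‖q α β‖ₑ ^ (e / 4) ≤ C₃ := by
    intro α β hα hβ
    -- The difference of the phases at `v` and `w` has the coefficients
    -- `multiPoly (q α) v - multiPoly (q α) w` as a polynomial in `u`.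
    have hTT := lintegral_enorm_integral_sq_le (μ := cubeMeasure n) (ν := cubeMeasure n) hkm
      (fun u v => (norm_exp_I_mul_ofReal' _).le) ha ha1
    have hz : ∀ z : (Fin n → ℝ) × (Fin n → ℝ),
        ‖∫ u, Complex.exp (Complex.I * (biPoly q u z.1 : ℂ)) *
          (starRingEnd ℂ) (Complex.exp (Complex.I * (biPoly q u z.2 : ℂ))) ∂cubeMeasure n‖ₑ ≤
        C₁ * ‖multiPoly (q α) z.1 - multiPoly (q α) z.2‖ₑ ^ (-(e / 2)) := by
      intro z
      have := h1 (fun α => multiPoly (q α) z.1 - multiPoly (q α) z.2) α hα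
      convert this using 3
      congr with u
      rw [multiPoly_sub, ← Complex.exp_conj, ← Complex.exp_add, map_mul, Complex.conj_I,
        Complex.conj_ofReal]
      congr 1
      simp only [biPoly]
      push_cast
      ring
    have hlin : ∫⁻ z, C₁ * ‖multiPoly (q α) z.1 - multiPoly (q α) z.2‖ₑ ^ (-(e / 2))
        ∂((cubeMeasure n).prod (cubeMeasure n)) ≤
        C₁ * (2 ^ n * C₂) * ‖q α β‖ₑ ^ (-(e / 2)) := by
      have hc := continuous_multiPoly (q α)
      have hc' : Continuous fun z : (Fin n → ℝ) × (Fin n → ℝ) =>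
        multiPoly (q α) z.1 - multiPoly (q α) z.2 := by fun_prop
      rw [lintegral_const_mul' _ _ ENNReal.coe_ne_top, lintegral_prod_symm', mul_assoc]
      swap
      · exact hc'.measurable.enorm.pow_const _
      gcongr
      calc _ ≤ ∫⁻ w, C₂ * ‖q α β‖ₑ ^ (-(e / 2)) ∂cubeMeasure n := by
            refine lintegral_mono fun w => ?_
            -- Subtracting a constant does not change the coefficient of index `β ≠ 0`.
            have := h2 (fun γ => q α γ - if γ = 0 then multiPoly (q α) w else 0) β
            simp only [if_neg hβ, sub_zero] at this
            refine le_trans (le_of_eq ?_) this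
            congr with v
            rw [multiPoly_sub]
            congr 3
            exact (multiPoly_const _ _).symm
        _ = _ := by rw [lintegral_const, cubeMeasure_univ]; ring
    have hfin : I ^ 2 ≤ 2 ^ n * (C₁ * (2 ^ n * C₂)) * ‖q α β‖ₑ ^ (-(e / 2)) := by
      refine hsq.trans ?_
      rw [mul_assoc]
      gcongr
      exact hTT.trans ((lintegral_mono hz).trans hlin)
    rcases eq_or_ne (q α β) 0 with h0 | h0
    · rw [h0]; simp [he]
    have hx0 : ‖q α β‖ₑ ≠ 0 := by simpa using h0
    have h3 : (I * ‖q α β‖ₑ ^ (e / 4)) ^ 2 ≤ 2 ^ n * (C₁ * (2 ^ n * C₂)) := by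
      rw [mul_pow, ← ENNReal.rpow_natCast (_ ^ (e / 4)), ← ENNReal.rpow_mul]
      calc _ ≤ (2 ^ n * (C₁ * (2 ^ n * C₂)) * ‖q α β‖ₑ ^ (-(e / 2))) *
            ‖q α β‖ₑ ^ (e / 4 * (2 : ℕ)) := by
            gcongr
        _ = _ := by
          rw [mul_assoc, ← ENNReal.rpow_add _ _ hx0 (by simp)]
          have : -(e / 2) + e / 4 * (2 : ℕ) = 0 := by push_cast; ring
          rw [this, ENNReal.rpow_zero, mul_one]
    have h4 : ((C₃ : ℝ≥0) : ℝ≥0∞) = (2 ^ n * (C₁ * (2 ^ n * C₂)) : ℝ≥0∞) ^ (1 / 2 : ℝ) := by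
      rw [ENNReal.coe_rpow_of_nonneg _ (by norm_num)]
      push_cast
      rfl
    rw [h4, one_div, ENNReal.le_rpow_inv_iff (by norm_num)]
    exact_mod_cast h3
  have hsum : ENNReal.ofReal (mixedSum q) ^ (e / 4) ≤
      ∑ α ∈ Finset.univ.erase 0, ∑ β ∈ Finset.univ.erase 0, ‖q α β‖ₑ ^ (e / 4) := by
    have hadd : ∀ x y : ℝ≥0∞, (x + y) ^ (e / 4) ≤ x ^ (e / 4) + y ^ (e / 4) := fun x y =>
      ENNReal.rpow_add_le_add_rpow _ _ (by positivity)
        (by nlinarith [mul_nonneg he.le (Nat.cast_nonneg (α := ℝ) d)])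
    have hzero : (0 : ℝ≥0∞) ^ (e / 4) = 0 := ENNReal.zero_rpow_of_pos (by positivity)
    rw [mixedSum, ENNReal.ofReal_sum_of_nonneg
      fun _ _ => Finset.sum_nonneg fun _ _ => abs_nonneg _]
    refine (Finset.le_sum_of_subadditive (fun x : ℝ≥0∞ => x ^ (e / 4)) hzero.le hadd _ _).trans ?_
    gcongr with α hα
    rw [ENNReal.ofReal_sum_of_nonneg fun _ _ => abs_nonneg _]
    refine (Finset.le_sum_of_subadditive (fun x : ℝ≥0∞ => x ^ (e / 4)) hzero.le hadd _ _).trans ?_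
    gcongr with β hβ
    rw [Real.enorm_eq_ofReal_abs]
  calc I * ENNReal.ofReal (mixedSum q) ^ (e / 4)
      ≤ I * ∑ α ∈ Finset.univ.erase 0, ∑ β ∈ Finset.univ.erase 0, ‖q α β‖ₑ ^ (e / 4) := by gcongr
    _ = ∑ α ∈ Finset.univ.erase 0, ∑ β ∈ Finset.univ.erase 0, I * ‖q α β‖ₑ ^ (e / 4) := by
        simp only [Finset.mul_sum]
    _ ≤ ∑ α ∈ Finset.univ.erase (0 : Fin n → Fin (d + 1)),
          ∑ β ∈ Finset.univ.erase (0 : Fin n → Fin (d + 1)), (C₃ : ℝ≥0∞) := by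
        gcongr with α hα β hβ
        exact hcoef α β (Finset.ne_of_mem_erase hα) (Finset.ne_of_mem_erase hβ)
    _ ≤ ∑ α : Fin n → Fin (d + 1), ∑ β : Fin n → Fin (d + 1), (C₃ : ℝ≥0∞) := by
        refine (Finset.sum_le_sum_of_subset (Finset.subset_univ _)).trans ?_
        gcongr with α hα
        exact Finset.subset_univ _
    _ = _ := by
        simp only [Finset.sum_const, Finset.card_univ, nsmul_eq_mul, N]
        push_cast
        rfl

/-- Dyadic summation: if `S_j` at least doubles at each step and `b_j` is controlled both by `S_j`
and by a negative power of `S_j`, then `∑ b_j` is bounded independently of `S`. -/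
lemma tsum_le_of_doubling {S b : ℕ → ℝ≥0∞} {C : ℝ≥0∞} {δ : ℝ} (hδ : 0 < δ)
    (hS : ∀ j, 2 * S j ≤ S (j + 1)) (h1 : ∀ j, b j ≤ C * S j)
    (h2 : ∀ j, b j * S j ^ δ ≤ C) :
    ∑' j, b j ≤ C * (2 + (1 - 2 ^ (-δ))⁻¹) := by
  have hsum : ∀ N, ∑ j ∈ Finset.range N, S j ≤ S N := by
    intro N
    induction N with
    | zero => simp
    | succ N ih =>
      rw [Finset.sum_range_succ]
      exact (add_le_add_left ih _).trans ((two_mul (S N)).symm.le.trans (hS N))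
  have hsmall : ∀ N, (∀ j < N, S j ≤ 1) → ∑ j ∈ Finset.range N, b j ≤ C * 2 := by
    intro N hN
    refine (Finset.sum_le_sum fun j _ => h1 j).trans ?_
    rw [← Finset.mul_sum]
    gcongr
    cases N with
    | zero => simp
    | succ N =>
      rw [Finset.sum_range_succ]
      refine (add_le_add_left (hsum N) _).trans ?_
      have := hN N (Nat.lt_succ_self N)
      calc S N + S N ≤ 1 + 1 := add_le_add this this
        _ = 2 := one_add_one_eq_two
  by_cases hall : ∀ j, S j ≤ 1
  · refine ENNReal.tsum_le_of_sum_range_le fun N => (hsmall N fun j _ => hall j).trans ?_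
    gcongr
    exact le_self_add
  · push Not at hall
    classical
    -- From the first index `J` with `S J > 1` on, `S` grows geometrically.
    set J := Nat.find hall with hJ
    have hJ1 : 1 < S J := Nat.find_spec hall
    have hJ2 : ∀ j < J, S j ≤ 1 := fun j hj => not_lt.1 (Nat.find_min hall hj)
    have hgrow : ∀ i, 2 ^ i ≤ S (i + J) := by
      intro i
      induction i with
      | zero => simpa using hJ1.le
      | succ i ih =>
        rw [pow_succ, mul_comm, add_right_comm]
        exact (mul_le_mul_right ih 2).trans (hS _)
    have hbig : ∀ i, b (i + J) ≤ C * (2 ^ (-δ)) ^ i := by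
      intro i
      have h3 : b (i + J) * ((2 : ℝ≥0∞) ^ i) ^ δ ≤ C :=
        le_trans (by gcongr; exact hgrow i) (h2 (i + J))
      have h4 : (2 : ℝ≥0∞) ^ i ≠ 0 := by simp
      have h5 : (2 : ℝ≥0∞) ^ i ≠ ∞ := by simp
      calc b (i + J) = b (i + J) * (((2 : ℝ≥0∞) ^ i) ^ δ * ((2 : ℝ≥0∞) ^ i) ^ (-δ)) := by
            rw [← ENNReal.rpow_add _ _ h4 h5]; simp
        _ = b (i + J) * ((2 : ℝ≥0∞) ^ i) ^ δ * ((2 : ℝ≥0∞) ^ i) ^ (-δ) := by rw [mul_assoc]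
        _ ≤ C * ((2 : ℝ≥0∞) ^ i) ^ (-δ) := by gcongr
        _ = _ := by
          congr 1
          rw [← ENNReal.rpow_natCast, ← ENNReal.rpow_natCast, ← ENNReal.rpow_mul,
            ← ENNReal.rpow_mul, mul_comm]
    rw [← ENNReal.summable.sum_add_tsum_nat_add' (k := J), mul_add]
    gcongr
    · exact hsmall J hJ2
    · refine (ENNReal.tsum_le_tsum hbig).trans ?_
      rw [ENNReal.tsum_mul_left, ENNReal.tsum_geometric]

/-! ### Rescaling to the unit cube -/

/-- The affine parametrization `u ↦ c + ρ u` of the cube of center `c` and side `2ρ` by the unit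
cube. -/
noncomputable def cubeMap {n : ℕ} (c : EuclideanSpace ℝ (Fin n)) (ρ : ℝ) (u : Fin n → ℝ) :
    EuclideanSpace ℝ (Fin n) :=
  c + ρ • WithLp.toLp 2 u

lemma cubeMap_apply {n : ℕ} (c : EuclideanSpace ℝ (Fin n)) (ρ : ℝ) (u : Fin n → ℝ) (i : Fin n) :
    cubeMap c ρ u i = c i + ρ * u i := by
  simp [cubeMap]

lemma measurableSet_axisCube {n : ℕ} (c : EuclideanSpace ℝ (Fin n)) (r : ℝ) :
    MeasurableSet (axisCube c r) := by
  have : axisCube c r = ⋂ i, {y : EuclideanSpace ℝ (Fin n) | |y i - c i| ≤ r} := by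
    ext y; simp [axisCube]
  rw [this]
  refine MeasurableSet.iInter fun i => measurableSet_le ?_ measurable_const
  fun_prop

lemma measurePreserving_cubeMap {n : ℕ} (c : EuclideanSpace ℝ (Fin n)) {ρ : ℝ} (hρ : 0 < ρ) :
    MeasurePreserving (cubeMap c ρ) (ENNReal.ofReal (ρ ^ n) • cubeMeasure n)
      (volume.restrict (axisCube c ρ)) := by
  have h1 : MeasurePreserving (fun x : EuclideanSpace ℝ (Fin n) => ρ • x)
      (ENNReal.ofReal (ρ ^ n) • volume) volume := by
    refine ⟨measurable_const_smul ρ, ?_⟩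
    rw [Measure.map_smul, Measure.map_addHaar_smul _ hρ.ne', finrank_euclideanSpace_fin,
      smul_smul, ← ENNReal.ofReal_mul (by positivity), abs_of_pos (by positivity),
      mul_inv_cancel₀ (by positivity)]
    simp
  have h2 : MeasurePreserving (fun x : EuclideanSpace ℝ (Fin n) => c + x) volume volume :=
    measurePreserving_add_left volume c
  have h3 : MeasurePreserving (WithLp.toLp 2 : (Fin n → ℝ) → EuclideanSpace ℝ (Fin n))
      (ENNReal.ofReal (ρ ^ n) • volume) (ENNReal.ofReal (ρ ^ n) • volume) :=
    (PiLp.volume_preserving_toLp (Fin n)).smul_measure _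
  have h4 : MeasurePreserving (cubeMap c ρ) (ENNReal.ofReal (ρ ^ n) • volume) volume :=
    h2.comp (h1.comp h3)
  have hpre : cubeMap c ρ ⁻¹' axisCube c ρ = Set.univ.pi fun _ => Set.Icc (-1) 1 := by
    ext u
    simp only [Set.mem_univ_pi, Set.mem_preimage, axisCube, Set.mem_ofPred_eq, cubeMap_apply,
      add_sub_cancel_left, abs_mul, abs_of_pos hρ, Set.mem_Icc, ← abs_le]
    refine forall_congr' fun i => ?_
    rw [mul_le_iff_le_one_right hρ]
  have h5 := h4.restrict_preimage (measurableSet_axisCube c ρ)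
  rw [Measure.restrict_smul, hpre, volume_pi, Measure.restrict_pi_pi] at h5
  exact h5

lemma measurableEmbedding_cubeMap {n : ℕ} (c : EuclideanSpace ℝ (Fin n)) {ρ : ℝ} (hρ : 0 < ρ) :
    MeasurableEmbedding (cubeMap c ρ) :=
  (measurableEmbedding_addLeft c).comp
    ((measurableEmbedding_const_smul₀ hρ.ne').comp
      (MeasurableEquiv.toLp 2 (Fin n → ℝ)).measurableEmbedding)

lemma lintegral_axisCube {n : ℕ} (c : EuclideanSpace ℝ (Fin n)) {ρ : ℝ} (hρ : 0 < ρ)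
    (g : EuclideanSpace ℝ (Fin n) → ℝ≥0∞) :
    ∫⁻ x in axisCube c ρ, g x =
      ENNReal.ofReal (ρ ^ n) * ∫⁻ u, g (cubeMap c ρ u) ∂cubeMeasure n := by
  rw [← (measurePreserving_cubeMap c hρ).lintegral_comp_emb (measurableEmbedding_cubeMap c hρ),
    lintegral_smul_measure, smul_eq_mul]

lemma integral_axisCube {n : ℕ} (c : EuclideanSpace ℝ (Fin n)) {ρ : ℝ} (hρ : 0 < ρ)
    (g : EuclideanSpace ℝ (Fin n) → ℂ) :
    ∫ x in axisCube c ρ, g x = ∫ u, (ρ ^ n : ℝ) * g (cubeMap c ρ u) ∂cubeMeasure n := by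
  rw [← (measurePreserving_cubeMap c hρ).integral_comp (measurableEmbedding_cubeMap c hρ),
    integral_smul_measure, integral_const_mul, ENNReal.toReal_ofReal (by positivity)]
  rfl

lemma volume_axisCube {n : ℕ} (c : EuclideanSpace ℝ (Fin n)) {ρ : ℝ} (hρ : 0 < ρ) :
    volume (axisCube c ρ) = ENNReal.ofReal ((2 * ρ) ^ n) := by
  have := lintegral_axisCube c hρ (fun _ => 1)
  rw [lintegral_one, lintegral_one, Measure.restrict_apply_univ, cubeMeasure_univ] at this
  rw [this, mul_comm 2, mul_pow, ENNReal.ofReal_mul (by positivity), ENNReal.ofReal_pow (p := 2)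
    (by norm_num)]
  norm_num

/-- A polynomial on `ℝⁿ × ℝⁿ` of degree at most `d` has an expansion with exponents at most `d`. -/
lemma exists_eval_eq_biPoly {n d : ℕ} (P : MvPolynomial (Fin n ⊕ Fin n) ℝ)
    (hP : P.totalDegree ≤ d) :
    ∃ q : (Fin n → Fin (d + 1)) → (Fin n → Fin (d + 1)) → ℝ, ∀ u v : Fin n → ℝ,
      MvPolynomial.eval (Sum.elim u v) P = biPoly q u v := by
  classical
  let ι : (Fin n → Fin (d + 1)) × (Fin n → Fin (d + 1)) → ((Fin n ⊕ Fin n) →₀ ℕ) := fun z =>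
    Finsupp.equivFunOnFinite.symm (Sum.elim (fun i => (z.1 i : ℕ)) (fun i => (z.2 i : ℕ)))
  have hι : Function.Injective ι := by
    intro z w h
    have h' := Finsupp.equivFunOnFinite.symm.injective h
    ext i
    · exact congr_fun h' (Sum.inl i)
    · exact congr_fun h' (Sum.inr i)
  refine ⟨fun α β => P.coeff (ι (α, β)), fun u v => ?_⟩
  rw [MvPolynomial.eval_eq']
  have hsub : P.support ⊆ Finset.univ.image ι := by
    intro s hs
    have hle : ∀ i, s i < d + 1 := fun i => Nat.lt_succ_iff.2
      (((MvPolynomial.le_degreeOf_of_mem_support i hs).trans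
        (MvPolynomial.degreeOf_le_totalDegree P i)).trans hP)
    refine Finset.mem_image.2 ⟨(fun i => ⟨s (Sum.inl i), hle _⟩, fun i => ⟨s (Sum.inr i), hle _⟩),
      Finset.mem_univ _, ?_⟩
    ext i
    rcases i with i | i <;> simp [ι]
  rw [Finset.sum_subset hsub fun s _ hs => by
    rw [MvPolynomial.notMem_support_iff.1 hs, zero_mul], Finset.sum_image hι.injOn,
    Fintype.sum_prod_type]
  simp only [biPoly, multiPoly]
  refine Finset.sum_congr rfl fun α _ => ?_
  rw [Finset.sum_mul]
  refine Finset.sum_congr rfl fun β _ => ?_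
  rw [Fintype.prod_sum_type]
  simp only [ι, Finsupp.equivFunOnFinite_symm_apply_apply, Sum.elim_inl, Sum.elim_inr]
  ring

lemma totalDegree_aeval_le {σ τ : Type*} (f : σ → MvPolynomial τ ℝ)
    (hf : ∀ i, (f i).totalDegree ≤ 1) (P : MvPolynomial σ ℝ) :
    (MvPolynomial.aeval f P).totalDegree ≤ P.totalDegree := by
  rw [MvPolynomial.aeval_def, MvPolynomial.eval₂_eq]
  refine MvPolynomial.totalDegree_finsetSum_le fun s hs => ?_
  refine (MvPolynomial.totalDegree_mul _ _).trans ?_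
  rw [MvPolynomial.algebraMap_eq, MvPolynomial.totalDegree_C, zero_add]
  refine (MvPolynomial.totalDegree_finsetProd _ _).trans ?_
  refine le_trans (Finset.sum_le_sum fun i _ => ?_) (MvPolynomial.le_totalDegree hs)
  exact (MvPolynomial.totalDegree_pow _ _).trans (by nlinarith [hf i])

/-- A phase of degree at most `d`, recentered at `c` and rescaled in the second variable. -/
lemma exists_phase_eq_biPoly {n d : ℕ} (P : MvPolynomial (Fin n ⊕ Fin n) ℝ)
    (hP : P.totalDegree ≤ d) (c : EuclideanSpace ℝ (Fin n)) (r : ℝ) :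
    ∃ q : (Fin n → Fin (d + 1)) → (Fin n → Fin (d + 1)) → ℝ, ∀ (ρ : ℝ) (u v : Fin n → ℝ),
      phase P (cubeMap c ρ u) (cubeMap c r v) = biPoly q (ρ • u) v := by
  let f : Fin n ⊕ Fin n → MvPolynomial (Fin n ⊕ Fin n) ℝ :=
    Sum.elim (fun i => MvPolynomial.C (c i) + MvPolynomial.X (Sum.inl i))
      (fun i => MvPolynomial.C (c i) + MvPolynomial.C r * MvPolynomial.X (Sum.inr i))
  have hf : ∀ i, (f i).totalDegree ≤ 1 := by
    rintro (i | i)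
    · refine (MvPolynomial.totalDegree_add _ _).trans ?_
      simp
    · refine (MvPolynomial.totalDegree_add _ _).trans (max_le (by simp) ?_)
      exact (MvPolynomial.totalDegree_mul _ _).trans (by simp)
  obtain ⟨q, hq⟩ := exists_eval_eq_biPoly (MvPolynomial.aeval f P)
    ((totalDegree_aeval_le f hf P).trans hP)
  refine ⟨q, fun ρ u v => ?_⟩
  rw [← hq, phase, MvPolynomial.aeval_def, MvPolynomial.eval_eval₂]
  rw [MvPolynomial.eval, MvPolynomial.coe_eval₂Hom]
  congr 1
  · ext; simp
  · funext i
    rcases i with i | i <;> simp [f, cubeMap_apply]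

lemma biPoly_smul_left {n d : ℕ} (q : (Fin n → Fin (d + 1)) → (Fin n → Fin (d + 1)) → ℝ)
    (ρ : ℝ) (u v : Fin n → ℝ) :
    biPoly q (ρ • u) v = biPoly (fun α β => ρ ^ (∑ i, (α i : ℕ)) * q α β) u v := by
  simp only [biPoly, multiPoly]
  refine Finset.sum_congr rfl fun α _ => ?_
  simp only [Pi.smul_apply, smul_eq_mul, mul_pow, Finset.prod_mul_distrib,
    Finset.prod_pow_eq_pow_sum, mul_assoc, ← Finset.mul_sum]
  ring

/-- Doubling the scale in `u` at least doubles the coefficients of the mixed monomials. -/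
lemma two_mul_mixedSum_le {n d : ℕ} (q : (Fin n → Fin (d + 1)) → (Fin n → Fin (d + 1)) → ℝ)
    (ρ : ℝ) : 2 * mixedSum (fun α β => ρ ^ (∑ i, (α i : ℕ)) * q α β) ≤
      mixedSum (fun α β => (2 * ρ) ^ (∑ i, (α i : ℕ)) * q α β) := by
  simp only [mixedSum, Finset.mul_sum]
  refine Finset.sum_le_sum fun α hα => Finset.sum_le_sum fun β _ => ?_
  have hα' : 1 ≤ ∑ i, (α i : ℕ) := by
    obtain ⟨i, hi⟩ := Function.ne_iff.1 (Finset.ne_of_mem_erase hα)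
    have h1 : 1 ≤ (α i : ℕ) := Nat.one_le_iff_ne_zero.2 fun h => hi (Fin.ext (by simpa using h))
    exact h1.trans (Finset.single_le_sum (f := fun i => (α i : ℕ)) (fun _ _ => Nat.zero_le _)
      (Finset.mem_univ i))
  rw [mul_pow, mul_assoc, abs_mul (2 ^ _), abs_of_pos (by positivity : (0 : ℝ) < 2 ^ _)]
  gcongr
  exact le_self_pow₀ (by norm_num) (by omega)

/-! ### Atoms away from their center -/

lemma quasiMeasurePreserving_cubeMap {n : ℕ} (c : EuclideanSpace ℝ (Fin n)) {ρ : ℝ} (hρ : 0 < ρ) :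
    Measure.QuasiMeasurePreserving (cubeMap c ρ) (cubeMeasure n)
      (volume.restrict (axisCube c ρ)) := by
  have h := measurePreserving_cubeMap c hρ
  refine ⟨h.measurable, ?_⟩
  have h0 : ENNReal.ofReal (ρ ^ n) ≠ 0 := by
    rw [Ne, ENNReal.ofReal_eq_zero, not_le]; positivity
  rw [← h.map_eq, Measure.map_smul]
  exact Measure.absolutelyContinuous_smul h0

lemma norm_atom_rescaled_le {n : ℕ} {a : EuclideanSpace ℝ (Fin n) → ℂ}
    {c : EuclideanSpace ℝ (Fin n)} {r : ℝ} (hr : 0 < r)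
    (hbound : ∀ᵐ x, x ∈ axisCube c r → ‖a x‖ ≤ (volume.real (axisCube c r))⁻¹) :
    ∀ᵐ v ∂cubeMeasure n, ‖((r ^ n : ℝ) : ℂ) * a (cubeMap c r v)‖ ≤ 1 := by
  have h1 : ∀ᵐ x ∂volume.restrict (axisCube c r), ‖a x‖ ≤ (volume.real (axisCube c r))⁻¹ :=
    ae_restrict_of_ae_restrict_of_subset subset_rfl (by
      rw [ae_restrict_iff'₀]
      · exact hbound
      · exact (measurableSet_axisCube c r).nullMeasurableSet)
  filter_upwards [(quasiMeasurePreserving_cubeMap c hr).ae h1] with v hv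
  rw [norm_mul, Complex.norm_real, Real.norm_of_nonneg (by positivity)]
  rw [Measure.real, volume_axisCube c hr, ENNReal.toReal_ofReal (by positivity)] at hv
  calc _ ≤ r ^ n * ((2 * r) ^ n)⁻¹ := by gcongr
    _ ≤ 1 := by
        rw [← div_eq_mul_inv, div_le_one (by positivity)]
        gcongr
        linarith

/-- The central estimate: away from the center of the cube, the oscillatory integral of an atom is
integrable against `‖x - c‖ ^ (-n)`, uniformly in the atom and in the polynomial. On the dyadic
shell at distance `ρ = 2ʲ r` from `c`, the phase rescaled to unit cubes has mixed coefficients which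
at least double with `j`: cancellation handles the shells on which they are small, and oscillation
the others. -/
lemma exists_lintegral_osc_atom_le (n d : ℕ) :
    ∃ C : ℝ≥0, ∀ P : MvPolynomial (Fin n ⊕ Fin n) ℝ, P.totalDegree ≤ d →
      ∀ (a : EuclideanSpace ℝ (Fin n) → ℂ) (c : EuclideanSpace ℝ (Fin n)) (r : ℝ), 0 < r →
      AEStronglyMeasurable a volume → Function.support a ⊆ axisCube c r →
      (∀ᵐ x, x ∈ axisCube c r → ‖a x‖ ≤ (volume.real (axisCube c r))⁻¹) →
      ∫ y, Complex.exp (Complex.I * (phase P c y : ℂ)) * a y = 0 →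
      ∫⁻ x in {x | r ≤ ‖x - c‖}, ENNReal.ofReal (‖x - c‖ ^ (-(n : ℝ))) *
        ‖∫ y, Complex.exp (Complex.I * (phase P x y : ℂ)) * a y‖ₑ ≤ C := by
  have hd : (0 : ℝ) < d + 1 := by positivity
  obtain ⟨e, he, hed⟩ : ∃ e : ℝ, 0 < e ∧ e * (d + 1) ≤ 1 / 2 :=
    ⟨1 / (2 * (d + 1)), by positivity, by field_simp; exact le_rfl⟩
  obtain ⟨C₁, hC₁⟩ := exists_lintegral_enorm_osc_mul_mixedSum_rpow_le n d he hed
  have hK : (2 : ℝ≥0∞) ^ n * ((4 ^ n + C₁) * (2 + (1 - 2 ^ (-(e / 4)))⁻¹)) ≠ ∞ := by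
    have h2 : (2 : ℝ≥0∞) ^ (-(e / 4)) < 1 :=
      ENNReal.rpow_lt_one_of_one_lt_of_neg (by norm_num) (by linarith)
    have h3 : (1 - (2 : ℝ≥0∞) ^ (-(e / 4)))⁻¹ ≠ ∞ := by
      rw [Ne, ENNReal.inv_eq_top, tsub_eq_zero_iff_le, not_le]
      exact h2
    finiteness
  refine ⟨((2 : ℝ≥0∞) ^ n * ((4 ^ n + C₁) * (2 + (1 - 2 ^ (-(e / 4)))⁻¹))).toNNReal, ?_⟩
  intro P hP a c r hr ha hsupp hbound hcancel
  rw [ENNReal.coe_toNNReal hK]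
  obtain ⟨q, hq⟩ := exists_phase_eq_biPoly P hP c r
  set F : EuclideanSpace ℝ (Fin n) → ℂ := fun x =>
    ∫ y, Complex.exp (Complex.I * (phase P x y : ℂ)) * a y with hFdef
  let a' : (Fin n → ℝ) → ℂ := fun v => ((r ^ n : ℝ) : ℂ) * a (cubeMap c r v)
  have ha' : AEStronglyMeasurable a' (cubeMeasure n) :=
    ((ha.restrict (s := axisCube c r)).comp_quasiMeasurePreserving
      (quasiMeasurePreserving_cubeMap c hr)).const_mul _
  have ha1 : ∀ᵐ v ∂cubeMeasure n, ‖a' v‖ ≤ 1 := norm_atom_rescaled_le hr hbound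
  have hF : ∀ (ρ : ℝ) (u : Fin n → ℝ), F (cubeMap c ρ u) =
      ∫ v, Complex.exp (Complex.I * (biPoly q (ρ • u) v : ℂ)) * a' v ∂cubeMeasure n := by
    intro ρ u
    simp only [hFdef]
    rw [← setIntegral_eq_integral_of_forall_compl_eq_zero (s := axisCube c r) (fun y hy => by
      rw [Function.notMem_support.1 fun h => hy (hsupp h), mul_zero]), integral_axisCube c hr]
    refine integral_congr_ae (Filter.Eventually.of_forall fun v => ?_)
    simp only [a', hq]
    ring
  have hcancel' : ∫ v, Complex.exp (Complex.I * (biPoly q 0 v : ℂ)) * a' v ∂cubeMeasure n = 0 := by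
    have h := hF 0 0
    have hc : cubeMap c 0 0 = c := by simp [cubeMap]
    rw [smul_zero, hc] at h
    rw [← h]
    exact hcancel
  -- The shell `R j ≤ ‖x - c‖ < R (j + 1)` lies in the cube of center `c` and side `2 R (j + 1)`.
  let R : ℕ → ℝ := fun j => r * 2 ^ j
  have hR : ∀ j, 0 < R j := fun j => by simp only [R]; positivity
  let q' : ℕ → (Fin n → Fin (d + 1)) → (Fin n → Fin (d + 1)) → ℝ := fun j α β =>
    R (j + 1) ^ (∑ i, (α i : ℕ)) * q α β
  let b : ℕ → ℝ≥0∞ := fun j => ∫⁻ u, ‖F (cubeMap c (R (j + 1)) u)‖ₑ ∂cubeMeasure n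
  have hb : ∀ j, b j = ∫⁻ u, ‖∫ v, Complex.exp (Complex.I * (biPoly (q' j) u v : ℂ)) * a' v
      ∂cubeMeasure n‖ₑ ∂cubeMeasure n := by
    intro j
    simp only [b, hF, biPoly_smul_left, q']
  have hS : ∀ j, 2 * ENNReal.ofReal (mixedSum (q' j)) ≤ ENNReal.ofReal (mixedSum (q' (j + 1))) := by
    intro j
    have h2 : (2 : ℝ≥0∞) = ENNReal.ofReal 2 := by norm_num
    rw [h2, ← ENNReal.ofReal_mul (by norm_num)]
    apply ENNReal.ofReal_le_ofReal
    refine (two_mul_mixedSum_le q (R (j + 1))).trans (le_of_eq ?_)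
    have : R (j + 1 + 1) = 2 * R (j + 1) := by simp only [R]; ring
    simp only [q', this]
  have hb1 : ∀ j, b j ≤ (4 ^ n + C₁) * ENNReal.ofReal (mixedSum (q' j)) := by
    intro j
    rw [hb]
    refine (lintegral_enorm_osc_le_mixedSum (q' j) ha' ha1 ?_).trans ?_
    · have h := fun v => biPoly_smul_left q (R (j + 1)) 0 v
      simp only [smul_zero] at h
      simp only [q', ← h]
      exact hcancel'
    · gcongr
      exact le_self_add
  have hb2 : ∀ j, b j * ENNReal.ofReal (mixedSum (q' j)) ^ (e / 4) ≤ 4 ^ n + C₁ := by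
    intro j
    rw [hb]
    exact (hC₁ (q' j) a' ha' ha1).trans le_add_self
  have htsum := tsum_le_of_doubling (by positivity) hS hb1 hb2
  let shell : ℕ → Set (EuclideanSpace ℝ (Fin n)) := fun j =>
    {x | R j ≤ ‖x - c‖ ∧ ‖x - c‖ < R (j + 1)}
  have hshell : ∀ j, MeasurableSet (shell j) := by
    intro j
    have hm : Measurable fun x : EuclideanSpace ℝ (Fin n) => ‖x - c‖ := by fun_prop
    exact (measurableSet_le measurable_const hm).inter (measurableSet_lt hm measurable_const)
  have hcover : {x | r ≤ ‖x - c‖} ⊆ ⋃ j, shell j := by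
    intro x hx
    obtain ⟨j, hj1, hj2⟩ := exists_nat_pow_near (x := ‖x - c‖ / r) (y := (2 : ℝ))
      ((one_le_div hr).2 hx) one_lt_two
    refine Set.mem_iUnion.2 ⟨j, ?_, ?_⟩
    · rw [le_div_iff₀ hr] at hj1; simp only [R]; linarith
    · rw [div_lt_iff₀ hr] at hj2; simp only [R]; linarith
  refine (lintegral_mono_set hcover).trans ((lintegral_iUnion_le _ _).trans ?_)
  calc _ ≤ ∑' j, 2 ^ n * b j := by
        refine ENNReal.tsum_le_tsum fun j => ?_
        calc _ ≤ ∫⁻ x in shell j, ENNReal.ofReal (R j ^ (-(n : ℝ))) * ‖F x‖ₑ := by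
              refine setLIntegral_mono' (hshell j) fun x hx => ?_
              refine mul_le_mul_left (ENNReal.ofReal_le_ofReal ?_) _
              exact Real.rpow_le_rpow_of_nonpos (hR j) hx.1 (neg_nonpos.2 (Nat.cast_nonneg n))
          _ ≤ ∫⁻ x in axisCube c (R (j + 1)), ENNReal.ofReal (R j ^ (-(n : ℝ))) * ‖F x‖ₑ := by
              refine lintegral_mono_set fun x hx i => ?_
              have h := PiLp.norm_apply_le (x - c) i
              rw [Real.norm_eq_abs] at h
              exact h.trans hx.2.le
          _ = ENNReal.ofReal (R j ^ (-(n : ℝ))) * (ENNReal.ofReal (R (j + 1) ^ n) * b j) := by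
              rw [lintegral_const_mul' _ _ ENNReal.ofReal_ne_top, lintegral_axisCube c (hR _)]
          _ = 2 ^ n * b j := by
              rw [← mul_assoc, ← ENNReal.ofReal_mul (Real.rpow_nonneg (hR j).le _)]
              congr 1
              have h1 : R (j + 1) = 2 * R j := by simp only [R]; ring
              rw [h1, mul_pow, Real.rpow_neg (hR j).le, Real.rpow_natCast, mul_left_comm,
                inv_mul_cancel₀ (pow_pos (hR j) n).ne', mul_one, ENNReal.ofReal_pow (by norm_num)]
              norm_num
    _ = 2 ^ n * ∑' j, b j := ENNReal.tsum_mul_left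
    _ ≤ _ := by gcongr

/-! ### Integrals of homogeneous kernels -/

lemma lintegral_comp_sub_smul {n : ℕ} {α : ℝ} (hα : α ≠ 0) (x : EuclideanSpace ℝ (Fin n))
    (g : EuclideanSpace ℝ (Fin n) → ℝ≥0∞) :
    ∫⁻ y, g (x - α • y) = ENNReal.ofReal |(α ^ n)⁻¹| * ∫⁻ z, g z := by
  have h1 : ∫⁻ y, g (x - α • y) = ∫⁻ z, g (x - z) ∂(Measure.map (α • ·) volume) :=
    ((measurableEmbedding_const_smul₀ hα).lintegral_map (fun z => g (x - z))).symm
  rw [h1, Measure.map_addHaar_smul _ hα, finrank_euclideanSpace_fin, lintegral_smul_measure,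
    lintegral_sub_left_eq_self g x, smul_eq_mul]

/-- The integral converges at the origin as `t < n` and at infinity as `s + t > n`; its dependence
on `R` is found by scaling. -/
lemma exists_lintegral_add_norm_rpow_le {n : ℕ} (hn : 0 < n) {s t : ℝ} (ht0 : 0 ≤ t)
    (htn : t < n) (hst : n < s + t) :
    ∃ C : ℝ≥0, ∀ R : ℝ, 0 < R → ∫⁻ z : EuclideanSpace ℝ (Fin n),
      ENNReal.ofReal ((R + ‖z‖) ^ (-s) * ‖z‖ ^ (-t)) ≤ C * ENNReal.ofReal (R ^ (n - s - t)) := by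
  have hs : 0 < s := by linarith
  set J := ∫⁻ z : EuclideanSpace ℝ (Fin n), ENNReal.ofReal ((1 + ‖z‖) ^ (-s) * ‖z‖ ^ (-t)) with hJ
  have hfin : J ≠ ∞ := by
    have h1 : IntegrableOn (fun z : EuclideanSpace ℝ (Fin n) => ‖z‖ ^ (-t)) (Metric.ball 0 1) :=
      integrableOn_ball_of_norm_le_rpow (C := 1) (α := t)
        (by simpa using Nat.one_le_iff_ne_zero.2 hn.ne') (by simpa using htn)
        (Filter.Eventually.of_forall fun z => by
          rw [Real.norm_of_nonneg (by positivity), one_mul])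
        (by have : Measurable fun z : EuclideanSpace ℝ (Fin n) => ‖z‖ ^ (-t) := by fun_prop
            exact this.aestronglyMeasurable)
    have h2 : Integrable (fun z : EuclideanSpace ℝ (Fin n) =>
        (2 : ℝ) ^ t * (1 + ‖z‖) ^ (-(s + t))) :=
      (integrable_one_add_norm (by simpa using hst)).const_mul _
    have h3 := (h1.integrable_indicator measurableSet_ball).add h2
    refine ne_top_of_le_ne_top h3.lintegral_lt_top.ne (lintegral_mono fun z => ?_)
    apply ENNReal.ofReal_le_ofReal
    have hz : 0 ≤ ‖z‖ := norm_nonneg z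
    simp only [Pi.add_apply]
    by_cases hzb : z ∈ Metric.ball (0 : EuclideanSpace ℝ (Fin n)) 1
    · rw [Set.indicator_of_mem hzb]
      have h4 : (1 + ‖z‖) ^ (-s) ≤ 1 :=
        Real.rpow_le_one_of_one_le_of_nonpos (by linarith) (by linarith)
      have h5 : 0 ≤ ‖z‖ ^ (-t) := by positivity
      have h6 : 0 ≤ (2 : ℝ) ^ t * (1 + ‖z‖) ^ (-(s + t)) := by positivity
      nlinarith
    · rw [Set.indicator_of_notMem hzb, zero_add]
      rw [mem_ball_zero_iff, not_lt] at hzb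
      have h4 : ‖z‖ ^ (-t) ≤ ((1 + ‖z‖) / 2) ^ (-t) :=
        Real.rpow_le_rpow_of_nonpos (by positivity) (by linarith) (by linarith)
      rw [Real.div_rpow (by positivity) (by norm_num), Real.rpow_neg (by norm_num : (0 : ℝ) ≤ 2),
        div_inv_eq_mul] at h4
      rw [neg_add, Real.rpow_add (by positivity)]
      calc _ ≤ (1 + ‖z‖) ^ (-s) * ((1 + ‖z‖) ^ (-t) * 2 ^ t) := by gcongr
        _ = _ := by ring
  refine ⟨J.toNNReal, fun R hR => le_of_eq ?_⟩
  rw [ENNReal.coe_toNNReal hfin]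
  have h1 := lintegral_comp_sub_smul (n := n) (neg_ne_zero.2 (inv_ne_zero hR.ne')) 0
    (fun z => ENNReal.ofReal ((1 + ‖z‖) ^ (-s) * ‖z‖ ^ (-t)))
  have h2 : ∀ z : EuclideanSpace ℝ (Fin n), ENNReal.ofReal ((R + ‖z‖) ^ (-s) * ‖z‖ ^ (-t)) =
      ENNReal.ofReal (R ^ (-s - t)) *
        ENNReal.ofReal ((1 + ‖0 - (-R⁻¹) • z‖) ^ (-s) * ‖0 - (-R⁻¹) • z‖ ^ (-t)) := by
    intro z
    have h3 : ‖0 - (-R⁻¹) • z‖ = R⁻¹ * ‖z‖ := by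
      rw [zero_sub, neg_smul, neg_neg, norm_smul, Real.norm_of_nonneg (by positivity)]
    have h4 : 1 + R⁻¹ * ‖z‖ = R⁻¹ * (R + ‖z‖) := by field_simp
    rw [h3, h4, ← ENNReal.ofReal_mul (by positivity)]
    congr 1
    rw [Real.mul_rpow (by positivity) (by positivity),
      Real.mul_rpow (by positivity) (by positivity),
      Real.inv_rpow hR.le, Real.inv_rpow hR.le, ← Real.rpow_neg hR.le, ← Real.rpow_neg hR.le,
      neg_neg, neg_neg, sub_eq_add_neg, Real.rpow_add hR, Real.rpow_neg hR.le, Real.rpow_neg hR.le]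
    have := (Real.rpow_pos_of_pos hR s).ne'
    have := (Real.rpow_pos_of_pos hR t).ne'
    field_simp
  simp_rw [h2]
  rw [lintegral_const_mul' _ _ ENNReal.ofReal_ne_top, h1, ← mul_assoc,
    ← ENNReal.ofReal_mul (by positivity), mul_comm, ← hJ]
  congr 2
  rw [neg_pow, inv_pow, mul_inv, inv_inv, abs_mul, abs_inv, abs_pow, abs_neg, abs_one, one_pow,
    inv_one, one_mul, abs_of_pos (by positivity), ← Real.rpow_natCast, ← Real.rpow_add hR]
  congr 1; ring

/-- If among finitely many positive numbers any two dominate `ω` together, then at most one of them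
is much smaller than `ω`, and a product of negative powers is dominated by the sum of the products
in which all factors but one are replaced by powers of `ω`. -/
lemma prod_rpow_neg_le {ι : Type*} [Fintype ι] [Nonempty ι] [DecidableEq ι] {t : ι → ℝ}
    (ht : ∀ i, 0 ≤ t i) {Λ : ℝ} (hΛ : 1 ≤ Λ) {ω : ℝ} (hω : 0 < ω) {L : ι → ℝ}
    (hL : ∀ i, 0 < L i) (hdom : ∀ i j, i ≠ j → ω ≤ Λ * (L i + L j)) :
    ∏ i, L i ^ (-t i) ≤ (2 * Λ) ^ (∑ i, t i) *
      ∑ i, ω ^ (-(∑ j, t j - t i)) * L i ^ (-t i) := by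
  obtain ⟨i₀, -, hmin⟩ := Finset.exists_min_image Finset.univ L Finset.univ_nonempty
  have hsum : ∑ j ∈ Finset.univ.erase i₀, t j = ∑ j, t j - t i₀ := by
    rw [← Finset.add_sum_erase _ _ (Finset.mem_univ i₀)]; ring
  have h1 : ∏ j ∈ Finset.univ.erase i₀, L j ^ (-t j) ≤
      (2 * Λ) ^ (∑ j, t j) * ω ^ (-(∑ j, t j - t i₀)) := by
    calc _ ≤ ∏ j ∈ Finset.univ.erase i₀, (2 * Λ) ^ t j * ω ^ (-t j) := by
          refine Finset.prod_le_prod (fun j _ => (Real.rpow_pos_of_pos (hL j) _).le) fun j hj => ?_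
          have h2 : ω / (2 * Λ) ≤ L j := by
            rw [div_le_iff₀ (by positivity)]
            have := hdom j i₀ (Finset.ne_of_mem_erase hj)
            nlinarith [hmin j (Finset.mem_univ j)]
          refine (Real.rpow_le_rpow_of_nonpos (by positivity) h2 (by simpa using ht j)).trans
            (le_of_eq ?_)
          rw [Real.div_rpow hω.le (by positivity), Real.rpow_neg (by positivity : 0 ≤ 2 * Λ),
            div_inv_eq_mul, mul_comm]
      _ = (2 * Λ) ^ (∑ j, t j - t i₀) * ω ^ (-(∑ j, t j - t i₀)) := by
          rw [Finset.prod_mul_distrib, ← Real.rpow_sum_of_pos (by positivity),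
            ← Real.rpow_sum_of_pos hω, Finset.sum_neg_distrib, hsum]
      _ ≤ _ := by
          gcongr
          · linarith
          · linarith [ht i₀]
  rw [← Finset.mul_prod_erase _ _ (Finset.mem_univ i₀)]
  calc _ ≤ L i₀ ^ (-t i₀) * ((2 * Λ) ^ (∑ j, t j) * ω ^ (-(∑ j, t j - t i₀))) := by
        have := (Real.rpow_pos_of_pos (hL i₀) (-t i₀)).le
        gcongr
    _ = (2 * Λ) ^ (∑ j, t j) * (ω ^ (-(∑ j, t j - t i₀)) * L i₀ ^ (-t i₀)) := by ring
    _ ≤ _ := by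
        gcongr
        exact Finset.single_le_sum (f := fun i => ω ^ (-(∑ j, t j - t i)) * L i ^ (-t i))
          (fun i _ => by have := (Real.rpow_pos_of_pos (hL i) (-t i)).le; positivity)
          (Finset.mem_univ i₀)

/-- Two-factor case of `prod_rpow_neg_le`. -/
lemma mul_rpow_neg_le {t b : ℝ} (ht : 0 ≤ t) (hb : 0 ≤ b) {Λ : ℝ} (hΛ : 1 ≤ Λ) {ω z p : ℝ}
    (hω : 0 < ω) (hz : 0 < z) (hp : 0 < p) (hdom : ω ≤ Λ * (z + p)) :
    z ^ (-t) * p ^ (-b) ≤ (2 * Λ) ^ (t + b) * (ω ^ (-b) * z ^ (-t) + ω ^ (-t) * p ^ (-b)) := by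
  have := prod_rpow_neg_le (ι := Fin 2) (t := ![t, b]) (L := ![z, p]) (Λ := Λ) (ω := ω)
    (by intro i; fin_cases i <;> simpa) hΛ hω (by intro i; fin_cases i <;> simpa)
    (by
      intro i j hij
      fin_cases i <;> fin_cases j <;> simp at hij ⊢
      · exact hdom
      · rwa [add_comm])
  simpa [Fin.sum_univ_two, Fin.prod_univ_two] using this

/-- The model kernel `(‖x‖ + ‖y‖) ^ (-(n - t)) ‖x - α y‖ ^ (-t)` acts on powers of `‖y‖`. -/
lemma exists_lintegral_model_kernel_le {n : ℕ} (hn : 0 < n) {t b α : ℝ} (ht : 0 ≤ t) (htn : t < n)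
    (hb : 0 < b) (hbn : b < n) (hα : α ≠ 0) :
    ∃ C : ℝ≥0, ∀ x : EuclideanSpace ℝ (Fin n), x ≠ 0 → ∫⁻ y : EuclideanSpace ℝ (Fin n),
      ENNReal.ofReal ((‖x‖ + ‖y‖) ^ (-(n - t)) * ‖x - α • y‖ ^ (-t) * ‖y‖ ^ (-b)) ≤
        C * ENNReal.ofReal (‖x‖ ^ (-b)) := by
  obtain ⟨C₁, h1⟩ := exists_lintegral_add_norm_rpow_le hn (s := n - t + b) ht htn (by linarith)
  obtain ⟨C₂, h2⟩ := exists_lintegral_add_norm_rpow_le hn (s := n) hb.le hbn (by linarith)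
  set Λ : ℝ := 2 + |α| with hΛ
  have hΛ1 : 1 ≤ Λ := by have := abs_nonneg α; linarith
  let D₁ : ℝ≥0 := Real.toNNReal ((2 * Λ) ^ (t + b) * Λ ^ (n - t + b))
  let D₂ : ℝ≥0 := Real.toNNReal ((2 * Λ) ^ (t + b))
  let V : ℝ≥0 := Real.toNNReal |(α ^ n)⁻¹|
  refine ⟨D₁ * (V * C₁) + D₂ * C₂, fun x hx => ?_⟩
  have hx0 : 0 < ‖x‖ := norm_pos_iff.2 hx
  have hpt : ∀ᵐ y : EuclideanSpace ℝ (Fin n),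
      ENNReal.ofReal ((‖x‖ + ‖y‖) ^ (-(n - t)) * ‖x - α • y‖ ^ (-t) * ‖y‖ ^ (-b)) ≤
        D₁ * ENNReal.ofReal ((‖x‖ + ‖x - α • y‖) ^ (-(n - t + b)) * ‖x - α • y‖ ^ (-t)) +
          D₂ * ENNReal.ofReal ((‖x‖ + ‖y‖) ^ (-(n : ℝ)) * ‖y‖ ^ (-b)) := by
    have : Nonempty (Fin n) := ⟨⟨0, hn⟩⟩
    filter_upwards [Measure.ae_ne volume (0 : EuclideanSpace ℝ (Fin n)),
      Measure.ae_ne volume (α⁻¹ • x)] with y hy0 hyx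
    have hy : 0 < ‖y‖ := norm_pos_iff.2 hy0
    have hz : 0 < ‖x - α • y‖ := by
      rw [norm_pos_iff, sub_ne_zero]
      intro h
      exact hyx (by rw [h, smul_smul, inv_mul_cancel₀ hα, one_smul])
    have hω : 0 < ‖x‖ + ‖y‖ := by positivity
    have hxz : ‖x‖ ≤ ‖x - α • y‖ + |α| * ‖y‖ := by
      have := norm_add_le (x - α • y) (α • y)
      rwa [sub_add_cancel, norm_smul, Real.norm_eq_abs] at this
    have hzx : ‖x - α • y‖ ≤ ‖x‖ + |α| * ‖y‖ := by
      have := norm_sub_le x (α • y)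
      rwa [norm_smul, Real.norm_eq_abs] at this
    have hα0 := abs_nonneg α
    have hdom : ‖x‖ + ‖y‖ ≤ Λ * (‖x - α • y‖ + ‖y‖) := by
      rw [hΛ]; nlinarith [mul_nonneg hα0 hz.le]
    have hω2 : (‖x‖ + ‖x - α • y‖) ≤ Λ * (‖x‖ + ‖y‖) := by
      rw [hΛ]; nlinarith [mul_nonneg hα0 hx0.le]
    have hA := mul_rpow_neg_le ht hb.le hΛ1 hω hz hy hdom
    have hB : (‖x‖ + ‖y‖) ^ (-(n - t + b)) ≤
        Λ ^ (n - t + b) * (‖x‖ + ‖x - α • y‖) ^ (-(n - t + b)) := by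
      have h3 : (‖x‖ + ‖x - α • y‖) / Λ ≤ ‖x‖ + ‖y‖ := by
        rw [div_le_iff₀ (by positivity)]; linarith
      refine (Real.rpow_le_rpow_of_nonpos (by positivity) h3 (by linarith)).trans (le_of_eq ?_)
      rw [Real.div_rpow (by positivity) (by positivity), Real.rpow_neg (by positivity : 0 ≤ Λ),
        div_inv_eq_mul, mul_comm]
    change _ ≤ ENNReal.ofReal _ * _ + ENNReal.ofReal _ * _
    rw [← ENNReal.ofReal_mul (by positivity), ← ENNReal.ofReal_mul (by positivity),
      ← ENNReal.ofReal_add (by positivity) (by positivity)]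
    apply ENNReal.ofReal_le_ofReal
    have e1 : (‖x‖ + ‖y‖) ^ (-(n - t)) * (‖x‖ + ‖y‖) ^ (-b) = (‖x‖ + ‖y‖) ^ (-(n - t + b)) := by
      rw [← Real.rpow_add hω]; congr 1; ring
    have e2 : (‖x‖ + ‖y‖) ^ (-(n - t)) * (‖x‖ + ‖y‖) ^ (-t) = (‖x‖ + ‖y‖) ^ (-(n : ℝ)) := by
      rw [← Real.rpow_add hω]; congr 1; ring
    calc _ = (‖x‖ + ‖y‖) ^ (-(n - t)) * (‖x - α • y‖ ^ (-t) * ‖y‖ ^ (-b)) := by ring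
      _ ≤ (‖x‖ + ‖y‖) ^ (-(n - t)) * ((2 * Λ) ^ (t + b) *
          ((‖x‖ + ‖y‖) ^ (-b) * ‖x - α • y‖ ^ (-t) + (‖x‖ + ‖y‖) ^ (-t) * ‖y‖ ^ (-b))) := by
          gcongr
      _ = (2 * Λ) ^ (t + b) * ((‖x‖ + ‖y‖) ^ (-(n - t + b)) * ‖x - α • y‖ ^ (-t)) +
          (2 * Λ) ^ (t + b) * ((‖x‖ + ‖y‖) ^ (-(n : ℝ)) * ‖y‖ ^ (-b)) := by
          rw [← e1, ← e2]; ring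
      _ ≤ (2 * Λ) ^ (t + b) * ((Λ ^ (n - t + b) * (‖x‖ + ‖x - α • y‖) ^ (-(n - t + b))) *
            ‖x - α • y‖ ^ (-t)) + _ := by gcongr
      _ = _ := by ring
  refine (lintegral_mono_ae hpt).trans ?_
  rw [lintegral_add_left (by fun_prop), lintegral_const_mul' _ _ ENNReal.coe_ne_top,
    lintegral_const_mul' _ _ ENNReal.coe_ne_top,
    lintegral_comp_sub_smul hα x
      (fun z => ENNReal.ofReal ((‖x‖ + ‖z‖) ^ (-(n - t + b)) * ‖z‖ ^ (-t)))]
  have e3 := h1 ‖x‖ hx0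
  have e4 := h2 ‖x‖ hx0
  have e5 : (n : ℝ) - (n - t + b) - t = -b := by ring
  have e6 : (n : ℝ) - n - b = -b := by ring
  rw [e5] at e3
  rw [e6] at e4
  push_cast
  rw [add_mul, mul_assoc, mul_assoc, mul_assoc]
  gcongr
  exact le_rfl

/-! ### The Schur test -/

/-- **Schur test** with weights `u` and `w` for an operator with nonnegative kernel. -/
lemma lintegral_rpow_lintegral_le_of_schur {X Y : Type*} [MeasurableSpace X] [MeasurableSpace Y]
    {μ : Measure X} {ν : Measure Y} [SFinite μ] [SFinite ν] {k : X → Y → ℝ≥0∞}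
    (hk : Measurable (Function.uncurry k)) {u : X → ℝ≥0∞} {w : Y → ℝ≥0∞} (hu : Measurable u)
    (hw : Measurable w) (hw0 : ∀ᵐ y ∂ν, w y ≠ 0 ∧ w y ≠ ∞) {p q : ℝ} (hpq : p.HolderConjugate q)
    {C₁ C₂ : ℝ≥0∞} (h1 : ∀ᵐ x ∂μ, ∫⁻ y, k x y * w y ^ q ∂ν ≤ C₁ * u x ^ q)
    (h2 : ∀ᵐ y ∂ν, ∫⁻ x, k x y * u x ^ p ∂μ ≤ C₂ * w y ^ p) {f : Y → ℝ≥0∞}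
    (hf : AEMeasurable f ν) :
    ∫⁻ x, (∫⁻ y, k x y * f y ∂ν) ^ p ∂μ ≤ C₁ ^ (p / q) * C₂ * ∫⁻ y, f y ^ p ∂ν := by
  have hp := hpq.pos
  have hq := hpq.symm.pos
  have hkx : ∀ x, Measurable (k x) := fun x => hk.comp measurable_prodMk_left
  have hky : ∀ y, Measurable fun x => k x y := fun y => hk.comp measurable_prodMk_right
  have hpt : ∀ᵐ x ∂μ, (∫⁻ y, k x y * f y ∂ν) ^ p ≤
      C₁ ^ (p / q) * ∫⁻ y, u x ^ p * (k x y * (f y ^ p * (w y)⁻¹ ^ p)) ∂ν := by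
    filter_upwards [h1] with x hx
    have e1 : ∫⁻ y, k x y * f y ∂ν =
        ∫⁻ y, ((fun y => k x y ^ (1 / q) * w y) * fun y => k x y ^ (1 / p) * (f y * (w y)⁻¹)) y
          ∂ν := by
      refine lintegral_congr_ae ?_
      filter_upwards [hw0] with y hy
      simp only [Pi.mul_apply]
      have e2 : k x y ^ (1 / q) * k x y ^ (1 / p) = k x y := by
        rw [← ENNReal.rpow_add_of_nonneg _ _ (by positivity) (by positivity), one_div, one_div,
          hpq.symm.inv_add_inv_eq_one, ENNReal.rpow_one]
      calc k x y * f y = (k x y ^ (1 / q) * k x y ^ (1 / p)) * f y * (w y * (w y)⁻¹) := by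
            rw [e2, ENNReal.mul_inv_cancel hy.1 hy.2, mul_one]
        _ = _ := by ring
    have e3 := ENNReal.lintegral_mul_le_Lp_mul_Lq ν hpq.symm
      (f := fun y => k x y ^ (1 / q) * w y) (g := fun y => k x y ^ (1 / p) * (f y * (w y)⁻¹))
      (((hkx x).pow_const _).mul hw).aemeasurable
      (((hkx x).pow_const _).aemeasurable.mul (hf.mul hw.inv.aemeasurable))
    rw [← e1] at e3
    have e4 : ∀ y, (k x y ^ (1 / q) * w y) ^ q = k x y * w y ^ q := by
      intro y
      rw [ENNReal.mul_rpow_of_nonneg _ _ hq.le, ← ENNReal.rpow_mul, one_div_mul_cancel hq.ne',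
        ENNReal.rpow_one]
    have e5 : ∀ y, (k x y ^ (1 / p) * (f y * (w y)⁻¹)) ^ p = k x y * (f y ^ p * (w y)⁻¹ ^ p) := by
      intro y
      rw [ENNReal.mul_rpow_of_nonneg _ _ hp.le, ENNReal.mul_rpow_of_nonneg _ _ hp.le,
        ← ENNReal.rpow_mul, one_div_mul_cancel hp.ne', ENNReal.rpow_one]
    simp only [e4, e5] at e3
    calc _ ≤ ((∫⁻ y, k x y * w y ^ q ∂ν) ^ (1 / q) *
          (∫⁻ y, k x y * (f y ^ p * (w y)⁻¹ ^ p) ∂ν) ^ (1 / p)) ^ p :=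
          ENNReal.rpow_le_rpow e3 hp.le
      _ = (∫⁻ y, k x y * w y ^ q ∂ν) ^ (p / q) * ∫⁻ y, k x y * (f y ^ p * (w y)⁻¹ ^ p) ∂ν := by
          rw [ENNReal.mul_rpow_of_nonneg _ _ hp.le, ← ENNReal.rpow_mul, ← ENNReal.rpow_mul,
            one_div_mul_cancel hp.ne', ENNReal.rpow_one, one_div_mul_eq_div]
      _ ≤ (C₁ * u x ^ q) ^ (p / q) * ∫⁻ y, k x y * (f y ^ p * (w y)⁻¹ ^ p) ∂ν := by
          gcongr
      _ = C₁ ^ (p / q) * (u x ^ p * ∫⁻ y, k x y * (f y ^ p * (w y)⁻¹ ^ p) ∂ν) := by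
          rw [ENNReal.mul_rpow_of_nonneg _ _ (div_nonneg hp.le hq.le), ← ENNReal.rpow_mul,
            mul_div_cancel₀ _ hq.ne', mul_assoc]
      _ = _ := by
          rw [lintegral_const_mul'']
          exact (hkx x).aemeasurable.mul
            ((hf.pow_const _).mul (hw.inv.pow_const _).aemeasurable)
  have hg : AEMeasurable (fun y => f y ^ p * (w y)⁻¹ ^ p) ν :=
    (hf.pow_const _).mul (hw.inv.pow_const _).aemeasurable
  have hprod : AEMeasurable (Function.uncurry fun x y =>
      u x ^ p * (k x y * (f y ^ p * (w y)⁻¹ ^ p))) (μ.prod ν) :=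
    ((hu.pow_const p).comp measurable_fst).aemeasurable.mul (hk.aemeasurable.mul hg.comp_snd)
  calc _ ≤ ∫⁻ x, C₁ ^ (p / q) * ∫⁻ y, u x ^ p * (k x y * (f y ^ p * (w y)⁻¹ ^ p)) ∂ν ∂μ :=
        lintegral_mono_ae hpt
    _ = C₁ ^ (p / q) * ∫⁻ y, ∫⁻ x, u x ^ p * (k x y * (f y ^ p * (w y)⁻¹ ^ p)) ∂μ ∂ν := by
        have hm : AEMeasurable (fun x =>
          ∫⁻ y, u x ^ p * (k x y * (f y ^ p * (w y)⁻¹ ^ p)) ∂ν) μ := hprod.lintegral_prod_right'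
        rw [lintegral_const_mul'' _ hm, lintegral_lintegral_swap hprod]
    _ = C₁ ^ (p / q) * ∫⁻ y, (f y ^ p * (w y)⁻¹ ^ p) * ∫⁻ x, k x y * u x ^ p ∂μ ∂ν := by
        congr with y
        have hm : Measurable fun x => k x y * u x ^ p := (hky y).mul (hu.pow_const p)
        rw [← lintegral_const_mul _ hm]
        congr with x
        ring
    _ ≤ C₁ ^ (p / q) * ∫⁻ y, C₂ * f y ^ p ∂ν := by
        refine mul_le_mul_right (lintegral_mono_ae ?_) _
        filter_upwards [h2, hw0] with y hy hwy
        calc _ ≤ (f y ^ p * (w y)⁻¹ ^ p) * (C₂ * w y ^ p) := by gcongr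
          _ = C₂ * f y ^ p * ((w y)⁻¹ * w y) ^ p := by
              rw [ENNReal.mul_rpow_of_nonneg _ _ hp.le]; ring
          _ = _ := by rw [ENNReal.inv_mul_cancel hwy.1 hwy.2, ENNReal.one_rpow, mul_one]
    _ = _ := by rw [lintegral_const_mul'' _ (hf.pow_const p), mul_assoc]

/-! ### The product kernel -/

/-- The size bound of a product type kernel: `‖x‖ ^ (-θ₀ n) ∏ₖ ‖x - αₖ y‖ ^ (-θₖ n)`. -/
noncomputable def productKernel {n m : ℕ} (θ₀ : ℝ) (θ α : Fin m → ℝ)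
    (x y : EuclideanSpace ℝ (Fin n)) : ℝ :=
  ‖x‖ ^ (-(θ₀ * n)) * ∏ k, ‖x - α k • y‖ ^ (-(θ k * n))

lemma measurable_productKernel {n m : ℕ} (θ₀ : ℝ) (θ α : Fin m → ℝ) :
    Measurable (Function.uncurry (productKernel (n := n) θ₀ θ α)) := by
  unfold productKernel Function.uncurry
  fun_prop

lemma productKernel_nonneg {n m : ℕ} (θ₀ : ℝ) (θ α : Fin m → ℝ)
    (x y : EuclideanSpace ℝ (Fin n)) : 0 ≤ productKernel θ₀ θ α x y := by
  unfold productKernel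
  have := Finset.prod_nonneg (s := Finset.univ) (f := fun k => ‖x - α k • y‖ ^ (-(θ k * n)))
    fun k _ => by positivity
  positivity

/-- Any two of the linear forms `x`, `x - αₖ y` determine `x` and `y`. -/
lemma exists_norm_add_norm_le {m : ℕ} {E : Type*} [NormedAddCommGroup E] [NormedSpace ℝ E]
    {α : Fin m → ℝ} (hα : Function.Injective α) (hα0 : ∀ k, α k ≠ 0) :
    ∃ Λ : ℝ, 1 ≤ Λ ∧ ∀ (x y : E) (i j : Option (Fin m)), i ≠ j →
      ‖x‖ + ‖y‖ ≤ Λ * (i.elim ‖x‖ (fun k => ‖x - α k • y‖) +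
        j.elim ‖x‖ (fun k => ‖x - α k • y‖)) := by
  have h1 : ∀ (k : Fin m) (x y : E), ‖x‖ + ‖y‖ ≤ (1 + |α k|⁻¹) * (‖x‖ + ‖x - α k • y‖) := by
    intro k x y
    have hk : 0 < |α k| := abs_pos.2 (hα0 k)
    have h2 : |α k| * ‖y‖ ≤ ‖x‖ + ‖x - α k • y‖ := by
      have := norm_sub_le x (x - α k • y)
      rwa [sub_sub_cancel, norm_smul, Real.norm_eq_abs] at this
    have h3 : ‖y‖ ≤ |α k|⁻¹ * (‖x‖ + ‖x - α k • y‖) := by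
      rw [inv_mul_eq_div, le_div_iff₀ hk]; linarith
    have := norm_nonneg (x - α k • y)
    linarith
  have h : ∀ i j : Option (Fin m), ∃ Λ : ℝ, 0 ≤ Λ ∧ (i ≠ j → ∀ x y : E,
      ‖x‖ + ‖y‖ ≤ Λ * (i.elim ‖x‖ (fun k => ‖x - α k • y‖) +
        j.elim ‖x‖ (fun k => ‖x - α k • y‖))) := by
    rintro (_ | j) (_ | k)
    · exact ⟨0, le_rfl, fun h => absurd rfl h⟩
    · exact ⟨_, by positivity, fun _ x y => h1 k x y⟩
    · refine ⟨1 + |α j|⁻¹, by positivity, fun _ x y => ?_⟩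
      have := h1 j x y
      rw [add_comm ‖x‖ ‖x - α j • y‖] at this
      exact this
    · refine ⟨1 + (1 + |α j|) * |α k - α j|⁻¹, by positivity, fun hjk x y => ?_⟩
      have hjk' : 0 < |α k - α j| :=
        abs_pos.2 (sub_ne_zero.2 fun h => hjk (by rw [hα h]))
      have h2 : |α k - α j| * ‖y‖ ≤ ‖x - α j • y‖ + ‖x - α k • y‖ := by
        have := norm_sub_le (x - α j • y) (x - α k • y)
        rwa [sub_sub_sub_cancel_left, ← sub_smul, norm_smul, Real.norm_eq_abs] at this
      have h3 : ‖y‖ ≤ |α k - α j|⁻¹ * (‖x - α j • y‖ + ‖x - α k • y‖) := by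
        rw [inv_mul_eq_div, le_div_iff₀ hjk']; linarith
      have h4 : ‖x‖ ≤ ‖x - α j • y‖ + |α j| * ‖y‖ := by
        have := norm_add_le (x - α j • y) (α j • y)
        rwa [sub_add_cancel, norm_smul, Real.norm_eq_abs] at this
      have h5 := mul_le_mul_of_nonneg_left h3 (by positivity : 0 ≤ 1 + |α j|)
      have := norm_nonneg (x - α k • y)
      simp only [Option.elim_some]
      linarith
  choose Λ hΛ0 hΛ using h
  refine ⟨1 + ∑ i, ∑ j, Λ i j, le_add_of_nonneg_right
    (Finset.sum_nonneg fun i _ => Finset.sum_nonneg fun j _ => hΛ0 i j), fun x y i j hij => ?_⟩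
  refine (hΛ i j hij x y).trans (mul_le_mul_of_nonneg_right ?_ ?_)
  · have e1 : Λ i j ≤ ∑ j, Λ i j := Finset.single_le_sum (fun j _ => hΛ0 i j) (Finset.mem_univ j)
    have e2 : ∑ j, Λ i j ≤ ∑ i, ∑ j, Λ i j := Finset.single_le_sum (f := fun i => ∑ j, Λ i j)
      (fun i _ => Finset.sum_nonneg fun j _ => hΛ0 i j) (Finset.mem_univ i)
    linarith
  · rcases i with _ | i <;> rcases j with _ | j <;>
      simp only [Option.elim_none, Option.elim_some] <;> positivity

/-- The product kernel is dominated by a sum of kernels each having a single singular factor. -/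
lemma exists_productKernel_le {n m : ℕ} {θ₀ : ℝ} {θ α : Fin m → ℝ} (hθ₀ : 0 ≤ θ₀)
    (hθ : ∀ k, 0 < θ k) (hsum : θ₀ + ∑ k, θ k = 1) (hα : Function.Injective α)
    (hα0 : ∀ k, α k ≠ 0) :
    ∃ C : ℝ, 0 ≤ C ∧ ∀ x y : EuclideanSpace ℝ (Fin n), x ≠ 0 → (∀ k, x ≠ α k • y) →
      productKernel θ₀ θ α x y ≤ C * ((‖x‖ + ‖y‖) ^ (-(n - θ₀ * n)) * ‖x‖ ^ (-(θ₀ * n)) +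
        ∑ k, (‖x‖ + ‖y‖) ^ (-(n - θ k * n)) * ‖x - α k • y‖ ^ (-(θ k * n))) := by
  obtain ⟨Λ, hΛ1, hΛ⟩ := exists_norm_add_norm_le (E := EuclideanSpace ℝ (Fin n)) hα hα0
  let t : Option (Fin m) → ℝ := fun o => o.elim (θ₀ * n) (fun k => θ k * n)
  have ht : ∀ i, 0 ≤ t i := by
    rintro (_ | k)
    · simp only [t, Option.elim_none]; positivity
    · have := hθ k; simp only [t, Option.elim_some]; positivity
  have hts : ∑ i, t i = n := by
    rw [Fintype.sum_option]
    simp only [t, Option.elim_none, Option.elim_some]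
    rw [← Finset.sum_mul, ← add_mul, hsum, one_mul]
  refine ⟨(2 * Λ) ^ (n : ℝ), by positivity, fun x y hx hxy => ?_⟩
  let L : Option (Fin m) → ℝ := fun o => o.elim ‖x‖ (fun k => ‖x - α k • y‖)
  have hL : ∀ i, 0 < L i := by
    rintro (_ | k)
    · exact norm_pos_iff.2 hx
    · exact norm_pos_iff.2 (sub_ne_zero.2 (hxy k))
  have hω : 0 < ‖x‖ + ‖y‖ := by have := norm_pos_iff.2 hx; positivity
  have h := prod_rpow_neg_le ht hΛ1 hω hL (hΛ x y)
  rw [hts, Fintype.sum_option, Fintype.prod_option] at h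
  exact h

/-- The model kernel acting in the other variable. -/
lemma exists_lintegral_model_kernel_swap_le {n : ℕ} (hn : 0 < n) {t b α : ℝ} (ht : 0 ≤ t)
    (htn : t < n) (hb : 0 < b) (hbn : b < n) (hα : α ≠ 0) :
    ∃ C : ℝ≥0, ∀ y : EuclideanSpace ℝ (Fin n), y ≠ 0 → ∫⁻ x : EuclideanSpace ℝ (Fin n),
      ENNReal.ofReal ((‖x‖ + ‖y‖) ^ (-(n - t)) * ‖x - α • y‖ ^ (-t) * ‖x‖ ^ (-b)) ≤
        C * ENNReal.ofReal (‖y‖ ^ (-b)) := by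
  obtain ⟨C, hC⟩ := exists_lintegral_model_kernel_le hn ht htn hb hbn (inv_ne_zero hα)
  refine ⟨Real.toNNReal (|α| ^ (-t)) * C, fun y hy => ?_⟩
  have h : ∀ x : EuclideanSpace ℝ (Fin n),
      ENNReal.ofReal ((‖x‖ + ‖y‖) ^ (-(n - t)) * ‖x - α • y‖ ^ (-t) * ‖x‖ ^ (-b)) =
        ENNReal.ofReal (|α| ^ (-t)) *
          ENNReal.ofReal ((‖y‖ + ‖x‖) ^ (-(n - t)) * ‖y - α⁻¹ • x‖ ^ (-t) * ‖x‖ ^ (-b)) := by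
    intro x
    have h1 : ‖x - α • y‖ = |α| * ‖y - α⁻¹ • x‖ := by
      rw [← Real.norm_eq_abs, ← norm_smul, smul_sub, smul_smul, mul_inv_cancel₀ hα, one_smul,
        norm_sub_rev]
    rw [h1, ← ENNReal.ofReal_mul (by positivity), Real.mul_rpow (abs_nonneg _) (norm_nonneg _),
      add_comm ‖x‖]
    congr 1; ring
  simp_rw [h]
  rw [lintegral_const_mul' _ _ ENNReal.ofReal_ne_top]
  push_cast
  rw [mul_assoc]
  exact mul_le_mul_right (hC y hy) _

lemma ae_ne_smul {n m : ℕ} (hn : 0 < n) {α : Fin m → ℝ} (hα0 : ∀ k, α k ≠ 0)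
    (x : EuclideanSpace ℝ (Fin n)) : ∀ᵐ y : EuclideanSpace ℝ (Fin n), ∀ k, x ≠ α k • y := by
  have : Nonempty (Fin n) := ⟨⟨0, hn⟩⟩
  rw [ae_all_iff]
  intro k
  filter_upwards [Measure.ae_ne volume ((α k)⁻¹ • x)] with y hy h
  exact hy (by rw [h, smul_smul, inv_mul_cancel₀ (hα0 k), one_smul])

lemma ae_ne_zero_and_ne_smul {n m : ℕ} (hn : 0 < n) (α : Fin m → ℝ)
    (y : EuclideanSpace ℝ (Fin n)) :
    ∀ᵐ x : EuclideanSpace ℝ (Fin n), x ≠ 0 ∧ ∀ k, x ≠ α k • y := by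
  have : Nonempty (Fin n) := ⟨⟨0, hn⟩⟩
  refine (Measure.ae_ne volume 0).and ?_
  rw [ae_all_iff]
  intro k
  exact Measure.ae_ne volume (α k • y)

/-- The positive operator acts on powers of `‖y‖`. The lower bound on `b` is what the factor
`‖x‖ ^ (-θ₀ n)` requires for convergence at infinity. -/
lemma exists_lintegral_productKernel_mul_right_le {n m : ℕ} (hn : 0 < n) {θ₀ : ℝ}
    {θ α : Fin m → ℝ} (hθ₀ : 0 ≤ θ₀) (hθ : ∀ k, 0 < θ k ∧ θ k < 1) (hsum : θ₀ + ∑ k, θ k = 1)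
    (hα : Function.Injective α) (hα0 : ∀ k, α k ≠ 0) {b : ℝ} (hb : θ₀ * n < b) (hbn : b < n) :
    ∃ C : ℝ≥0, ∀ x : EuclideanSpace ℝ (Fin n), x ≠ 0 → ∫⁻ y : EuclideanSpace ℝ (Fin n),
      ENNReal.ofReal (productKernel θ₀ θ α x y) * ENNReal.ofReal (‖y‖ ^ (-b)) ≤
        C * ENNReal.ofReal (‖x‖ ^ (-b)) := by
  have hn0 : (0 : ℝ) < n := by exact_mod_cast hn
  have hb0 : 0 < b := lt_of_le_of_lt (by positivity) hb
  obtain ⟨C, hC0, hC⟩ := exists_productKernel_le (n := n) hθ₀ (fun k => (hθ k).1) hsum hα hα0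
  obtain ⟨C₀, h0⟩ := exists_lintegral_add_norm_rpow_le hn (s := n - θ₀ * n) hb0.le hbn
    (by linarith)
  choose D hD using fun k => exists_lintegral_model_kernel_le hn (t := θ k * n) (α := α k)
    (mul_nonneg (hθ k).1.le hn0.le) (by nlinarith [(hθ k).2]) hb0 hbn (hα0 k)
  refine ⟨C.toNNReal * (C₀ + ∑ k, D k), fun x hx => ?_⟩
  have hx0 : 0 < ‖x‖ := norm_pos_iff.2 hx
  have hpt : ∀ᵐ y : EuclideanSpace ℝ (Fin n),
      ENNReal.ofReal (productKernel θ₀ θ α x y) * ENNReal.ofReal (‖y‖ ^ (-b)) ≤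
        ENNReal.ofReal C * (ENNReal.ofReal (‖x‖ ^ (-(θ₀ * n))) *
          ENNReal.ofReal ((‖x‖ + ‖y‖) ^ (-(n - θ₀ * n)) * ‖y‖ ^ (-b)) +
          ∑ k, ENNReal.ofReal ((‖x‖ + ‖y‖) ^ (-(n - θ k * n)) * ‖x - α k • y‖ ^ (-(θ k * n)) *
            ‖y‖ ^ (-b))) := by
    filter_upwards [ae_ne_smul hn hα0 x] with y hy
    rw [← ENNReal.ofReal_mul (productKernel_nonneg _ _ _ _ _), ← ENNReal.ofReal_mul (by positivity),
      ← ENNReal.ofReal_sum_of_nonneg fun k _ => by positivity,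
      ← ENNReal.ofReal_add (by positivity) (Finset.sum_nonneg fun k _ => by positivity),
      ← ENNReal.ofReal_mul hC0]
    apply ENNReal.ofReal_le_ofReal
    refine (mul_le_mul_of_nonneg_right (hC x y hx hy) (by positivity)).trans (le_of_eq ?_)
    rw [← Finset.sum_mul]
    ring
  refine (lintegral_mono_ae hpt).trans ?_
  rw [lintegral_const_mul' _ _ ENNReal.ofReal_ne_top, lintegral_add_left (by fun_prop),
    lintegral_finsetSum _ fun k _ => by fun_prop, lintegral_const_mul' _ _ ENNReal.ofReal_ne_top]
  push_cast
  rw [mul_assoc, add_mul, Finset.sum_mul]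
  refine mul_le_mul_right (add_le_add ?_ (Finset.sum_le_sum fun k _ => hD k x hx)) _
  refine (mul_le_mul_right (h0 ‖x‖ hx0) _).trans (le_of_eq ?_)
  rw [mul_left_comm, ← ENNReal.ofReal_mul (by positivity), ← Real.rpow_add hx0]
  congr 3; ring

/-- The transpose of the positive operator acts on powers of `‖x‖`. The upper bound on `b` is
integrability of `‖x‖ ^ (-θ₀ n - b)` at the origin. -/
lemma exists_lintegral_productKernel_mul_left_le {n m : ℕ} (hn : 0 < n) {θ₀ : ℝ}
    {θ α : Fin m → ℝ} (hθ₀ : 0 ≤ θ₀) (hθ : ∀ k, 0 < θ k ∧ θ k < 1) (hsum : θ₀ + ∑ k, θ k = 1)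
    (hα : Function.Injective α) (hα0 : ∀ k, α k ≠ 0) {b : ℝ} (hb : 0 < b)
    (hbn : θ₀ * n + b < n) :
    ∃ C : ℝ≥0, ∀ y : EuclideanSpace ℝ (Fin n), y ≠ 0 → ∫⁻ x : EuclideanSpace ℝ (Fin n),
      ENNReal.ofReal (productKernel θ₀ θ α x y) * ENNReal.ofReal (‖x‖ ^ (-b)) ≤
        C * ENNReal.ofReal (‖y‖ ^ (-b)) := by
  have hn0 : (0 : ℝ) < n := by exact_mod_cast hn
  have hbn' : b < n := lt_of_le_of_lt (le_add_of_nonneg_left (by positivity)) hbn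
  obtain ⟨C, hC0, hC⟩ := exists_productKernel_le (n := n) hθ₀ (fun k => (hθ k).1) hsum hα hα0
  obtain ⟨C₀, h0⟩ := exists_lintegral_add_norm_rpow_le hn (s := n - θ₀ * n) (t := θ₀ * n + b)
    (by positivity) hbn (by linarith)
  choose D hD using fun k => exists_lintegral_model_kernel_swap_le hn (t := θ k * n) (α := α k)
    (mul_nonneg (hθ k).1.le hn0.le) (by nlinarith [(hθ k).2]) hb hbn' (hα0 k)
  refine ⟨C.toNNReal * (C₀ + ∑ k, D k), fun y hy => ?_⟩
  have hy0 : 0 < ‖y‖ := norm_pos_iff.2 hy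
  have hpt : ∀ᵐ x : EuclideanSpace ℝ (Fin n),
      ENNReal.ofReal (productKernel θ₀ θ α x y) * ENNReal.ofReal (‖x‖ ^ (-b)) ≤
        ENNReal.ofReal C * (
          ENNReal.ofReal ((‖y‖ + ‖x‖) ^ (-(n - θ₀ * n)) * ‖x‖ ^ (-(θ₀ * n + b))) +
          ∑ k, ENNReal.ofReal ((‖x‖ + ‖y‖) ^ (-(n - θ k * n)) * ‖x - α k • y‖ ^ (-(θ k * n)) *
            ‖x‖ ^ (-b))) := by
    filter_upwards [ae_ne_zero_and_ne_smul hn α y] with x hx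
    have hx0 : 0 < ‖x‖ := norm_pos_iff.2 hx.1
    rw [← ENNReal.ofReal_mul (productKernel_nonneg _ _ _ _ _),
      ← ENNReal.ofReal_sum_of_nonneg fun k _ => by positivity,
      ← ENNReal.ofReal_add (by positivity) (Finset.sum_nonneg fun k _ => by positivity),
      ← ENNReal.ofReal_mul hC0]
    apply ENNReal.ofReal_le_ofReal
    refine (mul_le_mul_of_nonneg_right (hC x y hx.1 hx.2) (by positivity)).trans (le_of_eq ?_)
    rw [← Finset.sum_mul, neg_add, Real.rpow_add hx0, add_comm ‖y‖]
    ring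
  refine (lintegral_mono_ae hpt).trans ?_
  rw [lintegral_const_mul' _ _ ENNReal.ofReal_ne_top, lintegral_add_left (by fun_prop),
    lintegral_finsetSum _ fun k _ => by fun_prop]
  push_cast
  rw [mul_assoc, add_mul, Finset.sum_mul]
  refine mul_le_mul_right (add_le_add ?_ (Finset.sum_le_sum fun k _ => hD k y hy)) _
  refine (h0 ‖y‖ hy0).trans (le_of_eq ?_)
  congr 3; ring

/-! ### Bounds on Lebesgue spaces -/

/-- The positive operator with kernel `productKernel` is bounded on `L^p`. -/
lemma exists_lintegral_productKernel_rpow_le {n m : ℕ} (hn : 0 < n) {θ₀ : ℝ}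
    {θ α : Fin m → ℝ} (hθ₀ : 0 ≤ θ₀) (hθ : ∀ k, 0 < θ k ∧ θ k < 1) (hsum : θ₀ + ∑ k, θ k = 1)
    (hα : Function.Injective α) (hα0 : ∀ k, α k ≠ 0) {p : ℝ} (hp : 1 < p) (hpθ : θ₀ * p < 1) :
    ∃ C : ℝ≥0, ∀ f : EuclideanSpace ℝ (Fin n) → ℝ≥0∞, AEMeasurable f volume →
      ∫⁻ x, (∫⁻ y, ENNReal.ofReal (productKernel θ₀ θ α x y) * f y) ^ p ≤ C * ∫⁻ y, f y ^ p := by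
  have hn0 : (0 : ℝ) < n := by exact_mod_cast hn
  have hp0 : 0 < p := by linarith
  obtain ⟨q, hpq⟩ : ∃ q, p.HolderConjugate q := ⟨_, Real.HolderConjugate.conjExponent hp⟩
  have hq0 := hpq.symm.pos
  have hinv : p⁻¹ + q⁻¹ = 1 := hpq.inv_add_inv_eq_one
  have hθp : θ₀ < p⁻¹ := by rwa [← one_div, lt_div_iff₀ hp0]
  -- Schur's test is applied with the weight `‖y‖ ^ (-n / (p q))`, both in `x` and in `y`. Its
  -- powers of exponent `q` and `p` are admissible in the two directions exactly when `θ₀ < 1 / p`.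
  obtain ⟨C₁, h1⟩ := exists_lintegral_productKernel_mul_right_le hn hθ₀ hθ hsum hα hα0
    (b := p⁻¹ * n) (by gcongr) (by have := inv_lt_one_of_one_lt₀ hp; nlinarith)
  obtain ⟨C₂, h2⟩ := exists_lintegral_productKernel_mul_left_le hn hθ₀ hθ hsum hα hα0
    (b := q⁻¹ * n) (by positivity) (by nlinarith)
  have : Nonempty (Fin n) := ⟨⟨0, hn⟩⟩
  let w : EuclideanSpace ℝ (Fin n) → ℝ≥0∞ := fun y => ENNReal.ofReal (‖y‖ ^ (-(p⁻¹ * q⁻¹ * n)))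
  have hwq : ∀ y, w y ^ q = ENNReal.ofReal (‖y‖ ^ (-(p⁻¹ * n))) := by
    intro y
    simp only [w]
    rw [ENNReal.ofReal_rpow_of_nonneg (by positivity) hq0.le, ← Real.rpow_mul (norm_nonneg _)]
    congr 2; field_simp
  have hwp : ∀ y, w y ^ p = ENNReal.ofReal (‖y‖ ^ (-(q⁻¹ * n))) := by
    intro y
    simp only [w]
    rw [ENNReal.ofReal_rpow_of_nonneg (by positivity) hp0.le, ← Real.rpow_mul (norm_nonneg _)]
    congr 2; field_simp
  refine ⟨C₁ ^ (p / q) * C₂, fun f hf => ?_⟩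
  have hw : Measurable w := by simp only [w]; fun_prop
  have h := lintegral_rpow_lintegral_le_of_schur (μ := volume) (ν := volume)
    (k := fun x y => ENNReal.ofReal (productKernel θ₀ θ α x y))
    (measurable_productKernel θ₀ θ α).ennreal_ofReal (u := w) (w := w) hw hw ?_ hpq
    (C₁ := C₁) (C₂ := C₂) ?_ ?_ hf
  · push_cast
    rwa [ENNReal.coe_rpow_of_nonneg _ (by positivity)]
  · filter_upwards [Measure.ae_ne volume 0] with y hy
    refine ⟨?_, ENNReal.ofReal_ne_top⟩
    have := norm_pos_iff.2 hy
    rw [Ne, ENNReal.ofReal_eq_zero, not_le]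
    positivity
  · filter_upwards [Measure.ae_ne volume 0] with x hx
    simp only [hwq]
    exact h1 x hx
  · filter_upwards [Measure.ae_ne volume 0] with y hy
    simp only [hwp]
    exact h2 y hy

lemma continuous_phase {n : ℕ} (P : MvPolynomial (Fin n ⊕ Fin n) ℝ) :
    Continuous fun z : EuclideanSpace ℝ (Fin n) × EuclideanSpace ℝ (Fin n) =>
      phase P z.1 z.2 := by
  refine (MvPolynomial.continuous_eval P).comp (continuous_pi ?_)
  rintro (i | i) <;> simp only [Sum.elim_inl, Sum.elim_inr] <;> fun_prop

lemma aestronglyMeasurable_oscIntegrand {n : ℕ} (P : MvPolynomial (Fin n ⊕ Fin n) ℝ)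
    {K : EuclideanSpace ℝ (Fin n) → EuclideanSpace ℝ (Fin n) → ℂ}
    (hK : AEStronglyMeasurable
      (fun z : EuclideanSpace ℝ (Fin n) × EuclideanSpace ℝ (Fin n) => K z.1 z.2)
      (volume.prod volume))
    {f : EuclideanSpace ℝ (Fin n) → ℂ} (hf : AEStronglyMeasurable f volume) :
    AEStronglyMeasurable (fun z : EuclideanSpace ℝ (Fin n) × EuclideanSpace ℝ (Fin n) =>
      oscIntegrand P K f z.1 z.2) (volume.prod volume) := by
  have hc := continuous_phase P
  have he : AEStronglyMeasurable (fun z : EuclideanSpace ℝ (Fin n) × EuclideanSpace ℝ (Fin n) =>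
      Complex.exp (Complex.I * (phase P z.1 z.2 : ℂ))) (volume.prod volume) :=
    Continuous.aestronglyMeasurable (by fun_prop)
  exact (he.mul hK).mul hf.comp_snd

lemma enorm_oscIntegrand {n : ℕ} (P : MvPolynomial (Fin n ⊕ Fin n) ℝ)
    (K : EuclideanSpace ℝ (Fin n) → EuclideanSpace ℝ (Fin n) → ℂ)
    (f : EuclideanSpace ℝ (Fin n) → ℂ) (x y : EuclideanSpace ℝ (Fin n)) :
    ‖oscIntegrand P K f x y‖ₑ = ‖K x y‖ₑ * ‖f y‖ₑ := by
  rw [oscIntegrand, enorm_mul, enorm_mul, ← ofReal_norm (Complex.exp _), norm_exp_I_mul_ofReal',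
    ENNReal.ofReal_one, one_mul]

/-- The oscillatory integrals are dominated by the positive operator. -/
lemma lintegral_enorm_oscIntegrand_le {n m : ℕ} (hn : 0 < n) {θ₀ : ℝ} {θ α : Fin m → ℝ}
    (hα0 : ∀ k, α k ≠ 0) {A B : ℝ} {K : EuclideanSpace ℝ (Fin n) → EuclideanSpace ℝ (Fin n) → ℂ}
    (hK : IsProductTypeKernel θ₀ θ α A B K) (P : MvPolynomial (Fin n ⊕ Fin n) ℝ)
    (f : EuclideanSpace ℝ (Fin n) → ℂ) {x : EuclideanSpace ℝ (Fin n)} (hx : x ≠ 0) :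
    ∫⁻ y, ‖oscIntegrand P K f x y‖ₑ ≤ ENNReal.ofReal |A| *
      ∫⁻ y, ENNReal.ofReal (productKernel θ₀ θ α x y) * ‖f y‖ₑ := by
  rw [← lintegral_const_mul' _ _ ENNReal.ofReal_ne_top]
  refine lintegral_mono_ae ?_
  filter_upwards [ae_ne_smul hn hα0 x] with y hy
  rw [enorm_oscIntegrand, ← mul_assoc, ← ENNReal.ofReal_mul (abs_nonneg A), ← ofReal_norm (K x y)]
  gcongr
  refine (hK.size x y hx hy).trans ?_
  exact mul_le_mul_of_nonneg_right (le_abs_self A) (productKernel_nonneg θ₀ θ α x y)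

/-- `T_P` is bounded on `L^p`, with a bound independent of `P`: only the size of the kernel is
used. -/
lemma exists_eLpNorm_oscOperator_le {n m : ℕ} (hn : 0 < n) {θ₀ : ℝ}
    {θ α : Fin m → ℝ} (hθ₀ : 0 ≤ θ₀) (hθ : ∀ k, 0 < θ k ∧ θ k < 1) (hsum : θ₀ + ∑ k, θ k = 1)
    (hα : Function.Injective α) (hα0 : ∀ k, α k ≠ 0) (A B : ℝ) {p : ℝ≥0∞} (hp : 1 < p)
    (hpθ : p < (ENNReal.ofReal θ₀)⁻¹) :
    ∃ C : ℝ≥0, ∀ K : EuclideanSpace ℝ (Fin n) → EuclideanSpace ℝ (Fin n) → ℂ,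
      IsProductTypeKernel θ₀ θ α A B K →
      ∀ (P : MvPolynomial (Fin n ⊕ Fin n) ℝ) (f : EuclideanSpace ℝ (Fin n) → ℂ),
        MemLp f p volume →
        (∀ᵐ x, Integrable (oscIntegrand P K f x) volume) ∧
        MemLp (oscOperator P K f) p volume ∧
        eLpNorm (oscOperator P K f) p volume ≤ C * eLpNorm f p volume := by
  have hptop : p ≠ ∞ := (hpθ.trans_le le_top).ne
  have hp0 : p ≠ 0 := (zero_lt_one.trans hp).ne'
  have hp1 : 1 < p.toReal := by
    rw [← ENNReal.toReal_one]; exact (ENNReal.toReal_lt_toReal ENNReal.one_ne_top hptop).2 hp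
  have hpos : 0 < p.toReal := by linarith
  have hpθ' : θ₀ * p.toReal < 1 := by
    rw [ENNReal.lt_inv_iff_lt_inv] at hpθ
    have h := ENNReal.toReal_lt_toReal ENNReal.ofReal_ne_top (ENNReal.inv_ne_top.2 hp0) |>.2 hpθ
    rw [ENNReal.toReal_ofReal hθ₀, ENNReal.toReal_inv] at h
    rwa [← one_div, lt_div_iff₀ hpos] at h
  obtain ⟨C, hC⟩ := exists_lintegral_productKernel_rpow_le hn hθ₀ hθ hsum hα hα0 hp1 hpθ'
  refine ⟨(|A|.toNNReal ^ p.toReal * C) ^ (1 / p.toReal), fun K hK P f hf => ?_⟩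
  have : Nonempty (Fin n) := ⟨⟨0, hn⟩⟩
  have hmeas := aestronglyMeasurable_oscIntegrand P hK.measurable hf.1
  have hbound : ∫⁻ x, (∫⁻ y, ‖oscIntegrand P K f x y‖ₑ) ^ p.toReal ≤
      ENNReal.ofReal |A| ^ p.toReal * C * ∫⁻ y, ‖f y‖ₑ ^ p.toReal := by
    calc _ ≤ ∫⁻ x, ENNReal.ofReal |A| ^ p.toReal *
          (∫⁻ y, ENNReal.ofReal (productKernel θ₀ θ α x y) * ‖f y‖ₑ) ^ p.toReal := by
          refine lintegral_mono_ae ?_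
          filter_upwards [Measure.ae_ne volume 0] with x hx
          rw [← ENNReal.mul_rpow_of_nonneg _ _ hpos.le]
          gcongr
          exact lintegral_enorm_oscIntegrand_le hn hα0 hK P f hx
      _ ≤ _ := by
          rw [lintegral_const_mul' _ _ (ENNReal.rpow_ne_top_of_nonneg hpos.le
            ENNReal.ofReal_ne_top), mul_assoc]
          gcongr
          exact hC _ hf.1.enorm
  have hTm : AEStronglyMeasurable (oscOperator P K f) volume := hmeas.integral_prod_right'
  have hfin : ∫⁻ y, ‖f y‖ₑ ^ p.toReal ≠ ∞ :=
    (lintegral_rpow_enorm_lt_top_of_eLpNorm_lt_top hp0 hptop hf.2).ne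
  have hnorm : eLpNorm (oscOperator P K f) p volume ≤
      ((|A|.toNNReal ^ p.toReal * C) ^ (1 / p.toReal) : ℝ≥0) * eLpNorm f p volume := by
    rw [eLpNorm_eq_lintegral_rpow_enorm_toReal hp0 hptop,
      eLpNorm_eq_lintegral_rpow_enorm_toReal hp0 hptop,
      ENNReal.coe_rpow_of_nonneg _ (by positivity),
      ← ENNReal.mul_rpow_of_nonneg _ _ (by positivity)]
    push_cast
    rw [ENNReal.coe_rpow_of_nonneg _ hpos.le]
    refine ENNReal.rpow_le_rpow ?_ (by positivity)
    refine le_trans (lintegral_mono fun x => ?_) hbound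
    gcongr
    exact enorm_integral_le_lintegral_enorm _
  refine ⟨?_, ⟨hTm, lt_of_le_of_lt hnorm (ENNReal.mul_lt_top ENNReal.coe_lt_top hf.2)⟩, hnorm⟩
  have hm : AEMeasurable (fun x => (∫⁻ y, ‖oscIntegrand P K f x y‖ₑ) ^ p.toReal) volume :=
    (hmeas.enorm.lintegral_prod_right').pow_const _
  have hlt : ∀ᵐ x, (∫⁻ y, ‖oscIntegrand P K f x y‖ₑ) ^ p.toReal < ∞ := by
    refine ae_lt_top' hm (ne_top_of_le_ne_top ?_ hbound)
    exact ENNReal.mul_ne_top (ENNReal.mul_ne_top (ENNReal.rpow_ne_top_of_nonneg hpos.le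
      ENNReal.ofReal_ne_top) ENNReal.coe_ne_top) hfin
  filter_upwards [hlt, hmeas.prodMk_left] with x hx hxm
  exact ⟨hxm, (ENNReal.rpow_lt_top_iff_of_pos hpos).1 hx⟩

/-! ### Size estimates for atoms -/

/-- The size and support conditions of an atom on the cube of center `c` and side `2r`, without
the cancellation condition. -/
structure IsSizedOnCube {n : ℕ} (a : EuclideanSpace ℝ (Fin n) → ℂ) (c : EuclideanSpace ℝ (Fin n))
    (r : ℝ) : Prop where
  aestronglyMeasurable : AEStronglyMeasurable a volume
  pos : 0 < r
  support_subset : Function.support a ⊆ axisCube c r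
  norm_le : ∀ᵐ x, x ∈ axisCube c r → ‖a x‖ ≤ (volume.real (axisCube c r))⁻¹

/-- A radius of a ball centered at the origin which contains the cube of center `c` and side `2r`;
it is comparable to the distance from the origin to the farthest point of the cube. -/
noncomputable def outerRadius {n : ℕ} (c : EuclideanSpace ℝ (Fin n)) (r : ℝ) : ℝ := ‖c‖ + √n * r

lemma norm_sub_le_of_mem_axisCube {n : ℕ} {c y : EuclideanSpace ℝ (Fin n)} {r : ℝ} (hr : 0 < r)
    (hy : y ∈ axisCube c r) : ‖y - c‖ ≤ √n * r := by
  rw [EuclideanSpace.norm_eq]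
  apply Real.sqrt_le_iff.2 ⟨by positivity, ?_⟩
  rw [mul_pow, Real.sq_sqrt (Nat.cast_nonneg n)]
  calc ∑ i, ‖(y - c) i‖ ^ 2 ≤ ∑ _i : Fin n, r ^ 2 := by
        gcongr with i
        exact hy i
    _ = n * r ^ 2 := by simp

lemma norm_le_of_mem_axisCube {n : ℕ} {c y : EuclideanSpace ℝ (Fin n)} {r : ℝ} (hr : 0 < r)
    (hy : y ∈ axisCube c r) : ‖y‖ ≤ outerRadius c r := by
  have h1 := norm_sub_le_of_mem_axisCube hr hy
  have h2 := norm_add_le (y - c) c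
  rw [sub_add_cancel] at h2
  unfold outerRadius
  linarith

lemma le_sqrt_mul {n : ℕ} (hn : 0 < n) {r : ℝ} (hr : 0 < r) : r ≤ √n * r := by
  have : (1 : ℝ) ≤ √n := Real.one_le_sqrt.2 (by exact_mod_cast hn)
  nlinarith

lemma IsSizedOnCube.enorm_le {n : ℕ} {a : EuclideanSpace ℝ (Fin n) → ℂ}
    {c : EuclideanSpace ℝ (Fin n)} {r : ℝ} (h : IsSizedOnCube a c r) :
    ∀ᵐ y, ‖a y‖ₑ ≤ (axisCube c r).indicator (fun _ => ENNReal.ofReal (((2 * r) ^ n)⁻¹)) y := by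
  have hr := h.pos
  filter_upwards [h.norm_le] with y hy
  by_cases hyQ : y ∈ axisCube c r
  · rw [Set.indicator_of_mem hyQ, ← ofReal_norm]
    have := hy hyQ
    rw [Measure.real, volume_axisCube c hr, ENNReal.toReal_ofReal (by positivity)] at this
    exact ENNReal.ofReal_le_ofReal this
  · rw [Set.indicator_of_notMem hyQ, Function.notMem_support.1 fun h' => hyQ (h.support_subset h')]
    simp

lemma IsSizedOnCube.lintegral_enorm_le_one {n : ℕ} {a : EuclideanSpace ℝ (Fin n) → ℂ}
    {c : EuclideanSpace ℝ (Fin n)} {r : ℝ} (h : IsSizedOnCube a c r) : ∫⁻ y, ‖a y‖ₑ ≤ 1 := by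
  have hr := h.pos
  refine (lintegral_mono_ae h.enorm_le).trans (le_of_eq ?_)
  rw [lintegral_indicator (measurableSet_axisCube c r), setLIntegral_const, volume_axisCube c hr,
    ← ENNReal.ofReal_mul (by positivity), inv_mul_cancel₀ (by positivity), ENNReal.ofReal_one]

/-- Averages of `‖y‖ ^ (-b)` over a cube are comparable to the value at its farthest point. -/
lemma exists_lintegral_atom_mul_norm_rpow_le {n : ℕ} (hn : 0 < n) {b : ℝ} (hb : 0 < b)
    (hbn : b < n) :
    ∃ C : ℝ≥0, ∀ (a : EuclideanSpace ℝ (Fin n) → ℂ) (c : EuclideanSpace ℝ (Fin n)) (r : ℝ),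
      IsSizedOnCube a c r →
      ∫⁻ y, ‖a y‖ₑ * ENNReal.ofReal (‖y‖ ^ (-b)) ≤ C * ENNReal.ofReal (outerRadius c r ^ (-b)) := by
  obtain ⟨C₁, h1⟩ := exists_lintegral_add_norm_rpow_le hn (s := n) hb.le hbn (by linarith)
  have hn0 : (0 : ℝ) < n := by exact_mod_cast hn
  have hσ : 0 < √(n : ℝ) := Real.sqrt_pos.2 hn0
  refine ⟨Real.toNNReal (3 ^ b) + Real.toNNReal ((3 * √n) ^ n) * C₁, fun a c r h => ?_⟩
  have hr := h.pos
  have hσr : 0 < √n * r := by positivity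
  set ρ := outerRadius c r with hρ
  have hρ0 : 0 < ρ := by rw [hρ, outerRadius]; positivity
  push_cast
  rw [add_mul]
  rcases le_total (2 * (√n * r)) ‖c‖ with hc | hc
  · -- the cube is far from the origin
    refine le_trans ?_ le_self_add
    calc _ ≤ ∫⁻ y, ‖a y‖ₑ * ENNReal.ofReal (3 ^ b * ρ ^ (-b)) := by
          refine lintegral_mono fun y => ?_
          by_cases hy : y ∈ axisCube c r
          · refine mul_le_mul_right (ENNReal.ofReal_le_ofReal ?_) _
            have h2 := norm_sub_le_of_mem_axisCube hr hy
            have h3 : ‖c‖ ≤ ‖y‖ + ‖y - c‖ := by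
              have := norm_sub_le y (y - c)
              rwa [sub_sub_cancel] at this
            have h4 : ρ / 3 ≤ ‖y‖ := by rw [hρ, outerRadius]; linarith
            refine (Real.rpow_le_rpow_of_nonpos (by positivity) h4 (by linarith)).trans
              (le_of_eq ?_)
            rw [Real.div_rpow hρ0.le (by norm_num), Real.rpow_neg (by norm_num : (0 : ℝ) ≤ 3),
              div_inv_eq_mul, mul_comm]
          · rw [Function.notMem_support.1 fun h' => hy (h.support_subset h')]
            simp
      _ = (∫⁻ y, ‖a y‖ₑ) * ENNReal.ofReal (3 ^ b * ρ ^ (-b)) :=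
          lintegral_mul_const' _ _ ENNReal.ofReal_ne_top
      _ ≤ 1 * ENNReal.ofReal (3 ^ b * ρ ^ (-b)) := by gcongr; exact h.lintegral_enorm_le_one
      _ = _ := by rw [one_mul, ENNReal.ofReal_mul (by positivity)]; rfl
  · -- the cube is comparable to a ball centered at the origin
    refine le_trans ?_ le_add_self
    calc _ ≤ ∫⁻ y, ENNReal.ofReal ((3 * √n) ^ n) *
          ENNReal.ofReal ((ρ + ‖y‖) ^ (-(n : ℝ)) * ‖y‖ ^ (-b)) := by
          refine lintegral_mono_ae ?_
          filter_upwards [h.enorm_le] with y hy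
          by_cases hyQ : y ∈ axisCube c r
          · rw [Set.indicator_of_mem hyQ] at hy
            refine (mul_le_mul_left hy _).trans ?_
            rw [← ENNReal.ofReal_mul (by positivity), ← ENNReal.ofReal_mul (by positivity),
              ← mul_assoc]
            apply ENNReal.ofReal_le_ofReal
            have hρy : 0 < ρ + ‖y‖ := by
              have := norm_nonneg y
              linarith
            refine mul_le_mul_of_nonneg_right ?_ (by positivity)
            have h2 : ρ + ‖y‖ ≤ 3 * √n * (2 * r) := by
              have := norm_le_of_mem_axisCube hr hyQ
              have h3 : ρ ≤ 3 * (√n * r) := by rw [hρ, outerRadius]; linarith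
              linarith
            rw [Real.rpow_neg hρy.le, Real.rpow_natCast, ← div_eq_mul_inv,
              le_div_iff₀ (pow_pos hρy n), inv_mul_le_iff₀ (by positivity),
              mul_comm _ ((3 * √n) ^ n),
              ← mul_pow]
            gcongr
          · rw [Function.notMem_support.1 fun h' => hyQ (h.support_subset h')]
            simp
      _ ≤ _ := by
          rw [lintegral_const_mul' _ _ ENNReal.ofReal_ne_top, mul_assoc]
          have h4 := h1 ρ hρ0
          rw [sub_self, zero_sub] at h4
          exact mul_le_mul_right h4 _

/-- Integrability of the positive operator applied to an atom, over a ball comparable to the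
smallest ball around the origin which contains the cube. -/
lemma exists_lintegral_near_le {n m : ℕ} (hn : 0 < n) {θ₀ : ℝ} {θ α : Fin m → ℝ} (hθ₀ : 0 ≤ θ₀)
    (hθ₀' : θ₀ < 1) (hθ : ∀ k, 0 < θ k ∧ θ k < 1) (hsum : θ₀ + ∑ k, θ k = 1)
    (hα : Function.Injective α) (hα0 : ∀ k, α k ≠ 0) {Λ : ℝ} (hΛ : 0 < Λ) :
    ∃ C : ℝ≥0, ∀ (a : EuclideanSpace ℝ (Fin n) → ℂ) (c : EuclideanSpace ℝ (Fin n)) (r : ℝ),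
      IsSizedOnCube a c r →
      ∫⁻ x in {x | ‖x‖ ≤ Λ * outerRadius c r},
        ∫⁻ y, ENNReal.ofReal (productKernel θ₀ θ α x y) * ‖a y‖ₑ ≤ C := by
  have hn0 : (0 : ℝ) < n := by exact_mod_cast hn
  have : Nonempty (Fin n) := ⟨⟨0, hn⟩⟩
  -- Any `b` strictly between `0` and `(1 - θ₀) n` will do.
  obtain ⟨b, hb, hbn⟩ : ∃ b : ℝ, 0 < b ∧ θ₀ * n + b < n :=
    ⟨(1 - θ₀) * n / 2, by have : 0 < 1 - θ₀ := by linarith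
                          positivity, by nlinarith⟩
  obtain ⟨C₁, h1⟩ := exists_lintegral_productKernel_mul_left_le hn hθ₀ hθ hsum hα hα0 hb hbn
  obtain ⟨C₂, h2⟩ := exists_lintegral_atom_mul_norm_rpow_le hn hb
    (lt_of_le_of_lt (le_add_of_nonneg_left (by positivity)) hbn)
  refine ⟨Real.toNNReal (Λ ^ b) * (C₁ * C₂), fun a c r h => ?_⟩
  have hr := h.pos
  set ρ := outerRadius c r with hρ
  have hρ0 : 0 < ρ := by
    have := Real.sqrt_pos.2 hn0
    rw [hρ, outerRadius]; positivity
  have hkm := measurable_productKernel (n := n) θ₀ θ α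
  have hmeas : AEMeasurable (Function.uncurry fun x y : EuclideanSpace ℝ (Fin n) =>
      ENNReal.ofReal (‖x‖ ^ (-b)) * (ENNReal.ofReal (productKernel θ₀ θ α x y) * ‖a y‖ₑ))
      (volume.prod volume) := by
    have hx : Measurable fun z : EuclideanSpace ℝ (Fin n) × EuclideanSpace ℝ (Fin n) =>
      ENNReal.ofReal (‖z.1‖ ^ (-b)) := by fun_prop
    exact hx.aemeasurable.mul (hkm.ennreal_ofReal.aemeasurable.mul
      h.aestronglyMeasurable.enorm.comp_snd)
  calc _ ≤ ∫⁻ x in {x | ‖x‖ ≤ Λ * ρ}, ENNReal.ofReal ((Λ * ρ) ^ b) *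
        ∫⁻ y, ENNReal.ofReal (‖x‖ ^ (-b)) *
          (ENNReal.ofReal (productKernel θ₀ θ α x y) * ‖a y‖ₑ) := by
        refine lintegral_mono_ae ?_
        have hms : MeasurableSet {x : EuclideanSpace ℝ (Fin n) | ‖x‖ ≤ Λ * ρ} :=
          measurableSet_le measurable_norm measurable_const
        filter_upwards [ae_restrict_mem hms, ae_restrict_of_ae (Measure.ae_ne volume 0)]
          with x hx hx0
        -- On this ball the weight `(‖x‖ / (Λ ρ)) ^ (-b)` is at least one.
        have hx0' := norm_pos_iff.2 hx0
        rw [lintegral_const_mul' _ _ ENNReal.ofReal_ne_top, ← mul_assoc,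
          ← ENNReal.ofReal_mul (by positivity)]
        refine le_mul_of_one_le_left' (ENNReal.one_le_ofReal.2 ?_)
        rw [Real.rpow_neg hx0'.le, ← div_eq_mul_inv, ← Real.div_rpow (by positivity) hx0'.le]
        exact Real.one_le_rpow ((one_le_div hx0').2 hx) hb.le
    _ ≤ ∫⁻ x, ENNReal.ofReal ((Λ * ρ) ^ b) *
        ∫⁻ y, ENNReal.ofReal (‖x‖ ^ (-b)) *
          (ENNReal.ofReal (productKernel θ₀ θ α x y) * ‖a y‖ₑ) := setLIntegral_le_lintegral _ _
    _ = ENNReal.ofReal ((Λ * ρ) ^ b) * ∫⁻ y, ‖a y‖ₑ *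
        ∫⁻ x, ENNReal.ofReal (productKernel θ₀ θ α x y) * ENNReal.ofReal (‖x‖ ^ (-b)) := by
        rw [lintegral_const_mul' _ _ ENNReal.ofReal_ne_top, lintegral_lintegral_swap hmeas]
        congr 1
        refine lintegral_congr fun y => ?_
        rw [← lintegral_const_mul' _ _ enorm_ne_top]
        refine lintegral_congr fun x => ?_
        ring
    _ ≤ ENNReal.ofReal ((Λ * ρ) ^ b) * ∫⁻ y, C₁ * (‖a y‖ₑ * ENNReal.ofReal (‖y‖ ^ (-b))) := by
        refine mul_le_mul_right (lintegral_mono_ae ?_) _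
        filter_upwards [Measure.ae_ne volume 0] with y hy
        rw [mul_left_comm]
        exact mul_le_mul_right (h1 y hy) _
    _ ≤ ENNReal.ofReal ((Λ * ρ) ^ b) * (C₁ * (C₂ * ENNReal.ofReal (ρ ^ (-b)))) := by
        rw [lintegral_const_mul' _ _ ENNReal.coe_ne_top]
        gcongr
        exact h2 a c r h
    _ = _ := by
        rw [Real.mul_rpow hΛ.le hρ0.le, ENNReal.ofReal_mul (by positivity)]
        have h3 : ENNReal.ofReal (ρ ^ b) * ENNReal.ofReal (ρ ^ (-b)) = 1 := by
          rw [← ENNReal.ofReal_mul (by positivity), ← Real.rpow_add hρ0, add_neg_cancel,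
            Real.rpow_zero, ENNReal.ofReal_one]
        push_cast
        calc _ = ENNReal.ofReal (Λ ^ b) * (C₁ * C₂) *
              (ENNReal.ofReal (ρ ^ b) * ENNReal.ofReal (ρ ^ (-b))) := by ring
          _ = _ := by rw [h3, mul_one]; rfl

/-! ### The kernel at large distance -/

lemma half_norm_le_norm_sub_smul {n : ℕ} {Λ β : ℝ} (hΛ : 2 * |β| ≤ Λ)
    {x y : EuclideanSpace ℝ (Fin n)} (hxy : Λ * ‖y‖ ≤ ‖x‖) : ‖x‖ / 2 ≤ ‖x - β • y‖ := by
  have h1 := norm_add_le (x - β • y) (β • y)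
  rw [sub_add_cancel, norm_smul, Real.norm_eq_abs] at h1
  nlinarith [norm_nonneg y]

lemma ne_smul_of_far {n : ℕ} {Λ β : ℝ} (hΛ : 2 * |β| ≤ Λ) {x y : EuclideanSpace ℝ (Fin n)}
    (hx : x ≠ 0) (hxy : Λ * ‖y‖ ≤ ‖x‖) : x ≠ β • y := by
  have h1 := half_norm_le_norm_sub_smul hΛ hxy
  have h2 := norm_pos_iff.2 hx
  intro h
  rw [sub_eq_zero.2 h, norm_zero] at h1
  linarith

lemma productKernel_le_of_far {n m : ℕ} {θ₀ : ℝ} {θ α : Fin m → ℝ} (hθ₀ : 0 ≤ θ₀)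
    (hθ : ∀ k, 0 < θ k) (hsum : θ₀ + ∑ k, θ k = 1) {Λ : ℝ} (hΛ : ∀ k, 2 * |α k| ≤ Λ)
    {x y : EuclideanSpace ℝ (Fin n)} (hx : x ≠ 0) (hxy : Λ * ‖y‖ ≤ ‖x‖) :
    productKernel θ₀ θ α x y ≤ (‖x‖ / 2) ^ (-(n : ℝ)) := by
  have hx0 := norm_pos_iff.2 hx
  set s := ‖x‖ / 2 with hs
  have hs0 : 0 < s := by positivity
  have hn0 : (0 : ℝ) ≤ n := Nat.cast_nonneg n
  have h1 : ‖x‖ ^ (-(θ₀ * n)) ≤ s ^ (-(θ₀ * n)) :=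
    Real.rpow_le_rpow_of_nonpos hs0 (by linarith) (by nlinarith [mul_nonneg hθ₀ hn0])
  have h2 : ∏ k, ‖x - α k • y‖ ^ (-(θ k * n)) ≤ ∏ k, s ^ (-(θ k * n)) := by
    refine Finset.prod_le_prod (fun k _ => by positivity) fun k _ => ?_
    exact Real.rpow_le_rpow_of_nonpos hs0 (half_norm_le_norm_sub_smul (hΛ k) hxy)
      (by nlinarith [mul_nonneg (hθ k).le hn0])
  unfold productKernel
  calc _ ≤ s ^ (-(θ₀ * n)) * ∏ k, s ^ (-(θ k * n)) :=
        mul_le_mul h1 h2 (Finset.prod_nonneg fun k _ => by positivity) (by positivity)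
    _ = _ := by
        rw [← Real.rpow_sum_of_pos hs0, ← Real.rpow_add hs0, Finset.sum_neg_distrib,
          ← Finset.sum_mul, ← neg_add, ← add_mul, hsum, one_mul]

lemma gradient_bound_le_of_far {n m : ℕ} {θ₀ : ℝ} {θ α : Fin m → ℝ} (hθ₀ : 0 ≤ θ₀)
    (hθ : ∀ k, 0 < θ k) (hsum : θ₀ + ∑ k, θ k = 1) {Λ : ℝ} (hΛ : ∀ k, 2 * |α k| ≤ Λ)
    {x y : EuclideanSpace ℝ (Fin n)} (hx : x ≠ 0) (hxy : Λ * ‖y‖ ≤ ‖x‖) :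
    ‖x‖ ^ (-(θ₀ * n)) * ∑ k, ‖x - α k • y‖ ^ (-(θ k * n) - 1) *
      ∏ j ∈ Finset.univ.erase k, ‖x - α j • y‖ ^ (-(θ j * n)) ≤
        m * (‖x‖ / 2) ^ (-(n : ℝ) - 1) := by
  have hx0 := norm_pos_iff.2 hx
  have hs0 : 0 < ‖x‖ / 2 := by positivity
  have hk : ∀ k, ‖x‖ ^ (-(θ₀ * n)) * (‖x - α k • y‖ ^ (-(θ k * n) - 1) *
      ∏ j ∈ Finset.univ.erase k, ‖x - α j • y‖ ^ (-(θ j * n))) ≤ (‖x‖ / 2) ^ (-(n : ℝ) - 1) := by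
    intro k
    have hk0 := half_norm_le_norm_sub_smul (hΛ k) hxy
    have h1 : ‖x - α k • y‖⁻¹ ≤ (‖x‖ / 2)⁻¹ := inv_anti₀ hs0 hk0
    have h2 : ‖x‖ ^ (-(θ₀ * n)) * (‖x - α k • y‖ ^ (-(θ k * n) - 1) *
        ∏ j ∈ Finset.univ.erase k, ‖x - α j • y‖ ^ (-(θ j * n))) =
        productKernel θ₀ θ α x y * ‖x - α k • y‖⁻¹ := by
      rw [productKernel, ← Finset.mul_prod_erase _ _ (Finset.mem_univ k),
        Real.rpow_sub (lt_of_lt_of_le hs0 hk0), Real.rpow_one, div_eq_mul_inv]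
      ring
    rw [h2, Real.rpow_sub hs0, Real.rpow_one, div_eq_mul_inv]
    exact mul_le_mul (productKernel_le_of_far hθ₀ hθ hsum hΛ hx hxy) h1 (by positivity)
      (by positivity)
  rw [Finset.mul_sum]
  refine (Finset.sum_le_card_nsmul _ _ _ fun k _ => hk k).trans (le_of_eq ?_)
  simp

/-- Far from the cube, `T_P a` is compared with `K(x, c)` times the oscillatory integral of `a`;
the error is controlled by the gradient of the kernel. -/
lemma enorm_oscOperator_atom_le_of_far {n m : ℕ} (hn : 0 < n) {θ₀ : ℝ} {θ α : Fin m → ℝ}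
    (hθ₀ : 0 ≤ θ₀) (hθ : ∀ k, 0 < θ k) (hsum : θ₀ + ∑ k, θ k = 1) {A B : ℝ}
    {K : EuclideanSpace ℝ (Fin n) → EuclideanSpace ℝ (Fin n) → ℂ}
    (hK : IsProductTypeKernel θ₀ θ α A B K) {Λ : ℝ} (hΛ2 : 2 ≤ Λ) (hΛ : ∀ k, 2 * |α k| ≤ Λ)
    (P : MvPolynomial (Fin n ⊕ Fin n) ℝ) {a : EuclideanSpace ℝ (Fin n) → ℂ}
    {c : EuclideanSpace ℝ (Fin n)} {r : ℝ} (h : IsSizedOnCube a c r)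
    {x : EuclideanSpace ℝ (Fin n)} (hx : Λ * outerRadius c r < ‖x‖) :
    ‖oscOperator P K a x‖ₑ ≤
      ENNReal.ofReal (|B| * m * √n * 4 ^ (n + 1) * r) *
        ENNReal.ofReal ((outerRadius c r + ‖x‖) ^ (-(n + 1 : ℝ))) +
      ENNReal.ofReal (|A| * 4 ^ n) * (ENNReal.ofReal (‖x - c‖ ^ (-(n : ℝ))) *
        ‖∫ y, Complex.exp (Complex.I * (phase P x y : ℂ)) * a y‖ₑ) := by
  have hr := h.pos
  have hrσ := le_sqrt_mul hn hr
  have hc0 := norm_nonneg c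
  set ρ := outerRadius c r with hρ
  have hρr : r ≤ ρ := by rw [hρ, outerRadius]; linarith
  have hρ0 : 0 < ρ := by linarith
  have hcρ : ‖c‖ ≤ ρ := by rw [hρ, outerRadius]; linarith
  have hxρ : 2 * ρ ≤ ‖x‖ := by nlinarith
  have hx0 : 0 < ‖x‖ := by linarith
  have hxne : x ≠ 0 := norm_pos_iff.1 hx0
  have hfar : ∀ z : EuclideanSpace ℝ (Fin n), ‖z‖ ≤ ρ → Λ * ‖z‖ ≤ ‖x‖ := fun z hz => by nlinarith
  have hball : ∀ z ∈ Metric.closedBall (0 : EuclideanSpace ℝ (Fin n)) ρ, Λ * ‖z‖ ≤ ‖x‖ :=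
    fun z hz => hfar z (mem_closedBall_zero_iff.1 hz)
  set g := |B| * (m * (‖x‖ / 2) ^ (-(n : ℝ) - 1)) with hg
  have hg0 : 0 ≤ g := by positivity
  have hdiff : ∀ y ∈ axisCube c r, ‖K x y - K x c‖ ≤ g * (√n * r) := by
    intro y hy
    have h1 := Convex.norm_image_sub_le_of_norm_fderiv_le (𝕜 := ℝ) (f := K x) (C := g)
      (s := Metric.closedBall 0 ρ) (x := c) (y := y)
      (fun z hz => hK.differentiable x z hxne fun k => ne_smul_of_far (hΛ k) hxne (hball z hz))
      (fun z hz => ?_) (convex_closedBall 0 ρ) (mem_closedBall_zero_iff.2 hcρ)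
      (mem_closedBall_zero_iff.2 (norm_le_of_mem_axisCube hr hy))
    · exact h1.trans (mul_le_mul_of_nonneg_left (norm_sub_le_of_mem_axisCube hr hy) hg0)
    · refine (hK.gradient x z hxne fun k => ne_smul_of_far (hΛ k) hxne (hball z hz)).trans ?_
      have h2 := gradient_bound_le_of_far hθ₀ hθ hsum hΛ hxne (hball z hz)
      refine mul_le_mul (le_abs_self B) h2 ?_ (abs_nonneg B)
      exact mul_nonneg (by positivity) (Finset.sum_nonneg fun k _ =>
        mul_nonneg (by positivity) (Finset.prod_nonneg fun j _ => by positivity))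
  have hKc : ‖K x c‖ ≤ |A| * (‖x‖ / 2) ^ (-(n : ℝ)) := by
    refine (hK.size x c hxne fun k => ne_smul_of_far (hΛ k) hxne (hfar c hcρ)).trans ?_
    exact mul_le_mul (le_abs_self A) (productKernel_le_of_far hθ₀ hθ hsum hΛ hxne (hfar c hcρ))
      (productKernel_nonneg θ₀ θ α x c) (abs_nonneg A)
  let e : EuclideanSpace ℝ (Fin n) → ℂ := fun y => Complex.exp (Complex.I * (phase P x y : ℂ))
  have hen : ∀ y, ‖e y‖ = 1 := fun y => norm_exp_I_mul_ofReal' _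
  have hea : Integrable (fun y => e y * a y) volume := by
    refine ⟨?_, ?_⟩
    · have hc := (continuous_phase P).comp (Continuous.prodMk_right x)
      have hc' : Continuous fun y => phase P x y := hc
      exact (Continuous.aestronglyMeasurable (by simp only [e]; fun_prop)).mul h.1
    · refine lt_of_le_of_lt (lintegral_mono fun y => ?_)
        (lt_of_le_of_lt h.lintegral_enorm_le_one ENNReal.one_lt_top)
      rw [enorm_mul, ← ofReal_norm (e y), hen, ENNReal.ofReal_one, one_mul]
  have hmain : ‖oscOperator P K a x‖ₑ ≤
      ENNReal.ofReal (g * (√n * r)) + ‖K x c‖ₑ * ‖∫ y, e y * a y‖ₑ := by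
    -- Where the integral does not converge absolutely, `oscOperator` is zero by convention.
    by_cases hint : Integrable (oscIntegrand P K a x) volume
    swap
    · rw [oscOperator, integral_undef hint]; simp
    have h2 : oscOperator P K a x =
        (∫ y, (oscIntegrand P K a x y - K x c * (e y * a y))) + K x c * ∫ y, e y * a y := by
      rw [integral_sub hint (hea.const_mul _), integral_const_mul, sub_add_cancel]
      rfl
    rw [h2]
    refine (enorm_add_le _ _).trans ?_
    rw [enorm_mul]
    refine add_le_add ?_ le_rfl
    refine (enorm_integral_le_lintegral_enorm _).trans ?_
    calc _ ≤ ∫⁻ y, ENNReal.ofReal (g * (√n * r)) * ‖a y‖ₑ := by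
          refine lintegral_mono fun y => ?_
          have h3 : oscIntegrand P K a x y - K x c * (e y * a y) =
              e y * (K x y - K x c) * a y := by
            simp only [oscIntegrand, e]; ring
          rw [h3, enorm_mul, enorm_mul, ← ofReal_norm (e y), hen, ENNReal.ofReal_one, one_mul]
          by_cases hy : y ∈ axisCube c r
          · rw [← ofReal_norm (K x y - K x c)]
            gcongr
            exact hdiff y hy
          · rw [Function.notMem_support.1 fun h' => hy (h.support_subset h')]
            simp
      _ ≤ ENNReal.ofReal (g * (√n * r)) * 1 := by
          rw [lintegral_const_mul' _ _ ENNReal.ofReal_ne_top]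
          gcongr
          exact h.lintegral_enorm_le_one
      _ = _ := mul_one _
  refine hmain.trans (add_le_add ?_ ?_)
  · rw [← ENNReal.ofReal_mul (by positivity)]
    apply ENNReal.ofReal_le_ofReal
    have h3 : (‖x‖ / 2) ^ (-(n : ℝ) - 1) ≤ 4 ^ (n + 1) * (ρ + ‖x‖) ^ (-(n + 1 : ℝ)) := by
      have h4 : (ρ + ‖x‖) / 4 ≤ ‖x‖ / 2 := by linarith
      have h5 : -(n : ℝ) - 1 = -(n + 1 : ℝ) := by ring
      rw [h5]
      refine (Real.rpow_le_rpow_of_nonpos (by positivity) h4 ?_).trans (le_of_eq ?_)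
      · have : (0 : ℝ) ≤ n := Nat.cast_nonneg n
        linarith
      · rw [Real.div_rpow (by positivity) (by norm_num), Real.rpow_neg (by norm_num : (0 : ℝ) ≤ 4),
          div_inv_eq_mul, mul_comm]
        congr 1
        exact_mod_cast Real.rpow_natCast 4 (n + 1)
    calc g * (√n * r) ≤ |B| * (m * (4 ^ (n + 1) * (ρ + ‖x‖) ^ (-(n + 1 : ℝ)))) * (√n * r) := by
          rw [hg]; gcongr
      _ = _ := by ring
  · rw [← mul_assoc, ← ENNReal.ofReal_mul (by positivity), ← ofReal_norm (K x c)]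
    gcongr
    refine hKc.trans ?_
    rw [mul_assoc]
    gcongr
    have hxc0 : 0 < ‖x - c‖ := by
      have := norm_sub_norm_le x c
      linarith
    have h4 : ‖x - c‖ / 4 ≤ ‖x‖ / 2 := by
      have := norm_sub_le x c
      linarith
    refine (Real.rpow_le_rpow_of_nonpos (by positivity) h4 (by simp)).trans (le_of_eq ?_)
    rw [Real.div_rpow (by positivity) (by norm_num), Real.rpow_neg (by norm_num : (0 : ℝ) ≤ 4),
      div_inv_eq_mul, mul_comm, Real.rpow_natCast]

/-! ### Uniform bounds on atoms -/

lemma outerRadius_pos {n : ℕ} (hn : 0 < n) (c : EuclideanSpace ℝ (Fin n)) {r : ℝ} (hr : 0 < r) :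
    0 < outerRadius c r := by
  have := le_sqrt_mul hn hr
  have := norm_nonneg c
  unfold outerRadius
  linarith

lemma le_outerRadius {n : ℕ} (hn : 0 < n) (c : EuclideanSpace ℝ (Fin n)) {r : ℝ} (hr : 0 < r) :
    r ≤ outerRadius c r := by
  have := le_sqrt_mul hn hr
  have := norm_nonneg c
  unfold outerRadius
  linarith

lemma IsHardyEAtom.exists_isSizedOnCube {n : ℕ} {P : MvPolynomial (Fin n ⊕ Fin n) ℝ}
    {a : EuclideanSpace ℝ (Fin n) → ℂ} (h : IsHardyEAtom P a) : ∃ c r, IsSizedOnCube a c r := by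
  obtain ⟨hm, c, r, hr, hs, hle, -⟩ := h
  exact ⟨c, r, hm, hr, hs, hle⟩

lemma two_mul_abs_le_two_add_sum {m : ℕ} (α : Fin m → ℝ) (k : Fin m) :
    2 * |α k| ≤ 2 + 2 * ∑ j, |α j| := by
  have := Finset.single_le_sum (f := fun j => |α j|) (fun j _ => abs_nonneg _) (Finset.mem_univ k)
  linarith

/-- `T_P` maps atoms to functions with bounded `L¹` norm. Close to the origin, at the scale
of the cube, the size of the kernel is enough. Far away the kernel is replaced by its value at the
center of the cube, and the oscillatory integral of the atom is controlled by its cancellation and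
by the decay of oscillatory integrals with polynomial phase. -/
lemma exists_lintegral_oscOperator_atom_le {n m : ℕ} (hn : 0 < n) {θ₀ : ℝ} {θ α : Fin m → ℝ}
    (hθ₀ : 0 ≤ θ₀) (hθ₀' : θ₀ < 1) (hθ : ∀ k, 0 < θ k ∧ θ k < 1) (hsum : θ₀ + ∑ k, θ k = 1)
    (hα : Function.Injective α) (hα0 : ∀ k, α k ≠ 0) (A B : ℝ) (d : ℕ) :
    ∃ C : ℝ≥0, ∀ K : EuclideanSpace ℝ (Fin n) → EuclideanSpace ℝ (Fin n) → ℂ,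
      IsProductTypeKernel θ₀ θ α A B K →
      ∀ P : MvPolynomial (Fin n ⊕ Fin n) ℝ, P.totalDegree ≤ d →
      ∀ a : EuclideanSpace ℝ (Fin n) → ℂ, IsHardyEAtom P a →
        ∫⁻ x, ‖oscOperator P K a x‖ₑ ≤ C := by
  set Λ : ℝ := 2 + 2 * ∑ j, |α j| with hΛdef
  have hΛ := two_mul_abs_le_two_add_sum α
  have hΛ2 : 2 ≤ Λ := by
    have := Finset.sum_nonneg fun j (_ : j ∈ Finset.univ) => abs_nonneg (α j)
    rw [hΛdef]; linarith
  have hn0 : (0 : ℝ) < n := by exact_mod_cast hn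
  have : Nonempty (Fin n) := ⟨⟨0, hn⟩⟩
  obtain ⟨C₁, h1⟩ := exists_lintegral_near_le hn hθ₀ hθ₀' hθ hsum hα hα0 (Λ := Λ) (by linarith)
  obtain ⟨C₂, h2⟩ := exists_lintegral_osc_atom_le n d
  obtain ⟨C₃, h3⟩ := exists_lintegral_add_norm_rpow_le hn (s := n + 1) le_rfl hn0 (by linarith)
  refine ⟨|A|.toNNReal * C₁ + ((|B| * m * √n * 4 ^ (n + 1)).toNNReal * C₃ +
    (|A| * 4 ^ n).toNNReal * C₂), fun K hK P hP a ha => ?_⟩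
  obtain ⟨hm, c, r, hr, hs, hle, hint⟩ := ha
  have hsz : IsSizedOnCube a c r := ⟨hm, hr, hs, hle⟩
  have hρ0 := outerRadius_pos hn c hr
  have hrρ := le_outerRadius hn c hr
  set ρ := outerRadius c r with hρ
  have hms : MeasurableSet {x : EuclideanSpace ℝ (Fin n) | ‖x‖ ≤ Λ * ρ} :=
    measurableSet_le measurable_norm measurable_const
  rw [← lintegral_add_compl _ hms]
  push_cast
  refine add_le_add ?_ ?_
  · calc _ ≤ ∫⁻ x in {x | ‖x‖ ≤ Λ * ρ}, ENNReal.ofReal |A| *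
          ∫⁻ y, ENNReal.ofReal (productKernel θ₀ θ α x y) * ‖a y‖ₑ := by
          refine lintegral_mono_ae (ae_restrict_of_ae ?_)
          filter_upwards [Measure.ae_ne volume 0] with x hx
          exact (enorm_integral_le_lintegral_enorm _).trans
            (lintegral_enorm_oscIntegrand_le hn hα0 hK P a hx)
      _ ≤ _ := by
          rw [lintegral_const_mul' _ _ ENNReal.ofReal_ne_top]
          exact mul_le_mul_right (h1 a c r hsz) _
  · have hsub : {x : EuclideanSpace ℝ (Fin n) | ‖x‖ ≤ Λ * ρ}ᶜ ⊆ {x | r ≤ ‖x - c‖} := by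
      intro x hx
      have hx' : Λ * ρ < ‖x‖ := not_le.1 hx
      have h4 := norm_sub_norm_le x c
      have h5 := le_sqrt_mul hn hr
      have h6 : ρ = ‖c‖ + √n * r := rfl
      have h7 := norm_nonneg c
      change r ≤ ‖x - c‖
      nlinarith
    have hpt : ∀ x ∈ {x : EuclideanSpace ℝ (Fin n) | ‖x‖ ≤ Λ * ρ}ᶜ, ‖oscOperator P K a x‖ₑ ≤
        ENNReal.ofReal (|B| * m * √n * 4 ^ (n + 1) * r) *
          ENNReal.ofReal ((ρ + ‖x‖) ^ (-(n + 1 : ℝ))) +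
        ENNReal.ofReal (|A| * 4 ^ n) * (ENNReal.ofReal (‖x - c‖ ^ (-(n : ℝ))) *
          ‖∫ y, Complex.exp (Complex.I * (phase P x y : ℂ)) * a y‖ₑ) := fun x hx =>
      enorm_oscOperator_atom_le_of_far hn hθ₀ (fun k => (hθ k).1) hsum hK hΛ2 hΛ P hsz
        (not_le.1 hx)
    refine (setLIntegral_mono' hms.compl hpt).trans ?_
    rw [lintegral_add_left (by fun_prop), lintegral_const_mul' _ _ ENNReal.ofReal_ne_top,
      lintegral_const_mul' _ _ ENNReal.ofReal_ne_top]
    refine add_le_add ?_ ?_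
    · have h4 : ∫⁻ x in {x : EuclideanSpace ℝ (Fin n) | ‖x‖ ≤ Λ * ρ}ᶜ,
          ENNReal.ofReal ((ρ + ‖x‖) ^ (-(n + 1 : ℝ))) ≤ C₃ * ENNReal.ofReal ρ⁻¹ := by
        have h5 := h3 ρ hρ0
        simp only [neg_zero, Real.rpow_zero, mul_one] at h5
        rw [show (n : ℝ) - (n + 1) - 0 = -1 by ring, Real.rpow_neg_one] at h5
        exact (setLIntegral_le_lintegral _ _).trans h5
      calc _ ≤ ENNReal.ofReal (|B| * m * √n * 4 ^ (n + 1) * r) * (C₃ * ENNReal.ofReal ρ⁻¹) :=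
            mul_le_mul_right h4 _
        _ = ENNReal.ofReal (|B| * m * √n * 4 ^ (n + 1)) * C₃ * ENNReal.ofReal (r * ρ⁻¹) := by
            rw [ENNReal.ofReal_mul (by positivity), ENNReal.ofReal_mul hr.le]
            ring
        _ ≤ ENNReal.ofReal (|B| * m * √n * 4 ^ (n + 1)) * C₃ * 1 := by
            refine mul_le_mul_right (ENNReal.ofReal_le_one.2 ?_) _
            rw [← div_eq_mul_inv]
            exact (div_le_one hρ0).2 hrρ
        _ = _ := mul_one _
    · exact mul_le_mul_right ((lintegral_mono_set hsub).trans (h2 P hP a c r hr hm hs hle hint)) _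

/-- Uniform bounds in `L¹` of an annulus for the positive operator applied to atoms. -/
lemma exists_lintegral_annulus_le {n m : ℕ} (hn : 0 < n) {θ₀ : ℝ} {θ α : Fin m → ℝ}
    (hθ₀ : 0 ≤ θ₀) (hθ₀' : θ₀ < 1) (hθ : ∀ k, 0 < θ k ∧ θ k < 1) (hsum : θ₀ + ∑ k, θ k = 1)
    (hα : Function.Injective α) (hα0 : ∀ k, α k ≠ 0) {R : ℝ} (hR : 0 < R) :
    ∃ C : ℝ≥0, ∀ (a : EuclideanSpace ℝ (Fin n) → ℂ) (c : EuclideanSpace ℝ (Fin n)) (r : ℝ),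
      IsSizedOnCube a c r →
      ∫⁻ x in {x | R⁻¹ ≤ ‖x‖ ∧ ‖x‖ ≤ R},
        ∫⁻ y, ENNReal.ofReal (productKernel θ₀ θ α x y) * ‖a y‖ₑ ≤ C := by
  set Λ : ℝ := 2 + 2 * ∑ j, |α j| with hΛdef
  have hΛ := two_mul_abs_le_two_add_sum α
  have hΛ2 : 2 ≤ Λ := by
    have := Finset.sum_nonneg fun j (_ : j ∈ Finset.univ) => abs_nonneg (α j)
    rw [hΛdef]; linarith
  obtain ⟨C₁, h1⟩ := exists_lintegral_near_le hn hθ₀ hθ₀' hθ hsum hα hα0 (Λ := Λ) (by linarith)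
  have hvol : volume (Metric.closedBall (0 : EuclideanSpace ℝ (Fin n)) R) ≠ ∞ :=
    measure_closedBall_lt_top.ne
  refine ⟨C₁ + ((R⁻¹ / 2) ^ (-(n : ℝ))).toNNReal *
    (volume (Metric.closedBall (0 : EuclideanSpace ℝ (Fin n)) R)).toNNReal, fun a c r h => ?_⟩
  have hr := h.pos
  set ρ := outerRadius c r with hρ
  push_cast
  rw [ENNReal.coe_toNNReal hvol]
  set S : Set (EuclideanSpace ℝ (Fin n)) := {x | R⁻¹ ≤ ‖x‖ ∧ ‖x‖ ≤ R} with hS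
  set N : Set (EuclideanSpace ℝ (Fin n)) := {x | ‖x‖ ≤ Λ * ρ} with hN
  have hmN : MeasurableSet N := measurableSet_le measurable_norm measurable_const
  have hmS : MeasurableSet S := (measurableSet_le measurable_const measurable_norm).inter
    (measurableSet_le measurable_norm measurable_const)
  refine (lintegral_mono_set (t := N ∪ S \ N) (by rw [Set.union_sdiff_self]; simp)).trans ?_
  refine (lintegral_union_le _ _ _).trans (add_le_add (h1 a c r h) ?_)
  calc _ ≤ ∫⁻ x in S \ N, ENNReal.ofReal ((R⁻¹ / 2) ^ (-(n : ℝ))) := by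
        refine setLIntegral_mono' (hmS.diff hmN) fun x hx => ?_
        have hxR : R⁻¹ ≤ ‖x‖ := hx.1.1
        have hxN : Λ * ρ < ‖x‖ := not_le.1 hx.2
        have hR' : 0 < R⁻¹ := inv_pos.2 hR
        have hx0 : x ≠ 0 := norm_pos_iff.1 (hR'.trans_le hxR)
        calc _ ≤ ∫⁻ y, ENNReal.ofReal ((R⁻¹ / 2) ^ (-(n : ℝ))) * ‖a y‖ₑ := by
              refine lintegral_mono fun y => ?_
              by_cases hy : y ∈ axisCube c r
              · refine mul_le_mul_left (ENNReal.ofReal_le_ofReal ?_) _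
                have h4 := norm_le_of_mem_axisCube hr hy
                refine (productKernel_le_of_far hθ₀ (fun k => (hθ k).1) hsum hΛ hx0
                  (by nlinarith)).trans ?_
                exact Real.rpow_le_rpow_of_nonpos (by positivity) (by linarith) (by simp)
              · rw [Function.notMem_support.1 fun h' => hy (h.support_subset h')]
                simp
          _ ≤ ENNReal.ofReal ((R⁻¹ / 2) ^ (-(n : ℝ))) * 1 := by
              rw [lintegral_const_mul' _ _ ENNReal.ofReal_ne_top]
              exact mul_le_mul_right h.lintegral_enorm_le_one _
          _ = _ := mul_one _
    _ = ENNReal.ofReal ((R⁻¹ / 2) ^ (-(n : ℝ))) * volume (S \ N) := setLIntegral_const _ _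
    _ ≤ _ := by
        refine mul_le_mul_right (measure_mono fun x hx => ?_) _
        exact mem_closedBall_zero_iff.2 hx.1.2

/-! ### Sums of atoms -/

/-- For almost every `x`, the integrands of the atoms in a decomposition are absolutely summable
in `L¹`. -/
lemma ae_tsum_lintegral_enorm_ne_top {n m : ℕ} (hn : 0 < n) {θ₀ : ℝ} {θ α : Fin m → ℝ}
    (hθ₀ : 0 ≤ θ₀) (hθ₀' : θ₀ < 1) (hθ : ∀ k, 0 < θ k ∧ θ k < 1) (hsum : θ₀ + ∑ k, θ k = 1)
    (hα : Function.Injective α) (hα0 : ∀ k, α k ≠ 0) {A B : ℝ}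
    {K : EuclideanSpace ℝ (Fin n) → EuclideanSpace ℝ (Fin n) → ℂ}
    (hK : IsProductTypeKernel θ₀ θ α A B K) (P : MvPolynomial (Fin n ⊕ Fin n) ℝ)
    {l : ℕ → ℂ} {a : ℕ → EuclideanSpace ℝ (Fin n) → ℂ} (ha : ∀ j, IsHardyEAtom P (a j))
    (hl : Summable fun j => ‖l j‖) :
    ∀ᵐ x, ∑' j, ‖l j‖ₑ * ∫⁻ y, ‖oscIntegrand P K (a j) x y‖ₑ ≠ ∞ := by
  have : Nonempty (Fin n) := ⟨⟨0, hn⟩⟩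
  have hl' : ∑' j, ‖l j‖ₑ ≠ ∞ := by
    simpa only [← ofReal_norm] using hl.tsum_ofReal_ne_top
  have hmeas : ∀ j, AEMeasurable (fun x => ‖l j‖ₑ * ∫⁻ y, ‖oscIntegrand P K (a j) x y‖ₑ) volume :=
    fun j => ((aestronglyMeasurable_oscIntegrand P hK.measurable (ha j).1).enorm
      |>.lintegral_prod_right').const_mul _
  have hann : ∀ N : ℕ, ∀ᵐ x ∂(volume.restrict
      {x : EuclideanSpace ℝ (Fin n) | (N + 1 : ℝ)⁻¹ ≤ ‖x‖ ∧ ‖x‖ ≤ N + 1}),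
      ∑' j, ‖l j‖ₑ * ∫⁻ y, ‖oscIntegrand P K (a j) x y‖ₑ < ∞ := by
    intro N
    obtain ⟨C, hC⟩ := exists_lintegral_annulus_le hn hθ₀ hθ₀' hθ hsum hα hα0
      (R := N + 1) (by positivity)
    refine ae_lt_top' (AEMeasurable.tsum fun j => (hmeas j).restrict) ?_
    rw [lintegral_tsum fun j => (hmeas j).restrict]
    refine ne_top_of_le_ne_top (b := ∑' j, ‖l j‖ₑ * (ENNReal.ofReal |A| * C)) ?_
      (ENNReal.tsum_le_tsum fun j => ?_)
    · rw [ENNReal.tsum_mul_right]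
      exact ENNReal.mul_ne_top hl' (ENNReal.mul_ne_top ENNReal.ofReal_ne_top ENNReal.coe_ne_top)
    · rw [lintegral_const_mul' _ _ enorm_ne_top]
      refine mul_le_mul_right ?_ _
      obtain ⟨c, r, h⟩ := (ha j).exists_isSizedOnCube
      refine le_trans ?_ (mul_le_mul_right (hC (a j) c r h) _)
      rw [← lintegral_const_mul' _ _ ENNReal.ofReal_ne_top]
      refine lintegral_mono_ae (ae_restrict_of_ae ?_)
      filter_upwards [Measure.ae_ne volume 0] with x hx
      exact lintegral_enorm_oscIntegrand_le hn hα0 hK P (a j) hx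
  have hmS : ∀ N : ℕ, MeasurableSet
      {x : EuclideanSpace ℝ (Fin n) | (N + 1 : ℝ)⁻¹ ≤ ‖x‖ ∧ ‖x‖ ≤ N + 1} := fun N =>
    (measurableSet_le measurable_const measurable_norm).inter
      (measurableSet_le measurable_norm measurable_const)
  filter_upwards [ae_all_iff.2 fun N => (ae_restrict_iff' (hmS N)).1 (hann N),
    Measure.ae_ne volume 0] with x hx hx0
  have hx0' := norm_pos_iff.2 hx0
  obtain ⟨N, hN⟩ := exists_nat_ge (max ‖x‖ ‖x‖⁻¹)
  have h1 := (le_max_left _ _).trans hN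
  have h2 := (le_max_right _ _).trans hN
  refine (hx N ⟨?_, by linarith⟩).ne
  rw [inv_le_comm₀ (by positivity) hx0']
  linarith

/-- Termwise integration of an atomic decomposition at a point where the integrands are absolutely
summable. -/
lemma integrable_oscIntegrand_and_enorm_le_tsum {n : ℕ} {P : MvPolynomial (Fin n ⊕ Fin n) ℝ}
    {K : EuclideanSpace ℝ (Fin n) → EuclideanSpace ℝ (Fin n) → ℂ}
    {f : EuclideanSpace ℝ (Fin n) → ℂ} {l : ℕ → ℂ} {a : ℕ → EuclideanSpace ℝ (Fin n) → ℂ}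
    (hf : ∀ᵐ y, HasSum (fun j => l j * a j y) (f y)) {x : EuclideanSpace ℝ (Fin n)}
    (hfm : AEStronglyMeasurable (oscIntegrand P K f x) volume)
    (ham : ∀ j, AEStronglyMeasurable (oscIntegrand P K (a j) x) volume)
    (hfin : ∑' j, ‖l j‖ₑ * ∫⁻ y, ‖oscIntegrand P K (a j) x y‖ₑ ≠ ∞) :
    Integrable (oscIntegrand P K f x) volume ∧
      ‖oscOperator P K f x‖ₑ ≤ ∑' j, ‖l j‖ₑ * ‖oscOperator P K (a j) x‖ₑ := by
  have hm : ∀ j, AEStronglyMeasurable (fun y => l j * oscIntegrand P K (a j) x y) volume :=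
    fun j => (ham j).const_mul _
  have hnorm : ∀ j, ∫⁻ y, ‖l j * oscIntegrand P K (a j) x y‖ₑ =
      ‖l j‖ₑ * ∫⁻ y, ‖oscIntegrand P K (a j) x y‖ₑ := fun j => by
    rw [← lintegral_const_mul' _ _ enorm_ne_top]
    exact lintegral_congr fun y => enorm_mul _ _
  have hfin' : ∑' j, ∫⁻ y, ‖l j * oscIntegrand P K (a j) x y‖ₑ ≠ ∞ := by
    simpa only [hnorm] using hfin
  have heq : ∀ᵐ y, oscIntegrand P K f x y = ∑' j, l j * oscIntegrand P K (a j) x y := by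
    filter_upwards [hf] with y hy
    refine ((hy.mul_left (Complex.exp (Complex.I * (phase P x y : ℂ)) * K x y)).congr_fun
      ?_).tsum_eq.symm
    intro j
    simp only [oscIntegrand]
    ring
  refine ⟨⟨hfm, ?_⟩, ?_⟩
  · calc _ ≤ ∫⁻ y, ∑' j, ‖l j * oscIntegrand P K (a j) x y‖ₑ := by
          refine lintegral_mono_ae ?_
          filter_upwards [heq] with y hy
          rw [hy]
          exact enorm_tsum_le_tsum_enorm
      _ < ∞ := by
          rw [lintegral_tsum fun j => (hm j).enorm]
          exact hfin'.lt_top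
  · have h1 : oscOperator P K f x = ∑' j, l j * oscOperator P K (a j) x := by
      rw [oscOperator, integral_congr_ae heq, integral_tsum hm hfin']
      exact tsum_congr fun j => integral_const_mul _ _
    rw [h1]
    refine enorm_tsum_le_tsum_enorm.trans (le_of_eq ?_)
    exact tsum_congr fun j => enorm_mul _ _

/-- `T_P` maps `H¹_E` into `L¹`, with a bound which depends on `P` only through its degree. -/
lemma exists_eLpNorm_oscOperator_le_hardyENorm {n m : ℕ} (hn : 0 < n) {θ₀ : ℝ} {θ α : Fin m → ℝ}
    (hθ₀ : 0 ≤ θ₀) (hθ₀' : θ₀ < 1) (hθ : ∀ k, 0 < θ k ∧ θ k < 1) (hsum : θ₀ + ∑ k, θ k = 1)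
    (hα : Function.Injective α) (hα0 : ∀ k, α k ≠ 0) (A B : ℝ) (d : ℕ) :
    ∃ C : ℝ≥0, ∀ K : EuclideanSpace ℝ (Fin n) → EuclideanSpace ℝ (Fin n) → ℂ,
      IsProductTypeKernel θ₀ θ α A B K →
      ∀ P : MvPolynomial (Fin n ⊕ Fin n) ℝ, P.totalDegree ≤ d →
      ∀ f : EuclideanSpace ℝ (Fin n) → ℂ, MemHardyE P f →
        (∀ᵐ x, Integrable (oscIntegrand P K f x) volume) ∧
        MemLp (oscOperator P K f) 1 volume ∧
        eLpNorm (oscOperator P K f) 1 volume ≤ C * hardyENorm P f := by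
  obtain ⟨C, hC⟩ := exists_lintegral_oscOperator_atom_le hn hθ₀ hθ₀' hθ hsum hα hα0 A B d
  -- Adding `1` makes the constant nonzero, so that division moves it across the infimum.
  refine ⟨C + 1, fun K hK P hP f hf => ?_⟩
  obtain ⟨hfm, l₀, a₀, h₀⟩ := hf
  have hmeas := aestronglyMeasurable_oscIntegrand P hK.measurable hfm.1
  have hpt : ∀ (l : ℕ → ℂ) (a : ℕ → EuclideanSpace ℝ (Fin n) → ℂ),
      IsAtomicDecomposition P f l a → ∀ᵐ x, Integrable (oscIntegrand P K f x) volume ∧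
        ‖oscOperator P K f x‖ₑ ≤ ∑' j, ‖l j‖ₑ * ‖oscOperator P K (a j) x‖ₑ := by
    intro l a h
    filter_upwards [ae_tsum_lintegral_enorm_ne_top hn hθ₀ hθ₀' hθ hsum hα hα0 hK P h.atom
      h.summable, hmeas.prodMk_left, ae_all_iff.2 fun j =>
      (aestronglyMeasurable_oscIntegrand P hK.measurable (h.atom j).1).prodMk_left]
      with x hx hxf hxa
    exact integrable_oscIntegrand_and_enorm_le_tsum h.hasSum hxf hxa hx
  have hle : ∀ (l : ℕ → ℂ) (a : ℕ → EuclideanSpace ℝ (Fin n) → ℂ),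
      IsAtomicDecomposition P f l a →
      eLpNorm (oscOperator P K f) 1 volume ≤ (C + 1 : ℝ≥0) * ∑' j, ‖l j‖ₑ := by
    intro l a h
    rw [eLpNorm_one_eq_lintegral_enorm]
    calc _ ≤ ∫⁻ x, ∑' j, ‖l j‖ₑ * ‖oscOperator P K (a j) x‖ₑ :=
          lintegral_mono_ae ((hpt l a h).mono fun x hx => hx.2)
      _ = ∑' j, ‖l j‖ₑ * ∫⁻ x, ‖oscOperator P K (a j) x‖ₑ := by
          rw [lintegral_tsum fun j => ?_]
          · exact tsum_congr fun j => lintegral_const_mul' _ _ enorm_ne_top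
          · exact ((aestronglyMeasurable_oscIntegrand P hK.measurable
              (h.atom j).1).integral_prod_right').enorm.const_mul _
      _ ≤ ∑' j, ‖l j‖ₑ * (C + 1 : ℝ≥0) := by
          refine ENNReal.tsum_le_tsum fun j => mul_le_mul_right ?_ _
          exact (hC K hK P hP (a j) (h.atom j)).trans (by push_cast; exact le_self_add)
      _ = _ := by rw [ENNReal.tsum_mul_right, mul_comm]
  refine ⟨(hpt l₀ a₀ h₀).mono fun x hx => hx.1, ⟨hmeas.integral_prod_right', ?_⟩, ?_⟩
  · refine (hle l₀ a₀ h₀).trans_lt (ENNReal.mul_lt_top ENNReal.coe_lt_top (Ne.lt_top ?_))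
    simpa only [← ofReal_norm] using h₀.summable.tsum_ofReal_ne_top
  · rw [← ENNReal.div_le_iff' (by simp) ENNReal.coe_ne_top]
    refine le_iInf fun l => le_iInf fun a => le_iInf fun h => ?_
    rw [ENNReal.div_le_iff' (by simp) ENNReal.coe_ne_top]
    exact hle l a h

theorem mainTheorem4 (n m : ℕ) (hn : 0 < n) (θ₀ : ℝ) (θ α : Fin m → ℝ)
    (hθ₀ : 0 ≤ θ₀) (hθ₀_lt : θ₀ < 1) (hθ : ∀ k, 0 < θ k ∧ θ k < 1)
    (hsum : θ₀ + ∑ k, θ k = 1)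
    (hα : Function.Injective α) (hα_ne : ∀ k, α k ≠ 0)
    (A B : ℝ) (d : ℕ) :
    (∀ p : ℝ≥0∞, 1 < p → p < (ENNReal.ofReal θ₀)⁻¹ →
      ∃ C : ℝ≥0, ∀ K : EuclideanSpace ℝ (Fin n) → EuclideanSpace ℝ (Fin n) → ℂ,
        IsProductTypeKernel θ₀ θ α A B K →
        ∀ P : MvPolynomial (Fin n ⊕ Fin n) ℝ, P.totalDegree ≤ d →
        ∀ f : EuclideanSpace ℝ (Fin n) → ℂ, MemLp f p volume →
          (∀ᵐ x, Integrable (oscIntegrand P K f x) volume) ∧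
          MemLp (oscOperator P K f) p volume ∧
          eLpNorm (oscOperator P K f) p volume ≤ C * eLpNorm f p volume) ∧
    (∃ C : ℝ≥0, ∀ K : EuclideanSpace ℝ (Fin n) → EuclideanSpace ℝ (Fin n) → ℂ,
        IsProductTypeKernel θ₀ θ α A B K →
        ∀ P : MvPolynomial (Fin n ⊕ Fin n) ℝ, P.totalDegree ≤ d →
        ∀ f : EuclideanSpace ℝ (Fin n) → ℂ, MemHardyE P f →
          (∀ᵐ x, Integrable (oscIntegrand P K f x) volume) ∧
          MemLp (oscOperator P K f) 1 volume ∧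
          eLpNorm (oscOperator P K f) 1 volume ≤ C * hardyENorm P f) := by
  refine ⟨fun p hp hpθ => ?_,
    exists_eLpNorm_oscOperator_le_hardyENorm hn hθ₀ hθ₀_lt hθ hsum hα hα_ne A B d⟩
  obtain ⟨C, hC⟩ := exists_eLpNorm_oscOperator_le hn hθ₀ hθ hsum hα hα_ne A B hp hpθ
  exact ⟨C, fun K hK P _ f hf => hC K hK P f hf⟩
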